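/- Let $\omega:[0,\infty)\to[0,\infty)$ be a non-quasianalytic weight function, i.e. an increasing (non-decreasing) continuous function such that: $(\alpha)$ there is $L\ge 1$ with $\omega(2t)\le L\omega(t)+L$ for $t\ge 0$; $(\beta)$ $\int_1^\infty \frac{\omega(t)}{1+t^2}\,dt<\infty$; $(\gamma)$ $\log t=O(\omega(t))$ as $t\to\infty$; $(\delta)$ $\varphi_\omega(t)=\omega(e^t)$ is convex. Put $\omega(x)=\omega(|x|)$ for $x\in\mathbb{R}^d$ ($|\cdot|$ Euclidean), and let $\varphi_\omega^*(t)=\sup_{s\ge 0}\{st-\varphi_\omega(s)\}\in(-\infty,+\infty]$, $t\ge 0$. Let $\mathcal{S}_\omega(\mathbb{R}^d)$ be the space of all $f\in L^1(\mathbb{R}^d)$ such that $f$ and $\widehat f(\xi)=\int e^{-it\cdot\xi}f(t)\,dt$ are $C^\infty$ and, for all $\lambda>0$ and $\alpha\in\mathbb{N}_0^d$, $\sup_x|D^\alpha f(x)|e^{\lambda\omega(x)}<\infty$ and $\sup_\xi|D^\alpha\widehat f(\xi)|e^{\lambda\omega(\xi)}<\infty$, with the topology given by these seminorms. Let $\mathcal{S}'_\omega(\mathbb{R}^d)$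 be the space of continuous conjugate-linear functionals $a:f\mapsto\langle a,f\rangle$ on $\mathcal{S}_\omega(\mathbb{R}^d)$. For $a\in\mathcal{S}'_\omega(\mathbb{R}^d)$ and $\psi,f\in\mathcal{S}_\omega(\mathbb{R}^d)$ let $$V_\psi a(x,\xi)=\langle a,\ e^{i(\cdot)\cdot\xi}\psi(\cdot-x)\rangle,\qquad (a*f)(x)=\langle a,\ \overline{f(x-\cdot)}\rangle .$$ **Theorem.** For $a\in\mathcal{S}'_\omega(\mathbb{R}^d)$ and $0\ne\psi\in\mathcal{S}_\omega(\mathbb{R}^d)$ the following are equivalent: 1. $a$ is an $\omega$-convolutor, i.e. $a*f\in\mathcal{S}_\omega(\mathbb{R}^d)$ for every $f\in\mathcal{S}_\omega(\mathbb{R}^d)$. 2. $V_\psi a$ is $C^\infty$ on $\mathbb{R}^{2d}$, and for every $\mu>0$ there exist $C_\mu,\lambda_\mu>0$ such that for all $\alpha,\beta\in\mathbb{N}_0^d$ and $x,\xi\in\mathbb{R}^d$ $$|D_x^\alpha D_\xi^\beta V_\psi a(x,\xi)|\le C_\mu\, e^{\mu\varphi_\omega^*\left(\frac{|\alpha|}{\mu}\right)}e^{\mu\varphi_\omega^*\left(\frac{|\beta|}{\mu}\right)}e^{-\mu\omega(x)}e^{\lambda_\mu\omega(\xi)}$$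 (the right-hand side is $+\infty$ where $\varphi_\omega^*$ is). 3. For every $\mu>0$ there exist $C_\mu,\lambda_\mu>0$ such that for all $x,\xi\in\mathbb{R}^d$ $$|V_\psi a(x,\xi)|\le C_\mu\, e^{-\mu\omega(x)}e^{\lambda_\mu\omega(\xi)} .$$ -/

import Mathlib

noncomputable section

/-- The Euclidean space `ℝ^d`. -/
abbrev Rd (d : ℕ) : Type := EuclideanSpace ℝ (Fin d)

/-- Non-quasianalytic weight functions in the sense of Braun, Meise and Taylor. Only the values on
`[0, ∞)` are relevant. -/
structure WeightFunction where
  toFun : ℝ → ℝ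
  nonneg : ∀ t, 0 ≤ t → 0 ≤ toFun t
  monotoneOn : MonotoneOn toFun (Set.Ici 0)
  continuousOn : ContinuousOn toFun (Set.Ici 0)
  alpha : ∃ L : ℝ, 1 ≤ L ∧ ∀ t, 0 ≤ t → toFun (2 * t) ≤ L * toFun t + L
  beta : MeasureTheory.IntegrableOn (fun t => toFun t / (1 + t ^ 2)) (Set.Ici 1)
  gamma : Asymptotics.IsBigO Filter.atTop Real.log toFun
  delta : ConvexOn ℝ Set.univ (fun t => toFun (Real.exp t))

instance : CoeFun WeightFunction (fun _ => ℝ → ℝ) := ⟨WeightFunction.toFun⟩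

/-- The Young conjugate `φ*(t) = sup_{s ≥ 0} (s t - ω(e^s))`, as an extended real number (it is
`+∞` for large `t` when `ω` is equivalent to the logarithm). -/
def WeightFunction.youngConj (ω : WeightFunction) (t : ℝ) : EReal :=
  ⨆ (s : ℝ) (_ : 0 ≤ s), ((s * t - ω (Real.exp s) : ℝ) : EReal)

/-- The partial derivative `∂_i f`. -/
def pderiv {d : ℕ} (i : Fin d) (f : Rd d → ℂ) : Rd d → ℂ :=
  fun x => fderiv ℝ f x (EuclideanSpace.single i 1)

/-- The partial derivative `∂^α f = ∂_0^{α_0} ⋯ ∂_{d-1}^{α_{d-1}} f`. (Up to a power of `-i`, of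
modulus one, this is `D^α f`; only moduli of such derivatives are used.) -/
def multiDeriv {d : ℕ} (α : Fin d → ℕ) (f : Rd d → ℂ) : Rd d → ℂ :=
  (List.finRange d).foldr (fun i g => (pderiv i)^[α i] g) f

/-- The Fourier transform `∫ e^{-i t·ξ} f(t) dt`. -/
def fourierHat {d : ℕ} (f : Rd d → ℂ) (ξ : Rd d) : ℂ :=
  ∫ t, Complex.exp (-(Complex.I * (inner ℝ t ξ : ℝ))) * f t

/-- `f` is smooth and `sup_x |∂^α f(x)| e^{lω(x)} < ∞` for all `α` and all `l > 0`. -/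
def HasDecay {d : ℕ} (ω : WeightFunction) (f : Rd d → ℂ) : Prop :=
  ContDiff ℝ (⊤ : ℕ∞) f ∧ ∀ l : ℝ, 0 < l → ∀ α : Fin d → ℕ,
    BddAbove (Set.range fun x => ‖multiDeriv α f x‖ * Real.exp (l * ω ‖x‖))

/-! Helper facts on derivatives and decay. -/

section Helpers

variable {d : ℕ} {ω : WeightFunction} {f g : Rd d → ℂ}

/-- Iterated partial derivatives along a list of directions. -/
def listDeriv {d : ℕ} (L : List (Fin d)) (f : Rd d → ℂ) : Rd d → ℂ := L.foldr pderiv f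

theorem pderiv_contDiff (i : Fin d) (hf : ContDiff ℝ (⊤ : ℕ∞) f) :
    ContDiff ℝ (⊤ : ℕ∞) (pderiv i f) := by
  unfold pderiv
  exact (hf.fderiv_right (by norm_cast)).clm_apply contDiff_const

theorem listDeriv_contDiff (L : List (Fin d)) (hf : ContDiff ℝ (⊤ : ℕ∞) f) :
    ContDiff ℝ (⊤ : ℕ∞) (listDeriv L f) := by
  induction L with
  | nil => exact hf
  | cons i L ih => exact pderiv_contDiff i ih

theorem smooth_differentiable (hf : ContDiff ℝ (⊤ : ℕ∞) f) : Differentiable ℝ f :=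
  hf.differentiable (by simp)

theorem pderiv_comm (i j : Fin d) (hf : ContDiff ℝ (⊤ : ℕ∞) f) :
    pderiv i (pderiv j f) = pderiv j (pderiv i f) := by
  have h2 : Differentiable ℝ (fderiv ℝ f) :=
    (hf.fderiv_right (m := (⊤ : ℕ∞)) (by norm_cast)).differentiable (by simp)
  have key : ∀ (v w x : Rd d),
      fderiv ℝ (fun y => fderiv ℝ f y v) x w = fderiv ℝ (fderiv ℝ f) x w v := by
    intro v w x
    rw [fderiv_clm_apply (h2 x) (differentiableAt_const v)]
    simp
  funext x
  unfold pderiv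
  rw [key, key]
  have hs : IsSymmSndFDerivAt ℝ f x := by
    refine hf.contDiffAt.isSymmSndFDerivAt ?_
    simp only [minSmoothness_of_isRCLikeNormedField]
    exact WithTop.coe_le_coe.2 le_top
  exact hs _ _

theorem listDeriv_perm {L M : List (Fin d)} (h : L.Perm M) (hf : ContDiff ℝ (⊤ : ℕ∞) f) :
    listDeriv L f = listDeriv M f := by
  induction h with
  | nil => rfl
  | cons i _ ih => exact congrArg (pderiv i) ih
  | swap i j L => exact pderiv_comm _ _ (listDeriv_contDiff L hf)
  | trans _ _ h1 h2 => exact h1.trans h2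

/-- The list in which each `i` is repeated `α i` times, in increasing order. -/
def multiList {d : ℕ} (α : Fin d → ℕ) : List (Fin d) :=
  (List.finRange d).flatMap fun i => List.replicate (α i) i

theorem multiDeriv_eq_listDeriv (α : Fin d → ℕ) (f : Rd d → ℂ) :
    multiDeriv α f = listDeriv (multiList α) f := by
  have h1 : ∀ (n : ℕ) (i : Fin d) (g : Rd d → ℂ),
      (List.replicate n i).foldr pderiv g = (pderiv i)^[n] g := by
    intro n i g
    induction n with
    | zero => rfl
    | succ n ih => rw [List.replicate_succ, List.foldr_cons, ih, Function.iterate_succ_apply']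
  unfold multiDeriv listDeriv multiList
  induction List.finRange d with
  | nil => rfl
  | cons i l ih => rw [List.flatMap_cons, List.foldr_append, ← ih, h1, List.foldr_cons]

theorem listDeriv_eq_multiDeriv (L : List (Fin d)) (hf : ContDiff ℝ (⊤ : ℕ∞) f) :
    listDeriv L f = multiDeriv (fun i => L.count i) f := by
  rw [multiDeriv_eq_listDeriv]
  refine listDeriv_perm ?_ hf
  rw [List.perm_iff_count]
  intro a
  simp only [multiList, List.count_flatMap, Function.comp_def, List.count_replicate]
  have : ((List.finRange d).map fun i => if (i == a) = true then L.count i else 0).sum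
      = ∑ i : Fin d, if i = a then L.count i else 0 := by
    rw [← List.ofFn_eq_map, List.sum_ofFn]
    simp
  rw [this]
  simp

theorem hasDecay_iff : HasDecay ω f ↔ ContDiff ℝ (⊤ : ℕ∞) f ∧ ∀ l : ℝ, 0 < l →
    ∀ L : List (Fin d), ∃ C, ∀ x, ‖listDeriv L f x‖ * Real.exp (l * ω ‖x‖) ≤ C := by
  constructor
  · rintro ⟨h1, h2⟩
    refine ⟨h1, fun l hl L => ?_⟩
    obtain ⟨C, hC⟩ := h2 l hl (fun i => L.count i)
    exact ⟨C, fun x => listDeriv_eq_multiDeriv L h1 ▸ hC ⟨x, rfl⟩⟩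
  · rintro ⟨h1, h2⟩
    refine ⟨h1, fun l hl α => ?_⟩
    obtain ⟨C, hC⟩ := h2 l hl (multiList α)
    refine ⟨C, ?_⟩
    rintro _ ⟨x, rfl⟩
    rw [multiDeriv_eq_listDeriv]
    exact hC x

theorem pderiv_add (i : Fin d) (hf : ContDiff ℝ (⊤ : ℕ∞) f) (hg : ContDiff ℝ (⊤ : ℕ∞) g) :
    pderiv i (f + g) = pderiv i f + pderiv i g := by
  funext x
  simp only [pderiv, Pi.add_apply]
  rw [fderiv_add (smooth_differentiable hf x) (smooth_differentiable hg x)]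
  rfl

theorem listDeriv_add (L : List (Fin d)) (hf : ContDiff ℝ (⊤ : ℕ∞) f)
    (hg : ContDiff ℝ (⊤ : ℕ∞) g) : listDeriv L (f + g) = listDeriv L f + listDeriv L g := by
  induction L with
  | nil => rfl
  | cons i L ih =>
    change pderiv i (listDeriv L (f + g)) = _
    rw [ih, pderiv_add i (listDeriv_contDiff L hf) (listDeriv_contDiff L hg)]
    rfl

theorem pderiv_smul (i : Fin d) (c : ℂ) (hf : ContDiff ℝ (⊤ : ℕ∞) f) :
    pderiv i (c • f) = c • pderiv i f := by
  funext x
  simp only [pderiv, Pi.smul_apply]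
  rw [fderiv_const_smul (smooth_differentiable hf x)]
  rfl

theorem listDeriv_smul (L : List (Fin d)) (c : ℂ) (hf : ContDiff ℝ (⊤ : ℕ∞) f) :
    listDeriv L (c • f) = c • listDeriv L f := by
  induction L with
  | nil => rfl
  | cons i L ih =>
    change pderiv i (listDeriv L (c • f)) = _
    rw [ih, pderiv_smul i c (listDeriv_contDiff L hf)]
    rfl

theorem multiDeriv_add (α : Fin d → ℕ) (hf : ContDiff ℝ (⊤ : ℕ∞) f)
    (hg : ContDiff ℝ (⊤ : ℕ∞) g) : multiDeriv α (f + g) = multiDeriv α f + multiDeriv α g := by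
  simp only [multiDeriv_eq_listDeriv]
  exact listDeriv_add _ hf hg

theorem multiDeriv_smul (α : Fin d → ℕ) (c : ℂ) (hf : ContDiff ℝ (⊤ : ℕ∞) f) :
    multiDeriv α (c • f) = c • multiDeriv α f := by
  simp only [multiDeriv_eq_listDeriv]
  exact listDeriv_smul _ c hf

theorem HasDecay.add (hf : HasDecay ω f) (hg : HasDecay ω g) : HasDecay ω (f + g) := by
  rw [hasDecay_iff] at *
  refine ⟨hf.1.add hg.1, fun l hl L => ?_⟩
  obtain ⟨C, hC⟩ := hf.2 l hl L
  obtain ⟨D, hD⟩ := hg.2 l hl L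
  refine ⟨C + D, fun x => ?_⟩
  rw [listDeriv_add L hf.1 hg.1]
  refine le_trans ?_ (add_le_add (hC x) (hD x))
  rw [← add_mul]
  exact mul_le_mul_of_nonneg_right (norm_add_le _ _) (Real.exp_nonneg _)

theorem HasDecay.smul (c : ℂ) (hf : HasDecay ω f) : HasDecay ω (c • f) := by
  rw [hasDecay_iff] at *
  refine ⟨contDiff_const.smul hf.1, fun l hl L => ?_⟩
  obtain ⟨C, hC⟩ := hf.2 l hl L
  refine ⟨‖c‖ * C, fun x => ?_⟩
  rw [listDeriv_smul L c hf.1, Pi.smul_apply, norm_smul, mul_assoc]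
  exact mul_le_mul_of_nonneg_left (hC x) (norm_nonneg _)

theorem HasDecay.zero : HasDecay ω (0 : Rd d → ℂ) := by
  have h : ∀ L : List (Fin d), listDeriv L (0 : Rd d → ℂ) = 0 := by
    intro L
    have := listDeriv_smul L 0 (f := (0 : Rd d → ℂ)) contDiff_const
    simpa using this
  rw [hasDecay_iff]
  exact ⟨contDiff_const, fun l _ L => ⟨0, fun x => by simp [h]⟩⟩

theorem HasDecay.pderiv (i : Fin d) (hf : HasDecay ω f) : HasDecay ω (pderiv i f) := by
  rw [hasDecay_iff] at *
  refine ⟨pderiv_contDiff i hf.1, fun l hl L => ?_⟩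
  obtain ⟨C, hC⟩ := hf.2 l hl (L ++ [i])
  refine ⟨C, fun x => ?_⟩
  have : listDeriv (L ++ [i]) f = listDeriv L (_root_.pderiv i f) := by
    simp [listDeriv, List.foldr_append]
  rw [← this]
  exact hC x

/-- The character `t ↦ e^{i t·ξ}`. -/
def character {d : ℕ} (ξ : Rd d) : Rd d → ℂ := fun t => Complex.exp (Complex.I * (inner ℝ t ξ : ℝ))

theorem norm_character (ξ t : Rd d) : ‖character ξ t‖ = 1 := by
  unfold character
  rw [mul_comm, Complex.norm_exp_ofReal_mul_I]

theorem character_hasFDerivAt (ξ t : Rd d) :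
    HasFDerivAt (character ξ) (character ξ t • (Complex.I •
      (Complex.ofRealCLM.comp (innerSL ℝ ξ)))) t := by
  have h : HasFDerivAt (fun t : Rd d => Complex.I * ((inner ℝ t ξ : ℝ) : ℂ))
      (Complex.I • (Complex.ofRealCLM.comp (innerSL ℝ ξ))) t := by
    have h0 : HasFDerivAt (fun t : Rd d => ((inner ℝ t ξ : ℝ) : ℂ))
        (Complex.ofRealCLM.comp (innerSL ℝ ξ)) t := by
      have := (Complex.ofRealCLM.comp (innerSL ℝ ξ)).hasFDerivAt (x := t)
      refine this.congr_of_eventuallyEq (Filter.Eventually.of_forall fun y => ?_)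
      simp [real_inner_comm]
    exact h0.const_mul Complex.I
  exact h.cexp

theorem character_contDiff (ξ : Rd d) : ContDiff ℝ (⊤ : ℕ∞) (character ξ) := by
  unfold character
  refine Complex.contDiff_exp.comp ?_
  refine contDiff_const.mul ?_
  exact Complex.ofRealCLM.contDiff.comp (contDiff_id.inner ℝ contDiff_const)

theorem pderiv_character_mul (i : Fin d) (ξ : Rd d) (hf : ContDiff ℝ (⊤ : ℕ∞) f) :
    pderiv i (character ξ * f) =
      (Complex.I * (ξ i : ℂ)) • (character ξ * f) + character ξ * pderiv i f := by
  funext x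
  have h := (character_hasFDerivAt ξ x).mul (smooth_differentiable hf x).hasFDerivAt
  simp only [Pi.add_apply, Pi.smul_apply, Pi.mul_apply, pderiv]
  rw [h.fderiv]
  simp [EuclideanSpace.inner_single_right]
  ring

theorem HasDecay.character_mul (ξ : Rd d) (hf : HasDecay ω f) :
    HasDecay ω (character ξ * f) := by
  rw [hasDecay_iff]
  refine ⟨(character_contDiff ξ).mul hf.1, fun l hl L => ?_⟩
  induction L using List.reverseRecOn generalizing f with
  | nil =>
    obtain ⟨C, hC⟩ := (hasDecay_iff.1 hf).2 l hl []
    refine ⟨C, fun x => ?_⟩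
    have : ‖listDeriv [] (character ξ * f) x‖ = ‖listDeriv [] f x‖ := by
      simp [listDeriv, norm_character]
    rw [this]
    exact hC x
  | append_singleton L i ih =>
    have e : listDeriv (L ++ [i]) (character ξ * f) =
        (Complex.I * (ξ i : ℂ)) • listDeriv L (character ξ * f)
          + listDeriv L (character ξ * _root_.pderiv i f) := by
      have : listDeriv (L ++ [i]) (character ξ * f)
          = listDeriv L (_root_.pderiv i (character ξ * f)) := by
        simp [listDeriv, List.foldr_append]
      have s1 : ContDiff ℝ (⊤ : ℕ∞) (character ξ * f) := (character_contDiff ξ).mul hf.1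
      have s2 : ContDiff ℝ (⊤ : ℕ∞) (character ξ * _root_.pderiv i f) :=
        (character_contDiff ξ).mul (pderiv_contDiff i hf.1)
      have s3 : ContDiff ℝ (⊤ : ℕ∞) ((Complex.I * (ξ i : ℂ)) • (character ξ * f)) :=
        contDiff_const.smul s1
      rw [this, pderiv_character_mul i ξ hf.1, listDeriv_add L s3 s2,
        listDeriv_smul L _ s1]
    obtain ⟨C, hC⟩ := ih hf
    obtain ⟨D, hD⟩ := ih (hf.pderiv i)
    refine ⟨‖Complex.I * (ξ i : ℂ)‖ * C + D, fun x => ?_⟩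
    rw [e]
    have h1 := mul_le_mul_of_nonneg_left (hC x) (norm_nonneg (Complex.I * (ξ i : ℂ)))
    refine le_trans ?_ (add_le_add h1 (hD x))
    rw [← mul_assoc, ← add_mul, ← norm_mul]
    exact mul_le_mul_of_nonneg_right (norm_add_le _ _) (Real.exp_nonneg _)

theorem WeightFunction.add_le (ω : WeightFunction) : ∃ L : ℝ, 1 ≤ L ∧ ∀ s t, 0 ≤ s → 0 ≤ t →
    ω (s + t) ≤ L * (ω s + ω t) + L := by
  obtain ⟨L, hL, h⟩ := ω.alpha
  refine ⟨L, hL, fun s t hs ht => ?_⟩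
  have key : ∀ s t, 0 ≤ s → s ≤ t → ω (s + t) ≤ L * (ω s + ω t) + L := by
    intro s t hs hst
    have h1 : ω (s + t) ≤ ω (2 * t) :=
      ω.monotoneOn (Set.mem_Ici.2 (by linarith)) (Set.mem_Ici.2 (by linarith)) (by linarith)
    have h2 := h t (hs.trans hst)
    have h3 := mul_nonneg (by linarith : (0 : ℝ) ≤ L) (ω.nonneg s hs)
    change ω.toFun _ ≤ _ at h1
    nlinarith
  rcases le_total s t with hst | hst
  · exact key s t hs hst
  · rw [add_comm s t, add_comm (ω s)]
    exact key t s ht hst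

theorem pderiv_translate (i : Fin d) (x : Rd d) (f : Rd d → ℂ) :
    pderiv i (fun t => f (t - x)) = fun t => pderiv i f (t - x) := by
  funext t
  simp only [pderiv]
  rw [fderiv_comp_sub]

theorem HasDecay.translate (x : Rd d) (hf : HasDecay ω f) : HasDecay ω (fun t => f (t - x)) := by
  rw [hasDecay_iff] at *
  refine ⟨hf.1.comp (contDiff_id.sub contDiff_const), fun l hl L => ?_⟩
  have e : listDeriv L (fun t => f (t - x)) = fun t => listDeriv L f (t - x) := by
    induction L with
    | nil => rfl
    | cons i L ih =>
      change _root_.pderiv i (listDeriv L _) = _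
      rw [ih, pderiv_translate]
      rfl
  obtain ⟨K, hK, hadd⟩ := ω.add_le
  obtain ⟨C, hC⟩ := hf.2 (l * K) (by positivity) L
  refine ⟨C * Real.exp (l * (K * ω ‖x‖ + K)), fun t => ?_⟩
  rw [e]
  have h1 : ω ‖t‖ ≤ K * (ω ‖t - x‖ + ω ‖x‖) + K := by
    refine le_trans (ω.monotoneOn (norm_nonneg _) ?_ ?_)
      (hadd ‖t - x‖ ‖x‖ (norm_nonneg _) (norm_nonneg _))
    · exact Set.mem_Ici.2 (by positivity)
    · simpa using norm_add_le (t - x) x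
  calc ‖listDeriv L f (t - x)‖ * Real.exp (l * ω ‖t‖)
      ≤ ‖listDeriv L f (t - x)‖ * (Real.exp (l * K * ω ‖t - x‖) *
          Real.exp (l * (K * ω ‖x‖ + K))) := by
        refine mul_le_mul_of_nonneg_left ?_ (norm_nonneg _)
        rw [← Real.exp_add]
        refine Real.exp_le_exp.2 ?_
        nlinarith
    _ ≤ _ := by
        rw [← mul_assoc]
        exact mul_le_mul_of_nonneg_right (hC _) (Real.exp_nonneg _)

theorem HasDecay.conj (hf : HasDecay ω f) : HasDecay ω (fun t => starRingEnd ℂ (f t)) := by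
  rw [hasDecay_iff] at *
  refine ⟨Complex.conjCLE.contDiff.comp hf.1, fun l hl L => ?_⟩
  have e : listDeriv L (fun t => starRingEnd ℂ (f t)) = fun t => starRingEnd ℂ (listDeriv L f t) := by
    induction L with
    | nil => rfl
    | cons i L ih =>
      change _root_.pderiv i (listDeriv L _) = _
      rw [ih]
      funext t
      have h := (smooth_differentiable (listDeriv_contDiff L hf.1) t).hasFDerivAt
      have h' := (Complex.conjCLE.toContinuousLinearMap.hasFDerivAt).comp t h
      have h2 : fderiv ℝ (fun t => starRingEnd ℂ (listDeriv L f t)) t = _ := h'.fderiv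
      simp only [_root_.pderiv]
      rw [h2]
      simp [listDeriv, _root_.pderiv]
  obtain ⟨C, hC⟩ := hf.2 l hl L
  refine ⟨C, fun x => ?_⟩
  rw [e, Complex.norm_conj]
  exact hC x

theorem HasDecay.reflect (hf : HasDecay ω f) : HasDecay ω (fun t => f (-t)) := by
  rw [hasDecay_iff] at *
  refine ⟨hf.1.comp contDiff_neg, fun l hl L => ?_⟩
  have e : ∀ t, ‖listDeriv L (fun t => f (-t)) t‖ = ‖listDeriv L f (-t)‖ := by
    have : ∃ c : ℂ, ‖c‖ = 1 ∧
        listDeriv L (fun t => f (-t)) = c • fun t => listDeriv L f (-t) := by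
      induction L with
      | nil => exact ⟨1, by simp, by simp [listDeriv]⟩
      | cons i L ih =>
        obtain ⟨c, hc, h⟩ := ih
        refine ⟨-c, by simpa, ?_⟩
        change _root_.pderiv i (listDeriv L _) = _
        have hs : ContDiff ℝ (⊤ : ℕ∞) (fun t => listDeriv L f (-t)) :=
          (listDeriv_contDiff L hf.1).comp contDiff_neg
        rw [h, pderiv_smul i c hs]
        funext t
        have h2 : fderiv ℝ (fun t => listDeriv L f (-t)) t = -fderiv ℝ (listDeriv L f) (-t) := by
          have h3 := (smooth_differentiable (listDeriv_contDiff L hf.1) (-t)).hasFDerivAt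
          have h4 := (h3.comp t (hasFDerivAt_id t).neg).fderiv
          refine Eq.trans h4 ?_
          ext v
          simp
        simp only [_root_.pderiv, Pi.smul_apply]
        rw [h2]
        simp [listDeriv, _root_.pderiv]
    obtain ⟨c, hc, h⟩ := this
    intro t
    rw [h, Pi.smul_apply, norm_smul, hc, one_mul]
  obtain ⟨C, hC⟩ := hf.2 l hl L
  refine ⟨C, fun x => ?_⟩
  rw [e, ← norm_neg x]
  exact hC (-x)

theorem fourierHat_eq (f : Rd d → ℂ) (ξ : Rd d) :
    fourierHat f ξ = ∫ t, character (-ξ) t * f t := by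
  simp [fourierHat, character, inner_neg_right]

theorem integrable_character_mul (ξ : Rd d) (hf : MeasureTheory.Integrable f) :
    MeasureTheory.Integrable (character ξ * f) := by
  refine hf.bdd_mul (c := 1) (character_contDiff ξ).continuous.aestronglyMeasurable ?_
  exact Filter.Eventually.of_forall fun x => (norm_character ξ x).le

theorem fourierHat_add (hf : MeasureTheory.Integrable f) (hg : MeasureTheory.Integrable g) :
    fourierHat (f + g) = fourierHat f + fourierHat g := by
  funext ξ
  simp only [fourierHat_eq, Pi.add_apply, mul_add]
  exact MeasureTheory.integral_add (integrable_character_mul _ hf) (integrable_character_mul _ hg)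

theorem fourierHat_smul (c : ℂ) (f : Rd d → ℂ) : fourierHat (c • f) = c • fourierHat f := by
  funext ξ
  simp only [fourierHat_eq, Pi.smul_apply]
  rw [← MeasureTheory.integral_smul]
  congr 1
  funext t
  simp only [smul_eq_mul]
  ring

theorem fourierHat_translate (x : Rd d) (f : Rd d → ℂ) :
    fourierHat (fun t => f (t - x)) = character (-x) * fourierHat f := by
  funext ξ
  simp only [fourierHat_eq, Pi.mul_apply]
  rw [← MeasureTheory.integral_add_right_eq_self _ x, ← MeasureTheory.integral_const_mul]
  congr 1
  funext t
  simp only [character, add_sub_cancel_right, ← mul_assoc, ← Complex.exp_add]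
  congr 2
  rw [inner_add_left, inner_neg_right x, inner_neg_right ξ, real_inner_comm x ξ]
  push_cast
  ring

theorem fourierHat_modulate (η : Rd d) (f : Rd d → ℂ) :
    fourierHat (character η * f) = fun ξ => fourierHat f (ξ - η) := by
  funext ξ
  simp only [fourierHat_eq, Pi.mul_apply]
  congr 1
  funext t
  simp only [character, ← mul_assoc, ← Complex.exp_add]
  congr 2
  rw [neg_sub, inner_sub_right, inner_neg_right]
  push_cast
  ring

theorem fourierHat_conj (f : Rd d → ℂ) : fourierHat (fun t => starRingEnd ℂ (f t)) =
    fun ξ => starRingEnd ℂ (fourierHat f (-ξ)) := by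
  funext ξ
  simp only [fourierHat]
  rw [← integral_conj]
  congr 1
  funext t
  rw [map_mul, ← Complex.exp_conj]
  simp [inner_neg_right]

theorem fourierHat_reflect (f : Rd d → ℂ) : fourierHat (fun t => f (-t)) =
    fun ξ => fourierHat f (-ξ) := by
  funext ξ
  simp only [fourierHat]
  rw [← MeasureTheory.integral_neg_eq_self]
  simp [inner_neg_right, inner_neg_left]

end Helpers

/-- The functions of the space `S_ω(ℝ^d)`, as a linear subspace of all functions. -/
def ultraSubmodule (ω : WeightFunction) (d : ℕ) : Submodule ℂ (Rd d → ℂ) where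
  carrier := {f | MeasureTheory.Integrable f ∧ HasDecay ω f ∧ HasDecay ω (fourierHat f)}
  zero_mem' := by
    refine ⟨MeasureTheory.integrable_zero _ _ _, HasDecay.zero, ?_⟩
    have : fourierHat (0 : Rd d → ℂ) = 0 := by
      funext ξ
      simp [fourierHat]
    rw [this]
    exact HasDecay.zero
  add_mem' := by
    rintro f g ⟨f1, f2, f3⟩ ⟨g1, g2, g3⟩
    refine ⟨f1.add g1, f2.add g2, ?_⟩
    rw [fourierHat_add f1 g1]
    exact f3.add g3
  smul_mem' := by
    rintro c f ⟨f1, f2, f3⟩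
    refine ⟨f1.smul c, f2.smul c, ?_⟩
    rw [fourierHat_smul]
    exact f3.smul c

/-- The space `S_ω(ℝ^d)`. -/
def UltraSchwartz (ω : WeightFunction) (d : ℕ) : Type := ultraSubmodule ω d

namespace UltraSchwartz

variable {ω : WeightFunction} {d : ℕ}

instance : AddCommGroup (UltraSchwartz ω d) := inferInstanceAs (AddCommGroup (ultraSubmodule ω d))

instance : Module ℂ (UltraSchwartz ω d) := inferInstanceAs (Module ℂ (ultraSubmodule ω d))

/-- The underlying function. -/
def fn (f : UltraSchwartz ω d) : Rd d → ℂ := f.1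

/-- The seminorm `sup_x |∂^α g(x)| e^{lω(x)}`, where `g = T f` for a linear map `T` with values in
functions of rapid decay. -/
def weightedSeminorm (T : UltraSchwartz ω d →ₗ[ℂ] (Rd d → ℂ)) (hT : ∀ f, HasDecay ω (T f))
    (l : Set.Ioi (0 : ℝ)) (α : Fin d → ℕ) : Seminorm ℂ (UltraSchwartz ω d) :=
  Seminorm.of (fun f => ⨆ x, ‖multiDeriv α (T f) x‖ * Real.exp (l * ω ‖x‖))
    (by
      intro f g
      refine ciSup_le fun x => ?_
      rw [map_add, multiDeriv_add α (hT f).1 (hT g).1]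
      refine le_trans ?_ (add_le_add (le_ciSup ((hT f).2 l l.2 α) x)
        (le_ciSup ((hT g).2 l l.2 α) x))
      rw [← add_mul]
      exact mul_le_mul_of_nonneg_right (norm_add_le _ _) (Real.exp_nonneg _))
    (by
      intro c f
      rw [map_smul, multiDeriv_smul α c (hT f).1, Real.mul_iSup_of_nonneg (norm_nonneg c)]
      simp only [Pi.smul_apply, norm_smul, mul_assoc])

/-- The inclusion of `S_ω(ℝ^d)` into the functions. -/
def fnLinear (ω : WeightFunction) (d : ℕ) : UltraSchwartz ω d →ₗ[ℂ] (Rd d → ℂ) :=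
  (ultraSubmodule ω d).subtype

/-- The Fourier transform as a linear map on `S_ω(ℝ^d)`. -/
def hatLinear (ω : WeightFunction) (d : ℕ) : UltraSchwartz ω d →ₗ[ℂ] (Rd d → ℂ) where
  toFun f := fourierHat f.fn
  map_add' f g := fourierHat_add f.2.1 g.2.1
  map_smul' c f := fourierHat_smul c f.fn

/-- The family of all seminorms `sup |∂^α f| e^{lω}` and `sup |∂^α f̂| e^{lω}`, for `l > 0` and
multi-indices `α`. -/
def seminorms (ω : WeightFunction) (d : ℕ) : SeminormFamily ℂ (UltraSchwartz ω d)
    (Bool × Set.Ioi (0 : ℝ) × (Fin d → ℕ)) := fun i =>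
  if i.1 then weightedSeminorm (hatLinear ω d) (fun f => f.2.2.2) i.2.1 i.2.2
  else weightedSeminorm (fnLinear ω d) (fun f => f.2.2.1) i.2.1 i.2.2

instance : Nonempty (Bool × Set.Ioi (0 : ℝ) × (Fin d → ℕ)) := ⟨(true, ⟨1, Set.mem_Ioi.2 one_pos⟩, 0)⟩

/-- The locally convex topology of `S_ω(ℝ^d)`. -/
instance : TopologicalSpace (UltraSchwartz ω d) := (seminorms ω d).moduleFilterBasis.topology

/-- The phase shift `Π(x, ξ) ψ (t) = e^{i t·ξ} ψ(t - x)`. -/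
def phaseShift (x ξ : Rd d) (ψ : UltraSchwartz ω d) : UltraSchwartz ω d :=
  ⟨fun t => Complex.exp (Complex.I * (inner ℝ t ξ : ℝ)) * ψ.fn (t - x), by
    obtain ⟨f, f1, f2, f3⟩ := ψ
    change character ξ * (fun t => f (t - x)) ∈ ultraSubmodule ω d
    refine ⟨integrable_character_mul ξ (f1.comp_sub_right x), (f2.translate x).character_mul ξ, ?_⟩
    rw [fourierHat_modulate, fourierHat_translate]
    exact (f3.character_mul (-x)).translate ξ⟩

/-- The function `t ↦ conj (f (x - t))`. -/
def conjReflect (x : Rd d) (f : UltraSchwartz ω d) : UltraSchwartz ω d :=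
  ⟨fun t => starRingEnd ℂ (f.fn (x - t)), by
    obtain ⟨f, f1, f2, f3⟩ := f
    have e : (fun t => starRingEnd ℂ (f (x - t))) =
        fun t => (fun s => starRingEnd ℂ ((fun u => f (-u)) s)) (t - x) := by
      funext t
      simp
    change (fun t => starRingEnd ℂ (f (x - t))) ∈ ultraSubmodule ω d
    refine ⟨?_, ?_, ?_⟩
    · exact Complex.conjCLE.toContinuousLinearMap.integrable_comp (f1.comp_sub_left x)
    · rw [e]
      exact f2.reflect.conj.translate x
    · rw [e, fourierHat_translate x (fun s => starRingEnd ℂ ((fun u => f (-u)) s)),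
        fourierHat_conj, fourierHat_reflect]
      refine HasDecay.character_mul (-x) ?_
      simpa using f3.conj⟩

end UltraSchwartz

/-- The space `S'_ω(ℝ^d)` of ultradistributions: continuous conjugate-linear functionals on
`S_ω(ℝ^d)`. -/
abbrev UltraDistribution (ω : WeightFunction) (d : ℕ) : Type :=
  UltraSchwartz ω d →SL[starRingEnd ℂ] ℂ

namespace UltraDistribution

variable {ω : WeightFunction} {d : ℕ}

/-- The short-time Fourier transform `V_ψ a(x, ξ) = ⟨a, Π(x, ξ) ψ⟩`. -/
def stft (ψ : UltraSchwartz ω d) (a : UltraDistribution ω d) (x ξ : Rd d) : ℂ :=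
  a (ψ.phaseShift x ξ)

/-- The convolution `(a ∗ f)(x) = ⟨a, conj (f (x - ·))⟩`, that is `∫ a(y) f(x - y) dy` when `a` is a
function (the functional `a` being conjugate-linear). -/
def conv (a : UltraDistribution ω d) (f : UltraSchwartz ω d) (x : Rd d) : ℂ :=
  a (f.conjReflect x)

/-- `a` is an `ω`-convolutor: `a ∗ f` belongs to `S_ω(ℝ^d)` for every `f` in `S_ω(ℝ^d)`. -/
def IsConvolutor (a : UltraDistribution ω d) : Prop :=
  ∀ f : UltraSchwartz ω d, a.conv f ∈ ultraSubmodule ω d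

/-- The derivative `∂_x^α ∂_ξ^β` of a function of `(x, ξ)`. -/
def mixedDeriv (α β : Fin d → ℕ) (F : Rd d → Rd d → ℂ) (x ξ : Rd d) : ℂ :=
  multiDeriv α (fun x' => multiDeriv β (F x') ξ) x

end UltraDistribution

end

/-!
Write `w(x) = ω(|x|)`. The implications are proved in the order (1) ⟹ (2) ⟹ (3) ⟹ (1).

*The space.* A function belongs to `S_ω` as soon as it is continuous and it and its Fourier
transform decay faster than every `e^{-lw}` (`Tame`, `mem_ultraSubmodule_iff`): no bounds on
derivatives are needed. Behind this is `exists_iteratedFDeriv_le`. Near `y`, write `f` as the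
product of the localised function `h = f · e^{-|·-y|²/2}`, whose Fourier transform is small in `y`
and in the frequency (`exists_stft_le`), and of `e^{|·-y|²/2}`, whose `k`-th derivative at `y` is at
most `k!`. The sums produced by the Leibniz rule are gamma integrals, and condition `(β)`, in the
form `ω(t) = o(t)`, bounds them by the moments `sup tⁿ e^{-μω(t)}`, that is by `e^{μφ*(n/μ)}`.
Consequently the topology of `S_ω` is given by the countably many norms `sup |f| e^{nw} + sup |f̂|
e^{nw}` (`UltraSchwartz.level`), and `S_ω` is a Fréchet space. By the Hahn–Banach theorem a
continuous functional has the form `∫ U f + ∫ W f̂` with `U`, `W` of exponential growth in `w`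
(`UltraDistribution.exists_represents`), so it commutes with superpositions and derivatives of
families in `S_ω` under bounds that involve no derivatives (`apply_integral`, `hasFDerivAt_apply`).

*(1) ⟹ (2).* The derivatives of `V_ψ a` at `(x, ξ)` are, up to factors of modulus one, the values of
`a` on the functions `t ↦ t^β e^{it·ξ} (∂^α ψ)(t - x)` (`atom`, `norm_mixedDeriv_stft`). Each of
them is `conj (f (x - ·))` for some `f ∈ S_ω`, so the value is `(a ∗ f)(x)`. For a convolutor, the
Banach–Steinhaus theorem gives `|(a ∗ f)(x)| ≤ C p(f) e^{-μ'w(x)}` for every `μ'`, with a continuous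
seminorm `p` (`IsConvolutor.exists_norm_conv_le`). By `exists_atom_le`, `p(f)` grows in `x` at most
like `e^{cw(x)}`, where `c` depends on `μ` but not on `p`; hence `μ' = μ + c` can be taken.

*(2) ⟹ (3).* This is the case `α = β = 0`, because `φ*(0) ≤ 0`.

*(3) ⟹ (1).* The inversion formula represents `g ∈ S_ω` as a superposition of the functions `Π(y, η)
ψ` with coefficients `V_ψ g(y, η)` (`integral_coeff_smul_phaseShift`). With `g = conj (f (x - ·))`
it represents `(a ∗ f)(x)` by an integral of `V_ψ a`, which gives the decay of `a ∗ f`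
(`rapidDecay_conv`). For the decay of its Fourier transform, the commutation `(a ∗ f) ∗ g = (a ∗ g)
∗ f` becomes `(a ∗ f)^ ĝ = (a ∗ g)^ f̂` (`hat_conv_mul_hat`). One takes for `g` a modulated and
reflected `ψ`, for which `|a ∗ g| = |V_ψ a(·, η)|` and `|ĝ(ξ)| = |ψ̂(ξ - η)|`, and `η = ξ - ζ` with
a fixed `ζ` such that `ψ̂(ζ) ≠ 0`.
-/

noncomputable section

open MeasureTheory Filter Topology

/-! ### Weight functions -/

namespace WeightFunction

variable (ω : WeightFunction)

theorem mono {s t : ℝ} (hs : 0 ≤ s) (hst : s ≤ t) : ω s ≤ ω t :=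
  ω.monotoneOn (Set.mem_Ici.2 hs) (Set.mem_Ici.2 (hs.trans hst)) hst

theorem norm_nonneg' {E : Type*} [SeminormedAddCommGroup E] (x : E) : 0 ≤ ω ‖x‖ :=
  ω.nonneg _ (norm_nonneg x)

theorem continuous_comp {X : Type*} [TopologicalSpace X] {f : X → ℝ} (hf : Continuous f)
    (h0 : ∀ x, 0 ≤ f x) : Continuous fun x => ω (f x) :=
  ω.continuousOn.comp_continuous hf h0

theorem continuous_norm (d : ℕ) : Continuous fun x : Rd d => ω ‖x‖ :=
  ω.continuous_comp _root_.continuous_norm norm_nonneg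

/-- A constant `K` of quasi-subadditivity: `ω (s + t) ≤ K (ω s + ω t) + K`. -/
def subK : ℝ := Classical.choose ω.add_le

theorem one_le_subK : 1 ≤ ω.subK := (Classical.choose_spec ω.add_le).1

theorem subK_pos : 0 < ω.subK := one_pos.trans_le ω.one_le_subK

theorem add_le_subK {s t : ℝ} (hs : 0 ≤ s) (ht : 0 ≤ t) :
    ω (s + t) ≤ ω.subK * (ω s + ω t) + ω.subK :=
  (Classical.choose_spec ω.add_le).2 s t hs ht

theorem norm_add_le_subK {E : Type*} [SeminormedAddCommGroup E] (x y : E) :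
    ω ‖x + y‖ ≤ ω.subK * (ω ‖x‖ + ω ‖y‖) + ω.subK :=
  (ω.mono (norm_nonneg _) (norm_add_le x y)).trans (ω.add_le_subK (norm_nonneg _) (norm_nonneg _))

theorem norm_sub_le_subK {E : Type*} [SeminormedAddCommGroup E] (x y : E) :
    ω ‖x - y‖ ≤ ω.subK * (ω ‖x‖ + ω ‖y‖) + ω.subK := by
  simpa [sub_eq_add_neg] using ω.norm_add_le_subK x (-y)

/-- Peetre-type inequality for the weights `e^{-lω}`. -/
theorem exp_neg_shift {E : Type*} [SeminormedAddCommGroup E] {l : ℝ} (hl : 0 ≤ l) (x y : E) :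
    Real.exp (-(l * ω.subK) * ω ‖x - y‖) ≤
      Real.exp (l * ω.subK) * Real.exp (l * ω.subK * ω ‖y‖) * Real.exp (-l * ω ‖x‖) := by
  rw [← Real.exp_add, ← Real.exp_add]
  refine Real.exp_le_exp.2 ?_
  have h := ω.norm_add_le_subK (x - y) y
  rw [sub_add_cancel] at h
  nlinarith [mul_le_mul_of_nonneg_left h hl]

/-- Condition `(γ)`: every power is dominated by some exponential of the weight. -/
theorem exists_pow_le (n : ℕ) : ∃ μ : ℝ, 0 < μ ∧ ∃ A : ℝ, 0 < A ∧
    ∀ t : ℝ, 1 ≤ t → t ^ n ≤ A * Real.exp (μ * ω t) := by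
  obtain ⟨c, hc, h⟩ := ω.gamma.exists_pos
  obtain ⟨T, hT⟩ := eventually_atTop.1 (Asymptotics.isBigOWith_iff.1 h)
  refine ⟨n * c + 1, by positivity, max T 1 ^ n, by positivity, fun t ht => ?_⟩
  have hω := ω.nonneg t (by linarith)
  rcases le_total t (max T 1) with h1 | h1
  · refine (pow_le_pow_left₀ (by linarith) h1 n).trans (le_mul_of_one_le_right (by positivity) ?_)
    exact Real.one_le_exp (mul_nonneg (by positivity) hω)
  · have h2 := hT t ((le_max_left _ _).trans h1)
    rw [Real.norm_of_nonneg (Real.log_nonneg ht), Real.norm_of_nonneg hω] at h2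
    have h3 : t ^ n ≤ Real.exp ((n * c + 1) * ω t) := by
      rw [← Real.exp_log (show 0 < t by linarith), ← Real.exp_nat_mul,
        Real.exp_log (show 0 < t by linarith)]
      refine Real.exp_le_exp.2 ?_
      nlinarith [mul_le_mul_of_nonneg_left h2 (Nat.cast_nonneg (α := ℝ) n)]
    exact h3.trans (le_mul_of_one_le_left (Real.exp_nonneg _) (one_le_pow₀ (le_max_right _ _)))

/-- Condition `(β)` forces `ω(t) = o(t)`. -/
theorem exists_le_linear {ε : ℝ} (hε : 0 < ε) : ∃ C : ℝ, 0 ≤ C ∧ ∀ t, 0 ≤ t → ω t ≤ ε * t + C := by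
  have hI : IntegrableOn (fun t => ω t / (1 + t ^ 2)) (Set.Ioi 1) :=
    ω.beta.mono_set Set.Ioi_subset_Ici_self
  have h1 := intervalIntegral_tendsto_integral_Ioi 1 hI tendsto_id
  have h2 := intervalIntegral_tendsto_integral_Ioi 1 hI
    (tendsto_id.const_mul_atTop (show (0 : ℝ) < 2 by norm_num))
  have h3 := h2.sub h1
  rw [sub_self] at h3
  obtain ⟨T, hT⟩ := eventually_atTop.1
    ((h3.eventually_lt_const (show 0 < ε / 5 by positivity)).and (eventually_ge_atTop 1))
  -- the integral over `[t, 2t]` tends to zero, and by monotonicity it is at least `ω(t) / (5t)`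
  have key : ∀ t, max T 1 ≤ t → ω t ≤ ε * t := by
    intro t ht
    have ht1 : 1 ≤ t := (le_max_right _ _).trans ht
    have h4 := (hT t ((le_max_left _ _).trans ht)).1
    have hint : ∀ a b : ℝ, 1 ≤ a → a ≤ b →
        IntervalIntegrable (fun t => ω t / (1 + t ^ 2)) volume a b := fun a b ha hab =>
      (intervalIntegrable_iff_integrableOn_Ioc_of_le hab).2
        (ω.beta.mono_set fun x hx => Set.mem_Ici.2 (ha.trans hx.1.le))
    simp only [id] at h4
    rw [intervalIntegral.integral_interval_sub_left (hint _ _ le_rfl (by linarith))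
      (hint _ _ le_rfl ht1)] at h4
    have h5 : ∫ _ in t..2 * t, ω t / (1 + (2 * t) ^ 2) ≤
        ∫ s in t..2 * t, ω s / (1 + s ^ 2) := by
      refine intervalIntegral.integral_mono_on (by linarith) (by simp)
        (hint _ _ ht1 (by linarith)) fun s hs => ?_
      have := hs.1
      have := hs.2
      have hs0 : 0 ≤ s := by linarith
      refine div_le_div₀ (ω.nonneg s hs0) (ω.mono (by linarith) hs.1) (by positivity) ?_
      gcongr
    rw [intervalIntegral.integral_const, smul_eq_mul] at h5
    have h6 : (2 * t - t) * (ω t / (1 + (2 * t) ^ 2)) ≥ ω t / (5 * t) := by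
      have h0 := ω.nonneg t (by linarith)
      rw [ge_iff_le, ← mul_div_assoc, div_le_div_iff₀ (by positivity) (by positivity)]
      nlinarith [mul_nonneg h0 (show 0 ≤ t ^ 2 - 1 by nlinarith)]
    have h7 : ω t / (5 * t) ≤ ε / 5 := by linarith
    rw [div_le_div_iff₀ (by positivity) (by positivity)] at h7
    linarith
  refine ⟨ω (max T 1), ω.nonneg _ (by positivity), fun t ht => ?_⟩
  rcases le_total t (max T 1) with h | h
  · have := ω.mono ht h
    nlinarith
  · have := key t h
    have := ω.nonneg (max T 1) (by positivity)
    linarith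

/-- By `(γ)`, large powers of `1 + |x|` are dominated by an exponential of the weight. -/
theorem exists_integrable_exp (d : ℕ) :
    ∃ ν : ℝ, 0 < ν ∧ Integrable fun x : Rd d => Real.exp (-ν * ω ‖x‖) := by
  obtain ⟨μ, hμ, A, hA, h⟩ := ω.exists_pow_le (d + 1)
  have hK := ω.subK_pos
  refine ⟨μ * ω.subK, by positivity, ?_⟩
  have hi : Integrable fun x : Rd d => (1 + ‖x‖) ^ (-((d + 1 : ℕ) : ℝ)) :=
    integrable_one_add_norm (by simp)
  refine (hi.const_mul (A * Real.exp (μ * (ω.subK * ω 1 + ω.subK)))).mono'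
    ((Real.continuous_exp.comp (continuous_const.mul (ω.continuous_norm d))).aestronglyMeasurable)
    (Eventually.of_forall fun x => ?_)
  have h1 := h (1 + ‖x‖) (by linarith [norm_nonneg x])
  have h2 := ω.add_le_subK zero_le_one (norm_nonneg x)
  have hp : 0 < (1 + ‖x‖) ^ (d + 1) := by positivity
  rw [Real.rpow_neg (by positivity), Real.rpow_natCast, Real.norm_of_nonneg (Real.exp_nonneg _),
    ← div_eq_mul_inv, le_div_iff₀ hp]
  calc _ ≤ Real.exp (-(μ * ω.subK) * ω ‖x‖) * (A * Real.exp (μ * ω (1 + ‖x‖))) := by gcongr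
    _ = A * Real.exp (-(μ * ω.subK) * ω ‖x‖ + μ * ω (1 + ‖x‖)) := by rw [Real.exp_add]; ring
    _ ≤ _ := by
      gcongr
      nlinarith [mul_le_mul_of_nonneg_left h2 hμ.le]

/-- A rate `ν` for which `e^{-νω}` is integrable on `ℝ^d`. -/
def intRate (d : ℕ) : ℝ := Classical.choose (ω.exists_integrable_exp d)

theorem intRate_pos (d : ℕ) : 0 < ω.intRate d :=
  (Classical.choose_spec (ω.exists_integrable_exp d)).1

theorem integrable_exp (d : ℕ) : Integrable fun x : Rd d => Real.exp (-ω.intRate d * ω ‖x‖) :=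
  (Classical.choose_spec (ω.exists_integrable_exp d)).2

theorem integrable_exp_shift {c : ℝ} (hc : 0 < c) :
    IntegrableOn (fun τ => Real.exp (c * ω (1 + τ)) * Real.exp (-τ)) (Set.Ioi 0) := by
  obtain ⟨C, hC, h⟩ := ω.exists_le_linear (ε := 1 / (2 * c)) (by positivity)
  have hi : IntegrableOn (fun τ : ℝ => Real.exp (-(1 / 2) * τ)) (Set.Ioi 0) :=
    exp_neg_integrableOn_Ioi 0 (by norm_num)
  refine (hi.const_mul (Real.exp (1 / 2 + c * C))).mono' ?_ ?_
  · refine ContinuousOn.aestronglyMeasurable ?_ measurableSet_Ioi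
    refine ContinuousOn.mul (Real.continuous_exp.comp_continuousOn (continuousOn_const.mul ?_))
      (by fun_prop)
    refine ω.continuousOn.comp (by fun_prop) fun τ hτ => ?_
    have : 0 < τ := hτ
    exact Set.mem_Ici.2 (by linarith)
  · refine (ae_restrict_iff' measurableSet_Ioi).2 (Eventually.of_forall fun τ hτ => ?_)
    have hτ0 : 0 < τ := hτ
    rw [Real.norm_of_nonneg (by positivity), ← Real.exp_add, ← Real.exp_add]
    refine Real.exp_le_exp.2 ?_
    have h1 := mul_le_mul_of_nonneg_left (h (1 + τ) (by linarith)) hc.le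
    have h2 : c * (1 / (2 * c) * (1 + τ) + C) = (1 + τ) / 2 + c * C := by field_simp
    linarith

/-- The sum `∑ₖ (n choose k) rᵏ (n-k)!` is the integral `∫₀^∞ (r + τ)ⁿ e^{-τ} dτ`, so it is
controlled by any bound for the moments `tⁿ e^{-μω(t)}`. -/
theorem exists_sum_factorial_le {μ : ℝ} (hμ : 0 < μ) : ∃ C : ℝ, 0 < C ∧ ∀ (n : ℕ) (A r : ℝ), 0 ≤ r →
    (∀ t : ℝ, 1 ≤ t → t ^ n ≤ A * Real.exp (μ * ω t)) →
    ∑ k ∈ Finset.range (n + 1), (n.choose k : ℝ) * r ^ k * (n - k).factorial ≤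
      C * A * Real.exp (μ * ω.subK * ω r) := by
  have hK := ω.subK_pos
  set I := ∫ τ in Set.Ioi (0 : ℝ), Real.exp (μ * ω.subK * ω (1 + τ)) * Real.exp (-τ) with hI
  have hI0 : 0 ≤ I := by
    refine setIntegral_nonneg measurableSet_Ioi fun τ _ => by positivity
  refine ⟨Real.exp (μ * ω.subK) * (I + 1), by positivity, fun n A r hr hA => ?_⟩
  have hA0 : 0 ≤ A := by
    have h1 := (one_pow (M := ℝ) n ▸ hA 1 le_rfl)
    by_contra hneg
    push Not at hneg
    nlinarith [Real.exp_pos (μ * ω 1)]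
  have hfac : ∀ j : ℕ, IntegrableOn (fun τ : ℝ => τ ^ j * Real.exp (-τ)) (Set.Ioi 0) ∧
      ∫ τ in Set.Ioi (0 : ℝ), τ ^ j * Real.exp (-τ) = j.factorial := by
    intro j
    have h1 := Real.GammaIntegral_convergent (s := j + 1) (by positivity)
    have h2 := Real.Gamma_eq_integral (s := j + 1) (by positivity)
    rw [Real.Gamma_nat_eq_factorial] at h2
    simp only [add_sub_cancel_right, Real.rpow_natCast] at h1 h2
    rw [h2]
    simp only [mul_comm (Real.exp _)] at h1
    exact ⟨h1, integral_congr_ae (Eventually.of_forall fun τ => mul_comm _ _)⟩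
  have e : ∑ k ∈ Finset.range (n + 1), (n.choose k : ℝ) * r ^ k * (n - k).factorial =
      ∫ τ in Set.Ioi (0 : ℝ), (r + τ) ^ n * Real.exp (-τ) := by
    have : ∀ τ : ℝ, (r + τ) ^ n * Real.exp (-τ) = ∑ k ∈ Finset.range (n + 1),
        ((n.choose k : ℝ) * r ^ k) * (τ ^ (n - k) * Real.exp (-τ)) := by
      intro τ
      rw [add_pow, Finset.sum_mul]
      exact Finset.sum_congr rfl fun k _ => by ring
    simp only [this]
    rw [integral_finsetSum _ fun k _ => (hfac _).1.const_mul _]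
    refine Finset.sum_congr rfl fun k _ => ?_
    rw [integral_const_mul, (hfac _).2]
  rw [e]
  have hint := ω.integrable_exp_shift (c := μ * ω.subK) (by positivity)
  have hle : ∫ τ in Set.Ioi (0 : ℝ), (r + τ) ^ n * Real.exp (-τ) ≤
      ∫ τ in Set.Ioi (0 : ℝ), (A * Real.exp (μ * ω.subK) * Real.exp (μ * ω.subK * ω r)) *
        (Real.exp (μ * ω.subK * ω (1 + τ)) * Real.exp (-τ)) := by
    refine integral_mono_of_nonneg ?_ (hint.const_mul _) ?_
    · refine (ae_restrict_iff' measurableSet_Ioi).2 (Eventually.of_forall fun τ hτ => ?_)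
      have : 0 < τ := hτ
      simp only [Pi.zero_apply]
      positivity
    · refine (ae_restrict_iff' measurableSet_Ioi).2 (Eventually.of_forall fun τ hτ => ?_)
      have hτ0 : 0 < τ := hτ
      have h1 := hA (r + (1 + τ)) (by linarith)
      have h2 := ω.add_le_subK hr (show 0 ≤ 1 + τ by linarith)
      have h3 : (r + τ) ^ n ≤ (r + (1 + τ)) ^ n := by gcongr; linarith
      have h4 : Real.exp (μ * ω (r + (1 + τ))) ≤ Real.exp (μ * ω.subK) *
          Real.exp (μ * ω.subK * ω r) * Real.exp (μ * ω.subK * ω (1 + τ)) := by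
        rw [← Real.exp_add, ← Real.exp_add]
        refine Real.exp_le_exp.2 ?_
        nlinarith [mul_le_mul_of_nonneg_left h2 hμ.le]
      have h5 := mul_le_mul_of_nonneg_left h4 hA0
      calc _ ≤ A * (Real.exp (μ * ω.subK) *
          Real.exp (μ * ω.subK * ω r) * Real.exp (μ * ω.subK * ω (1 + τ))) * Real.exp (-τ) :=
            mul_le_mul_of_nonneg_right (h3.trans (h1.trans h5)) (Real.exp_nonneg _)
        _ = _ := by ring
  refine hle.trans ?_
  rw [integral_const_mul, ← hI]
  have : 0 ≤ A * Real.exp (μ * ω.subK) * Real.exp (μ * ω.subK * ω r) := by positivity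
  nlinarith

end WeightFunction

/-! ### The Fourier transform in the normalisation without `2π` -/

section FourierBasics

variable {d : ℕ} {f g : Rd d → ℂ}

/-- The bilinear form `(2π)⁻¹ ⟪v, w⟫`, for which Mathlib's general Fourier integral has the kernel
`e^{-i⟪v, w⟫}`. -/
def hatForm (d : ℕ) : Rd d →L[ℝ] Rd d →L[ℝ] ℝ := (2 * Real.pi)⁻¹ • innerSL ℝ

theorem hatForm_apply (v w : Rd d) : hatForm d v w = (2 * Real.pi)⁻¹ * inner ℝ v w := rfl

theorem norm_hatForm_le : 2 * Real.pi * ‖hatForm d‖ ≤ 1 := by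
  have h : ‖hatForm d‖ ≤ (2 * Real.pi)⁻¹ := by
    refine ContinuousLinearMap.opNorm_le_bound₂ _ (by positivity) fun v w => ?_
    rw [hatForm_apply, norm_mul, Real.norm_of_nonneg (by positivity : 0 ≤ (2 * Real.pi)⁻¹),
      mul_assoc]
    gcongr
    exact norm_inner_le_norm v w
  calc _ ≤ 2 * Real.pi * (2 * Real.pi)⁻¹ := by gcongr
    _ = 1 := mul_inv_cancel₀ (by positivity)

theorem fourierChar_hatForm (v w : Rd d) :
    ((Real.fourierChar (-(hatForm d v w)) : Circle) : ℂ) = character (-w) v := by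
  rw [Real.fourierChar_apply, hatForm_apply, character]
  congr 1
  rw [inner_neg_right]
  push_cast
  have : (Real.pi : ℂ) ≠ 0 := by exact_mod_cast Real.pi_ne_zero
  field_simp

theorem fourierHat_eq_vector (f : Rd d → ℂ) : fourierHat f =
    VectorFourier.fourierIntegral Real.fourierChar volume (hatForm d).toLinearMap₁₂ f := by
  funext ξ
  rw [fourierHat_eq, VectorFourier.fourierIntegral]
  congr 1
  funext t
  rw [Circle.smul_def, smul_eq_mul, ← fourierChar_hatForm]
  rfl

theorem fourierHat_eq_fourier (f : Rd d → ℂ) (ξ : Rd d) :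
    fourierHat f ξ = FourierTransform.fourier f ((2 * Real.pi)⁻¹ • ξ) := by
  rw [fourierHat, Real.fourier_eq']
  congr 1
  funext t
  rw [smul_eq_mul, inner_smul_right]
  congr 2
  push_cast
  have : (Real.pi : ℂ) ≠ 0 := by exact_mod_cast Real.pi_ne_zero
  field_simp

theorem norm_fourierHat_le (f : Rd d → ℂ) (ξ : Rd d) : ‖fourierHat f ξ‖ ≤ ∫ t, ‖f t‖ := by
  rw [fourierHat_eq_vector]
  exact VectorFourier.norm_fourierIntegral_le_integral_norm _ _ _ _ _

theorem fourierHat_continuous (hf : Integrable f) : Continuous (fourierHat f) := by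
  rw [fourierHat_eq_vector]
  exact VectorFourier.fourierIntegral_continuous Real.continuous_fourierChar
    (hatForm d).continuous₂ hf

theorem integral_fourierHat_mul (hf : Integrable f) (hg : Integrable g) :
    ∫ ξ, fourierHat f ξ * g ξ = ∫ t, f t * fourierHat g t := by
  have h := VectorFourier.integral_fourierIntegral_smul_eq_flip (μ := volume) (ν := volume)
    (L := (hatForm d).toLinearMap₁₂) Real.continuous_fourierChar (hatForm d).continuous₂ hf hg
  have e : (hatForm d).toLinearMap₁₂.flip = (hatForm d).toLinearMap₁₂ := by
    ext v w
    exact (hatForm_apply _ _).trans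
      ((congrArg _ (real_inner_comm _ _)).trans (hatForm_apply _ _).symm)
  rw [e, ← fourierHat_eq_vector, ← fourierHat_eq_vector] at h
  simpa only [smul_eq_mul] using h

/-- Fourier inversion for the normalisation `∫ e^{-it·ξ} f(t) dt`. -/
theorem fourierHat_fourierHat (hc : Continuous f) (hf : Integrable f)
    (hf' : Integrable (fourierHat f)) (t : Rd d) :
    fourierHat (fourierHat f) t = (2 * Real.pi : ℂ) ^ d * f (-t) := by
  have hpi : (0 : ℝ) < 2 * Real.pi := by positivity
  have hF : FourierTransform.fourier f = fun w => fourierHat f ((2 * Real.pi) • w) := by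
    funext w
    rw [fourierHat_eq_fourier, smul_smul, inv_mul_cancel₀ hpi.ne', one_smul]
  have hi : Integrable (FourierTransform.fourier f) := by
    rw [hF]
    exact hf'.comp_smul hpi.ne'
  have h := congrFun (hc.fourierInv_fourier_eq hf hi) (-t)
  rw [Real.fourierInv_eq_fourier_neg, neg_neg, Real.fourier_eq'] at h
  rw [← h, fourierHat]
  have h2 := Measure.integral_comp_inv_smul_of_nonneg (volume : Measure (Rd d))
    (fun w => Complex.exp (((-2 * Real.pi * inner ℝ w t : ℝ) : ℂ) * Complex.I) •
      FourierTransform.fourier f w) hpi.le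
  rw [finrank_euclideanSpace_fin] at h2
  have h3 : ((2 * Real.pi : ℂ) ^ d) = (((2 * Real.pi) ^ d : ℝ) : ℂ) := by push_cast; rfl
  rw [h3, ← Complex.real_smul, ← h2]
  congr 1
  funext w
  rw [← fourierHat_eq_fourier, inner_smul_left, smul_eq_mul]
  congr 2
  simp only [conj_trivial]
  push_cast
  have : (Real.pi : ℂ) ≠ 0 := by exact_mod_cast Real.pi_ne_zero
  field_simp

theorem contDiff_fourierHat (hf : ∀ n : ℕ, Integrable fun t => ‖t‖ ^ n * ‖f t‖) :
    ContDiff ℝ (⊤ : ℕ∞) (fourierHat f) := by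
  rw [fourierHat_eq_vector]
  exact VectorFourier.contDiff_fourierIntegral (hatForm d) fun n _ => hf n

theorem norm_iteratedFDeriv_fourierHat_le (hc : AEStronglyMeasurable f)
    (hf : ∀ n : ℕ, Integrable fun t => ‖t‖ ^ n * ‖f t‖) (n : ℕ) (ξ : Rd d) :
    ‖iteratedFDeriv ℝ n (fourierHat f) ξ‖ ≤ ∫ t, ‖t‖ ^ n * ‖f t‖ := by
  rw [fourierHat_eq_vector, VectorFourier.iteratedFDeriv_fourierIntegral (N := ⊤) (hatForm d)
    (fun n _ => hf n) hc le_top]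
  refine (VectorFourier.norm_fourierIntegral_le_integral_norm _ _ _ _ _).trans ?_
  refine integral_mono_of_nonneg (Eventually.of_forall fun _ => norm_nonneg _) (hf n)
    (Eventually.of_forall fun t => ?_)
  refine (VectorFourier.norm_fourierPowSMulRight_le _ _ _ _).trans ?_
  have := pow_le_one₀ (n := n) (by positivity) (norm_hatForm_le (d := d))
  rw [mul_assoc]
  exact mul_le_of_le_one_left (by positivity) this

theorem pderiv_fourierHat (hf : Integrable f) (hf' : Integrable fun t => ‖t‖ * ‖f t‖) (j : Fin d) :
    pderiv j (fourierHat f) = fun ξ => -Complex.I * fourierHat (fun t => (t j : ℂ) * f t) ξ := by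
  funext ξ
  rw [pderiv, fourierHat_eq_vector f, VectorFourier.fderiv_fourierIntegral (hatForm d) hf hf',
    Real.fourierIntegral_continuousLinearMap_apply', fourierHat_eq_vector,
    VectorFourier.fourierIntegral, VectorFourier.fourierIntegral, ← integral_const_mul]
  · congr 1
    funext t
    simp only [Circle.smul_def, VectorFourier.fourierSMulRight_apply, hatForm_apply, smul_eq_mul,
      Complex.real_smul, EuclideanSpace.inner_single_right]
    push_cast
    have : (Real.pi : ℂ) ≠ 0 := by exact_mod_cast Real.pi_ne_zero
    simp
    field_simp
  · refine (hf'.const_mul (2 * Real.pi * ‖hatForm d‖)).mono' hf.1.fourierSMulRight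
      (Eventually.of_forall fun t => ?_)
    simpa only [mul_assoc] using VectorFourier.norm_fourierSMulRight_le (hatForm d) f t

theorem fourierHat_pderiv (hf : Integrable f) (hd : Differentiable ℝ f)
    (hf' : Integrable (fderiv ℝ f)) (j : Fin d) :
    fourierHat (pderiv j f) = fun ξ => Complex.I * (ξ j : ℂ) * fourierHat f ξ := by
  funext ξ
  have h := congrArg (fun A => A (EuclideanSpace.single j 1))
    (congrFun (VectorFourier.fourierIntegral_fderiv (hatForm d) hf hd hf') ξ)
  simp only [Real.fourierIntegral_continuousLinearMap_apply' hf'] at h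
  rw [fourierHat_eq_vector]
  refine h.trans ?_
  rw [VectorFourier.fourierSMulRight_apply, ← fourierHat_eq_vector]
  simp only [neg_apply, ContinuousLinearMap.flip_apply, hatForm_apply,
    EuclideanSpace.inner_single_left, smul_eq_mul, Complex.real_smul]
  push_cast
  have : (Real.pi : ℂ) ≠ 0 := by exact_mod_cast Real.pi_ne_zero
  simp
  field_simp

/-- The Fourier transform of a product is the convolution of the Fourier transforms. -/
theorem fourierHat_mul (hc : Continuous f) (hf : Integrable f)
    (hf' : Integrable (fourierHat f)) (hg : Integrable g) (ξ : Rd d) :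
    (2 * Real.pi : ℂ) ^ d * fourierHat (fun t => f t * g t) ξ =
      ∫ η, fourierHat f η * fourierHat g (ξ - η) := by
  set k : Rd d → ℂ := character ξ * fun t => g (-t) with hk
  have hki : Integrable k := integrable_character_mul ξ hg.comp_neg
  have hkh : ∀ η, fourierHat k η = fourierHat g (ξ - η) := by
    intro η
    rw [hk, fourierHat_modulate, fourierHat_reflect]
    simp only [neg_sub]
  simp only [← hkh]
  rw [← integral_fourierHat_mul hf' hki, fourierHat_eq, ← integral_const_mul,
    ← integral_neg_eq_self]
  congr 1
  funext t
  rw [fourierHat_fourierHat hc hf hf', hk]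
  simp only [Pi.mul_apply, character, inner_neg_left, inner_neg_right, neg_neg]
  ring

/-- The Gaussian `e^{-|t|²/2}`. -/
def gaussian (d : ℕ) (t : Rd d) : ℂ := Complex.exp (-(1 / 2 : ℂ) * (‖t‖ : ℂ) ^ 2)

theorem gaussian_ofReal (t : Rd d) : gaussian d t = ((Real.exp (-(1 / 2) * ‖t‖ ^ 2) : ℝ) : ℂ) := by
  rw [gaussian]
  push_cast
  rfl

theorem norm_gaussian (t : Rd d) : ‖gaussian d t‖ = Real.exp (-(1 / 2) * ‖t‖ ^ 2) := by
  rw [gaussian_ofReal, Complex.norm_real, Real.norm_of_nonneg (Real.exp_nonneg _)]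

theorem fourierHat_gaussian (d : ℕ) :
    ∃ c : ℂ, ∀ ξ, fourierHat (gaussian d) ξ = c * gaussian d ξ := by
  refine ⟨(Real.pi / (1 / 2 : ℂ)) ^ (Module.finrank ℝ (Rd d) / 2 : ℂ), fun ξ => ?_⟩
  rw [fourierHat_eq_fourier]
  have h := fourier_gaussian_innerProductSpace (V := Rd d) (b := (1 / 2 : ℂ)) (by norm_num)
    ((2 * Real.pi)⁻¹ • ξ)
  refine Eq.trans h ?_
  rw [gaussian, norm_smul, Real.norm_of_nonneg (by positivity)]
  congr 2
  push_cast
  have : (Real.pi : ℂ) ≠ 0 := by exact_mod_cast Real.pi_ne_zero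
  field_simp

end FourierBasics

/-! ### Rapid decay and short-time Fourier transforms of tame functions -/

/-- A bound `A` for the moments `tⁿ e^{-μω(t)}`, `t ≥ 1`, bounds the powers `(1 + r)ⁿ`, `r ≥ 0`. -/
theorem WeightFunction.one_add_pow_le (ω : WeightFunction) {μ A : ℝ} {n : ℕ} (hμ : 0 ≤ μ)
    (hA : ∀ t : ℝ, 1 ≤ t → t ^ n ≤ A * Real.exp (μ * ω t)) :
    0 ≤ A ∧ ∀ r : ℝ, 0 ≤ r → (1 + r) ^ n ≤
      A * Real.exp (μ * ω.subK * (ω 1 + 1)) * Real.exp (μ * ω.subK * ω r) := by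
  have hA0 : 0 ≤ A := by
    have h1 := (one_pow (M := ℝ) n ▸ hA 1 le_rfl)
    by_contra hneg
    push Not at hneg
    nlinarith [Real.exp_pos (μ * ω 1)]
  refine ⟨hA0, fun r hr => (hA (1 + r) (by linarith)).trans ?_⟩
  rw [mul_assoc, ← Real.exp_add]
  gcongr
  have := mul_le_mul_of_nonneg_left (ω.add_le_subK zero_le_one hr) hμ
  nlinarith

section Decay

variable {d : ℕ} {ω : WeightFunction} {f g : Rd d → ℂ}

/-- `f` decays faster than every `e^{-lω}`. -/
def RapidDecay (ω : WeightFunction) (f : Rd d → ℂ) : Prop :=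
  ∀ l : ℝ, ∃ C, 0 ≤ C ∧ ∀ x, ‖f x‖ ≤ C * Real.exp (-l * ω ‖x‖)

/-- The weighted `L¹` norm `∫ |f| e^{lω}`. -/
def weightInt (ω : WeightFunction) (l : ℝ) (f : Rd d → ℂ) : ℝ :=
  ∫ x, ‖f x‖ * Real.exp (l * ω ‖x‖)

theorem weightInt_nonneg (ω : WeightFunction) (l : ℝ) (f : Rd d → ℂ) : 0 ≤ weightInt ω l f :=
  integral_nonneg fun _ => by positivity

theorem continuous_exp_weight (ω : WeightFunction) (d : ℕ) (l : ℝ) :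
    Continuous fun x : Rd d => Real.exp (l * ω ‖x‖) :=
  Real.continuous_exp.comp (continuous_const.mul (ω.continuous_norm d))

theorem integrable_of_bound (hf : AEStronglyMeasurable f) {C l : ℝ}
    (h : ∀ x, ‖f x‖ ≤ C * Real.exp (-(l + ω.intRate d) * ω ‖x‖)) :
    Integrable (fun x => ‖f x‖ * Real.exp (l * ω ‖x‖)) ∧
      weightInt ω l f ≤ C * ∫ x : Rd d, Real.exp (-ω.intRate d * ω ‖x‖) := by
  have hle : ∀ x, ‖f x‖ * Real.exp (l * ω ‖x‖) ≤ C * Real.exp (-ω.intRate d * ω ‖x‖) := by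
    intro x
    refine (mul_le_mul_of_nonneg_right (h x) (Real.exp_nonneg _)).trans (le_of_eq ?_)
    rw [mul_assoc, ← Real.exp_add]
    congr 2
    ring
  refine ⟨((ω.integrable_exp d).const_mul C).mono'
    (hf.norm.mul (continuous_exp_weight ω d l).aestronglyMeasurable)
    (Eventually.of_forall fun x => ?_), ?_⟩
  · rw [Real.norm_of_nonneg (by positivity)]
    exact hle x
  · rw [← integral_const_mul]
    exact integral_mono_of_nonneg (Eventually.of_forall fun _ => by positivity)
      ((ω.integrable_exp d).const_mul C) (Eventually.of_forall hle)

namespace RapidDecay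

theorem integrable_weight (h : RapidDecay ω f) (hf : AEStronglyMeasurable f) (l : ℝ) :
    Integrable (fun x => ‖f x‖ * Real.exp (l * ω ‖x‖)) := by
  obtain ⟨C, -, hC⟩ := h (l + ω.intRate d)
  exact (integrable_of_bound hf hC).1

theorem integrable (h : RapidDecay ω f) (hf : AEStronglyMeasurable f) : Integrable f := by
  refine (integrable_norm_iff hf).1 ?_
  simpa using h.integrable_weight hf 0

theorem pow_mul (h : RapidDecay ω f) (n : ℕ) (l : ℝ) :
    ∃ C, 0 ≤ C ∧ ∀ x, ‖x‖ ^ n * ‖f x‖ ≤ C * Real.exp (-l * ω ‖x‖) := by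
  obtain ⟨μ, hμ, A, hA, hA'⟩ := ω.exists_pow_le n
  obtain ⟨-, h1⟩ := ω.one_add_pow_le hμ.le hA'
  obtain ⟨C, hC, h2⟩ := h (l + μ * ω.subK)
  refine ⟨A * Real.exp (μ * ω.subK * (ω 1 + 1)) * C, by positivity, fun x => ?_⟩
  have h3 : ‖x‖ ^ n ≤ (1 + ‖x‖) ^ n := by gcongr; linarith
  refine (mul_le_mul (h3.trans (h1 _ (norm_nonneg x))) (h2 x) (norm_nonneg _)
    (by positivity)).trans (le_of_eq ?_)
  have : Real.exp (-l * ω ‖x‖) =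
      Real.exp (μ * ω.subK * ω ‖x‖) * Real.exp (-(l + μ * ω.subK) * ω ‖x‖) := by
    rw [← Real.exp_add]
    congr 1
    ring
  rw [this]
  ring

theorem integrable_pow_mul (h : RapidDecay ω f) (hf : AEStronglyMeasurable f) (n : ℕ) :
    Integrable fun x => ‖x‖ ^ n * ‖f x‖ := by
  obtain ⟨C, hC0, hC⟩ := h.pow_mul n (ω.intRate d)
  refine ((ω.integrable_exp d).const_mul C).mono' ?_ (Eventually.of_forall fun x => ?_)
  · exact (_root_.continuous_norm.pow n).aestronglyMeasurable.mul hf.norm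
  · rw [Real.norm_of_nonneg (by positivity)]
    exact hC x

theorem reflect (h : RapidDecay ω f) : RapidDecay ω fun t => f (-t) := by
  intro l
  obtain ⟨C, hC, h1⟩ := h l
  exact ⟨C, hC, fun x => by simpa using h1 (-x)⟩

theorem of_norm_le (h : RapidDecay ω f) {c : ℝ} (hc : 0 ≤ c) (hg : ∀ x, ‖g x‖ ≤ c * ‖f x‖) :
    RapidDecay ω g := by
  intro l
  obtain ⟨C, hC, h1⟩ := h l
  refine ⟨c * C, by positivity, fun x => (hg x).trans ?_⟩
  rw [mul_assoc]
  gcongr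
  exact h1 x

theorem of_nonneg (h : ∀ l : ℝ, 0 < l → ∃ C, ∀ x, ‖f x‖ ≤ C * Real.exp (-l * ω ‖x‖)) :
    RapidDecay ω f := by
  intro l
  obtain ⟨C, hC⟩ := h (|l| + 1) (by positivity)
  have hC0 : 0 ≤ C := by
    have := (norm_nonneg _).trans (hC 0)
    exact nonneg_of_mul_nonneg_left this (Real.exp_pos _)
  refine ⟨C, hC0, fun x => (hC x).trans ?_⟩
  gcongr
  · exact ω.norm_nonneg' x
  · linarith [le_abs_self l]

end RapidDecay

/-- A continuous function such that both it and its Fourier transform decay faster than every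
`e^{-lω}`. These are exactly the functions of `S_ω`. -/
structure Tame (ω : WeightFunction) (f : Rd d → ℂ) : Prop where
  continuous : Continuous f
  decay : RapidDecay ω f
  hat_decay : RapidDecay ω (fourierHat f)

namespace Tame

theorem integrable (h : Tame ω f) : Integrable f :=
  h.decay.integrable h.continuous.aestronglyMeasurable

theorem hat_continuous (h : Tame ω f) : Continuous (fourierHat f) :=
  fourierHat_continuous h.integrable

theorem hat_integrable (h : Tame ω f) : Integrable (fourierHat f) :=
  h.hat_decay.integrable h.hat_continuous.aestronglyMeasurable

theorem hat_hat (h : Tame ω f) (t : Rd d) :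
    fourierHat (fourierHat f) t = (2 * Real.pi : ℂ) ^ d * f (-t) :=
  fourierHat_fourierHat h.continuous h.integrable h.hat_integrable t

theorem norm_hat_hat (h : Tame ω f) (t : Rd d) :
    ‖fourierHat (fourierHat f) t‖ = (2 * Real.pi) ^ d * ‖f (-t)‖ := by
  rw [h.hat_hat, norm_mul, norm_pow]
  congr 2
  simp [abs_of_pos Real.pi_pos]

theorem hat (h : Tame ω f) : Tame ω (fourierHat f) :=
  ⟨h.hat_continuous, h.hat_decay, h.decay.reflect.of_norm_le (by positivity)
    fun t => (h.norm_hat_hat t).le⟩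

theorem contDiff (h : Tame ω f) : ContDiff ℝ (⊤ : ℕ∞) f := by
  have h1 := contDiff_fourierHat fun n =>
    h.hat_decay.integrable_pow_mul h.hat_continuous.aestronglyMeasurable n
  have h2 : f = fun t => ((2 * Real.pi : ℂ) ^ d)⁻¹ * fourierHat (fourierHat f) (-t) := by
    funext t
    rw [h.hat_hat, neg_neg, inv_mul_cancel_left₀]
    exact pow_ne_zero _ (by exact_mod_cast (by positivity : (2 * Real.pi) ≠ 0))
  rw [h2]
  exact contDiff_const.mul (h1.comp contDiff_neg)

theorem conj (h : Tame ω f) : Tame ω fun t => starRingEnd ℂ (f t) := by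
  refine ⟨Complex.continuous_conj.comp h.continuous,
    h.decay.of_norm_le zero_le_one fun t => by simp, ?_⟩
  rw [fourierHat_conj]
  exact h.hat_decay.reflect.of_norm_le zero_le_one fun t => by simp

theorem reflect (h : Tame ω f) : Tame ω fun t => f (-t) := by
  refine ⟨h.continuous.comp continuous_neg, h.decay.reflect, ?_⟩
  rw [fourierHat_reflect]
  exact h.hat_decay.reflect

end Tame

/-- The Gaussian decays faster than `e^{-lω}` because `ω` grows at most linearly. -/
theorem gaussian_decay (ω : WeightFunction) (d : ℕ) : RapidDecay ω (gaussian d) := by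
  refine RapidDecay.of_nonneg fun l hl => ?_
  obtain ⟨C, hC, h⟩ := ω.exists_le_linear one_pos
  refine ⟨Real.exp (l * C + l ^ 2 / 2), fun x => ?_⟩
  rw [norm_gaussian, ← Real.exp_add]
  refine Real.exp_le_exp.2 ?_
  nlinarith [mul_le_mul_of_nonneg_left (h ‖x‖ (norm_nonneg x)) hl.le, sq_nonneg (‖x‖ - l)]

theorem gaussian_contDiff (d : ℕ) : ContDiff ℝ (⊤ : ℕ∞) (gaussian d) := by
  have : gaussian d = fun t => ((Real.exp (-(1 / 2) * ‖t‖ ^ 2) : ℝ) : ℂ) := by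
    funext t
    exact gaussian_ofReal t
  rw [this]
  exact Complex.ofRealCLM.contDiff.comp
    (Real.contDiff_exp.comp (contDiff_const.mul (contDiff_norm_sq ℝ)))

theorem gaussian_tame (ω : WeightFunction) (d : ℕ) : Tame ω (gaussian d) := by
  refine ⟨(gaussian_contDiff d).continuous, gaussian_decay ω d, ?_⟩
  obtain ⟨c, hc⟩ := fourierHat_gaussian d
  refine (gaussian_decay ω d).of_norm_le (norm_nonneg c) fun x => ?_
  rw [hc, norm_mul]

/-- The crude bound behind the estimate of the short-time Fourier transform: a product of two
rapidly decaying functions, one of them translated, is small when the translation is large. -/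
theorem exists_integral_translate_le (hg : RapidDecay ω g) {l : ℝ} (hl : 0 ≤ l) :
    ∃ C, 0 ≤ C ∧ ∀ f : Rd d → ℂ, Integrable (fun x => ‖f x‖ * Real.exp (l * ω.subK * ω ‖x‖)) →
      ∀ y, ∫ t, ‖f t‖ * ‖g (y - t)‖ ≤ C * weightInt ω (l * ω.subK) f * Real.exp (-l * ω ‖y‖) := by
  obtain ⟨C, hC0, hC⟩ := hg (l * ω.subK)
  refine ⟨C * Real.exp (l * ω.subK), by positivity, fun f hf y => ?_⟩
  have hle : ∀ t, ‖f t‖ * ‖g (y - t)‖ ≤ C * Real.exp (l * ω.subK) * Real.exp (-l * ω ‖y‖) *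
      (‖f t‖ * Real.exp (l * ω.subK * ω ‖t‖)) := by
    intro t
    have h1 := ω.exp_neg_shift hl y t
    calc _ ≤ ‖f t‖ * (C * (Real.exp (l * ω.subK) * Real.exp (l * ω.subK * ω ‖t‖) *
            Real.exp (-l * ω ‖y‖))) := by
          gcongr
          exact (hC _).trans (mul_le_mul_of_nonneg_left h1 hC0)
      _ = _ := by ring
  refine (integral_mono_of_nonneg (Eventually.of_forall fun _ => by positivity) (hf.const_mul _)
    (Eventually.of_forall hle)).trans (le_of_eq ?_)
  rw [integral_const_mul, weightInt]
  ring

/-- The short-time Fourier transform of a tame function with a tame window decays rapidly in both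
variables: the time side bounds it by `e^{-2lω(y)}`, the frequency side by `e^{-2κω(ξ)}`, and the
minimum of the two is at most their geometric mean. -/
theorem exists_stft_le (hg : Tame ω g) {l κ : ℝ} (hl : 0 ≤ l) (hκ : 0 ≤ κ) :
    ∃ C, 0 ≤ C ∧ ∀ f : Rd d → ℂ, Tame ω f → ∀ y ξ,
      ‖fourierHat (fun t => f t * g (t - y)) ξ‖ ≤
        C * (weightInt ω (2 * l * ω.subK) f + weightInt ω (2 * κ * ω.subK) (fourierHat f)) *
          Real.exp (-l * ω ‖y‖) * Real.exp (-κ * ω ‖ξ‖) := by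
  obtain ⟨A, hA0, hA⟩ := exists_integral_translate_le (l := 2 * l) hg.decay.reflect (by positivity)
  obtain ⟨B, hB0, hB⟩ := exists_integral_translate_le (l := 2 * κ) hg.hat_decay (by positivity)
  have hpi : 0 < (2 * Real.pi) ^ d := by positivity
  refine ⟨A + B * ((2 * Real.pi) ^ d)⁻¹, by positivity, fun f hf y ξ => ?_⟩
  set P := weightInt ω (2 * l * ω.subK) f with hP
  set Q := weightInt ω (2 * κ * ω.subK) (fourierHat f) with hQ
  have hP0 : 0 ≤ P := weightInt_nonneg _ _ _
  have hQ0 : 0 ≤ Q := weightInt_nonneg _ _ _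
  set C := (A + B * ((2 * Real.pi) ^ d)⁻¹) * (P + Q) with hC
  have hgy : Integrable fun t => g (t - y) := hg.integrable.comp_sub_right y
  have h1 : ‖fourierHat (fun t => f t * g (t - y)) ξ‖ ≤ C * Real.exp (-(2 * l) * ω ‖y‖) := by
    refine (norm_fourierHat_le _ _).trans ?_
    have h := hA f (hf.decay.integrable_weight hf.continuous.aestronglyMeasurable _) y
    simp only [neg_sub] at h
    simp only [norm_mul]
    refine h.trans ?_
    gcongr
    rw [hC, ← hP]
    have : 0 ≤ B * ((2 * Real.pi) ^ d)⁻¹ * (P + Q) := by positivity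
    nlinarith [mul_nonneg hA0 hQ0]
  have h2 : ‖fourierHat (fun t => f t * g (t - y)) ξ‖ ≤ C * Real.exp (-(2 * κ) * ω ‖ξ‖) := by
    have h := fourierHat_mul hf.continuous hf.integrable hf.hat_integrable hgy ξ
    have h' := congrArg norm h
    rw [norm_mul, norm_pow] at h'
    have h3 : ‖(2 * Real.pi : ℂ)‖ = 2 * Real.pi := by simp [abs_of_pos Real.pi_pos]
    rw [h3] at h'
    have h4 : ‖∫ η, fourierHat f η * fourierHat (fun t => g (t - y)) (ξ - η)‖ ≤
        ∫ η, ‖fourierHat f η‖ * ‖fourierHat g (ξ - η)‖ := by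
      refine (norm_integral_le_integral_norm _).trans (le_of_eq ?_)
      congr 1
      funext η
      rw [norm_mul, fourierHat_translate, Pi.mul_apply, norm_mul, norm_character, one_mul]
    have h5 := h4.trans (hB _ (hf.hat_decay.integrable_weight
      hf.hat_continuous.aestronglyMeasurable _) ξ)
    rw [← h', ← hQ, ← le_div_iff₀' hpi] at h5
    refine h5.trans ?_
    rw [hC, div_eq_inv_mul]
    have : 0 ≤ (A * (P + Q) + B * ((2 * Real.pi) ^ d)⁻¹ * P) * Real.exp (-(2 * κ) * ω ‖ξ‖) := by
      positivity
    nlinarith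
  have hC0 : 0 ≤ C := by positivity
  rw [mul_assoc, ← Real.exp_add]
  rcases le_total (l * ω ‖y‖) (κ * ω ‖ξ‖) with h | h
  · refine h2.trans ?_
    gcongr
    linarith
  · refine h1.trans ?_
    gcongr
    linarith

end Decay

/-! ### Weighted estimates of derivatives of tame functions -/

section Derivatives

variable {d : ℕ} {ω : WeightFunction} {f g : Rd d → ℂ}

/-- The monomial `t ↦ ∏_{j ∈ L} t_j`. -/
def coordProd (L : List (Fin d)) (t : Rd d) : ℂ := (L.map fun j => (t j : ℂ)).prod

theorem coordProd_nil (t : Rd d) : coordProd [] t = 1 := rfl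

theorem coordProd_cons (j : Fin d) (L : List (Fin d)) (t : Rd d) :
    coordProd (j :: L) t = (t j : ℂ) * coordProd L t := by simp [coordProd]

theorem norm_coordProd_le (L : List (Fin d)) (t : Rd d) : ‖coordProd L t‖ ≤ ‖t‖ ^ L.length := by
  induction L with
  | nil => simp [coordProd_nil]
  | cons j L ih =>
    rw [coordProd_cons, norm_mul, List.length_cons, pow_succ']
    gcongr
    simpa using PiLp.norm_apply_le t j

/-- The coordinate `t ↦ t_j`, as a linear map into `ℂ`. -/
def coordCLM (j : Fin d) : Rd d →L[ℝ] ℂ := Complex.ofRealCLM.comp (EuclideanSpace.proj j)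

theorem coordCLM_apply (j : Fin d) (t : Rd d) : coordCLM j t = (t j : ℂ) := rfl

theorem norm_coordCLM_le (j : Fin d) : ‖coordCLM j‖ ≤ 1 := by
  refine ContinuousLinearMap.opNorm_le_bound _ zero_le_one fun t => ?_
  rw [coordCLM_apply, one_mul]
  simpa using PiLp.norm_apply_le t j

theorem coordProd_contDiff (L : List (Fin d)) : ContDiff ℝ (⊤ : ℕ∞) (coordProd L) := by
  induction L with
  | nil => exact contDiff_const
  | cons j L ih =>
    have : coordProd (j :: L) = fun t => coordCLM j t * coordProd L t := by
      funext t
      rw [coordProd_cons, coordCLM_apply]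
    rw [this]
    exact (coordCLM j).contDiff.mul ih

theorem listDeriv_eq_iteratedFDeriv (L : List (Fin d)) (hf : ContDiff ℝ (⊤ : ℕ∞) f) :
    listDeriv L f = fun x => iteratedFDeriv ℝ L.length f x
      fun i => EuclideanSpace.single (L.get i) (1 : ℝ) := by
  induction L with
  | nil =>
    funext x
    simp [listDeriv]
  | cons j L ih =>
    funext x
    change pderiv j (listDeriv L f) x = _
    have hd : DifferentiableAt ℝ (iteratedFDeriv ℝ L.length f) x :=
      (hf.differentiable_iteratedFDeriv (by exact_mod_cast WithTop.coe_lt_top _)) x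
    rw [ih, pderiv, fderiv_continuousMultilinear_apply_const_apply hd]
    exact (iteratedFDeriv_succ_apply_left (𝕜 := ℝ) (f := f) (x := x) (n := L.length)
      fun i : Fin (L.length + 1) => EuclideanSpace.single ((j :: L).get i) (1 : ℝ)).symm

theorem norm_listDeriv_le (L : List (Fin d)) (hf : ContDiff ℝ (⊤ : ℕ∞) f) (x : Rd d) :
    ‖listDeriv L f x‖ ≤ ‖iteratedFDeriv ℝ L.length f x‖ := by
  rw [listDeriv_eq_iteratedFDeriv L hf]
  refine (ContinuousMultilinearMap.le_opNorm _ _).trans ?_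
  simp

theorem norm_iteratedFDeriv_half_sq_le (i : ℕ) (hi : 1 ≤ i) :
    ‖iteratedFDeriv ℝ i (fun t : Rd d => (1 / 2 : ℝ) * ‖t‖ ^ 2) 0‖ ≤ 1 := by
  obtain ⟨k, rfl⟩ : ∃ k, i = k + 1 := ⟨i - 1, by omega⟩
  have hfd : fderiv ℝ (fun t : Rd d => (1 / 2 : ℝ) * ‖t‖ ^ 2) = fun t => innerSL ℝ t := by
    funext t
    have h := ((hasStrictFDerivAt_norm_sq t).hasFDerivAt.const_mul (1 / 2 : ℝ)).fderiv
    rw [h]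
    ext v
    simp
  have hfd' : fderiv ℝ (fun t : Rd d => innerSL ℝ t) = fun _ => innerSL ℝ := by
    funext t
    exact (innerSL ℝ : Rd d →L[ℝ] Rd d →L[ℝ] ℝ).fderiv
  rw [← norm_iteratedFDeriv_fderiv, hfd]
  rcases k with _ | k
  · simp
  · rw [← norm_iteratedFDeriv_fderiv, hfd']
    rcases k with _ | k
    · rw [norm_iteratedFDeriv_zero]
      exact norm_innerSL_le ℝ
    · rw [iteratedFDeriv_const_of_ne (by omega)]
      simp

/-- The reciprocal `e^{|t-y|²/2}` of the Gaussian centred at `y`. -/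
def invGaussian (y t : Rd d) : ℂ := Complex.exp (((1 / 2 : ℝ) * ‖t - y‖ ^ 2 : ℝ) : ℂ)

theorem gaussian_mul_invGaussian (y t : Rd d) : gaussian d (t - y) * invGaussian y t = 1 := by
  rw [gaussian, invGaussian, ← Complex.exp_add]
  push_cast
  ring_nf
  simp

theorem invGaussian_contDiff (y : Rd d) : ContDiff ℝ (⊤ : ℕ∞) (invGaussian y) :=
  Complex.contDiff_exp.comp (Complex.ofRealCLM.contDiff.comp (contDiff_const.mul
    ((contDiff_norm_sq ℝ).comp (contDiff_id.sub contDiff_const))))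

theorem iteratedDeriv_cexp_ofReal (n : ℕ) :
    iteratedDeriv n (fun s : ℝ => Complex.exp (s : ℂ)) = fun s : ℝ => Complex.exp (s : ℂ) := by
  induction n with
  | zero => simp
  | succ n ih =>
    rw [iteratedDeriv_succ, ih]
    funext s
    have := (Complex.hasDerivAt_exp (s : ℂ)).comp_ofReal
    exact this.deriv

/-- Since `|t|²/2` has derivatives of norm at most one at the origin, the Faà di Bruno formula
bounds the derivatives of its exponential by `n!`. -/
theorem norm_iteratedFDeriv_invGaussian_le (y : Rd d) (n : ℕ) :
    ‖iteratedFDeriv ℝ n (invGaussian y) y‖ ≤ n.factorial := by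
  have e : invGaussian y = fun t => ((fun s : ℝ => Complex.exp (s : ℂ)) ∘
      fun t : Rd d => (1 / 2 : ℝ) * ‖t‖ ^ 2) (t - y) := rfl
  rw [e, iteratedFDeriv_comp_sub]
  have h := norm_iteratedFDeriv_comp_le (𝕜 := ℝ) (n := n) (N := (⊤ : ℕ∞)) (C := 1) (D := 1)
    (g := fun s : ℝ => Complex.exp (s : ℂ)) (f := fun t : Rd d => (1 / 2 : ℝ) * ‖t‖ ^ 2)
    (Complex.contDiff_exp.comp Complex.ofRealCLM.contDiff)
    (contDiff_const.mul (contDiff_norm_sq ℝ)) (by exact_mod_cast le_top) (y - y)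
    (fun i _ => by
      rw [norm_iteratedFDeriv_eq_norm_iteratedDeriv, iteratedDeriv_cexp_ofReal]
      simp)
    (fun i hi _ => by
      rw [sub_self, one_pow]
      exact norm_iteratedFDeriv_half_sq_le i hi)
  simpa using h

theorem norm_iteratedFDeriv_coordCLM_le (j : Fin d) (y : Rd d) (i : ℕ) :
    ‖iteratedFDeriv ℝ i (coordCLM j) y‖ ≤
      (if i = 0 then ‖y‖ else 0) + (if i = 1 then 1 else 0) := by
  rcases i with _ | i
  · simp only [norm_iteratedFDeriv_zero, if_pos]
    simpa [coordCLM_apply] using PiLp.norm_apply_le y j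
  · have hfd : fderiv ℝ (coordCLM j) = fun _ => coordCLM j := by
      funext t
      exact (coordCLM j).fderiv
    rw [← norm_iteratedFDeriv_fderiv, hfd]
    rcases i with _ | i
    · simpa using norm_coordCLM_le j
    · rw [iteratedFDeriv_const_of_ne (by omega)]
      simp

/-- The factor `k!` is reproduced by multiplication with a coordinate, because the coordinate has
only one derivative and `(k choose i) (k - i)! ≤ k!`. -/
theorem norm_iteratedFDeriv_coordProd_mul_invGaussian_le (L : List (Fin d)) (y : Rd d) (k : ℕ) :
    ‖iteratedFDeriv ℝ k (fun t => coordProd L t * invGaussian y t) y‖ ≤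
      k.factorial * (1 + ‖y‖) ^ L.length := by
  induction L generalizing k with
  | nil => simpa [coordProd_nil] using norm_iteratedFDeriv_invGaussian_le y k
  | cons j L ih =>
    have e : (fun t => coordProd (j :: L) t * invGaussian y t) =
        fun t => coordCLM j t * (coordProd L t * invGaussian y t) := by
      funext t
      rw [coordProd_cons, coordCLM_apply, mul_assoc]
    rw [e]
    refine (norm_iteratedFDeriv_mul_le (coordCLM j).contDiff
      ((coordProd_contDiff L).mul (invGaussian_contDiff y)) y
      (n := k) (N := (⊤ : ℕ∞)) (by exact_mod_cast le_top)).trans ?_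
    set A := (1 + ‖y‖) ^ L.length with hA
    have hA0 : 0 ≤ A := by positivity
    have hle : ∀ i ∈ Finset.range (k + 1), (k.choose i : ℝ) * ‖iteratedFDeriv ℝ i (coordCLM j) y‖ *
        ‖iteratedFDeriv ℝ (k - i) (fun t => coordProd L t * invGaussian y t) y‖ ≤
        k.factorial * A * ((if i = 0 then ‖y‖ else 0) + (if i = 1 then 1 else 0)) := by
      intro i hi
      have hik : i ≤ k := Nat.lt_succ_iff.1 (Finset.mem_range.1 hi)
      have h1 : (k.choose i : ℝ) * (k - i).factorial ≤ k.factorial := by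
        have h2 := Nat.choose_mul_factorial_mul_factorial hik
        have h3 : k.choose i * (k - i).factorial ≤ k.factorial := by
          calc _ ≤ k.choose i * (k - i).factorial * i.factorial :=
                Nat.le_mul_of_pos_right _ i.factorial_pos
            _ = _ := by rw [← h2]; ring
        exact_mod_cast h3
      have h0 : (0 : ℝ) ≤ (if i = 0 then ‖y‖ else 0) + (if i = 1 then 1 else 0) := by
        positivity
      calc _ ≤ (k.choose i : ℝ) * ((if i = 0 then ‖y‖ else 0) + (if i = 1 then 1 else 0)) *
            ((k - i).factorial * A) := by
            gcongr
            · exact norm_iteratedFDeriv_coordCLM_le j y i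
            · exact ih (k - i)
        _ = ((k.choose i : ℝ) * (k - i).factorial) * (A *
            ((if i = 0 then ‖y‖ else 0) + (if i = 1 then 1 else 0))) := by ring
        _ ≤ k.factorial * (A * ((if i = 0 then ‖y‖ else 0) + (if i = 1 then 1 else 0))) := by
            gcongr
        _ = _ := by ring
    refine (Finset.sum_le_sum hle).trans ?_
    rw [← Finset.mul_sum, List.length_cons, pow_succ, ← hA, ← mul_assoc]
    gcongr
    rw [Finset.sum_add_distrib, Finset.sum_ite_eq', Finset.sum_ite_eq', add_comm]
    gcongr
    · split_ifs <;> norm_num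
    · split_ifs
      · exact le_rfl
      · positivity

/-- Derivatives of a tame function are controlled by the moments of its Fourier transform. -/
theorem Tame.norm_iteratedFDeriv_le (h : Tame ω f) (k : ℕ) (y : Rd d) :
    ‖iteratedFDeriv ℝ k f y‖ ≤ ∫ ξ, ‖ξ‖ ^ k * ‖fourierHat f ξ‖ := by
  have hm := fun n => h.hat_decay.integrable_pow_mul h.hat_continuous.aestronglyMeasurable n
  have hpi : 1 ≤ (2 * Real.pi) ^ d := one_le_pow₀ (by nlinarith [Real.pi_gt_three])
  set c : ℂ := ((2 * Real.pi : ℂ) ^ d)⁻¹ with hc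
  have hcn : ‖c‖ ≤ 1 := by
    rw [hc, norm_inv, norm_pow]
    have : ‖(2 * Real.pi : ℂ)‖ = 2 * Real.pi := by simp [abs_of_pos Real.pi_pos]
    rw [this]
    exact inv_le_one_of_one_le₀ hpi
  have h2 : f = c • (fourierHat (fourierHat f) ∘ LinearIsometryEquiv.neg ℝ (E := Rd d)) := by
    funext t
    simp only [Pi.smul_apply, Function.comp, smul_eq_mul, LinearIsometryEquiv.coe_neg, h.hat_hat,
      neg_neg, hc]
    rw [inv_mul_cancel_left₀]
    exact pow_ne_zero _ (by exact_mod_cast (by positivity : (2 * Real.pi) ≠ 0))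
  have hs := contDiff_fourierHat hm
  calc ‖iteratedFDeriv ℝ k f y‖ = ‖iteratedFDeriv ℝ k
        (c • (fourierHat (fourierHat f) ∘ LinearIsometryEquiv.neg ℝ (E := Rd d))) y‖ := by rw [← h2]
    _ = ‖c‖ * ‖iteratedFDeriv ℝ k (fourierHat (fourierHat f)) (-y)‖ := by
      rw [iteratedFDeriv_const_smul_apply, norm_smul,
        LinearIsometryEquiv.norm_iteratedFDeriv_comp_right]
      · rfl
      · exact ((hs.comp (LinearIsometryEquiv.contDiff _)).of_le
          (by exact_mod_cast le_top)).contDiffAt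
    _ ≤ ‖iteratedFDeriv ℝ k (fourierHat (fourierHat f)) (-y)‖ :=
      mul_le_of_le_one_left (norm_nonneg _) hcn
    _ ≤ _ := norm_iteratedFDeriv_fourierHat_le h.hat_continuous.aestronglyMeasurable hm k _

/-- The decay of the Fourier transform of `f · g(· - y)` is the frequency part of `exists_stft_le`.
-/
theorem Tame.mul_translate (hf : Tame ω f) (hg : Tame ω g) (y : Rd d) :
    Tame ω fun t => f t * g (t - y) := by
  refine ⟨hf.continuous.mul (hg.continuous.comp (continuous_id.sub continuous_const)), ?_, ?_⟩
  · obtain ⟨C, hC, h⟩ := hg.decay 0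
    refine hf.decay.of_norm_le hC fun t => ?_
    rw [norm_mul, mul_comm]
    gcongr
    simpa using h (t - y)
  · refine RapidDecay.of_nonneg fun l hl => ?_
    obtain ⟨C, hC, h⟩ := exists_stft_le hg (le_refl (0 : ℝ)) hl.le
    refine ⟨C * (weightInt ω (2 * 0 * ω.subK) f + weightInt ω (2 * l * ω.subK) (fourierHat f)),
      fun ξ => (h f hf y ξ).trans (le_of_eq ?_)⟩
    simp only [neg_zero, zero_mul, Real.exp_zero, mul_one]

/-- The weighted derivative estimate. A derivative of order `n` costs a bound `A` for the moments
`tⁿ e^{-μω(t)}`, a monomial of degree `m` a bound `B` for `tᵐ e^{-μω(t)}`. The weight `κ` on the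
Fourier side depends on `μ` only, not on the rate of decay `l` that is asked for. -/
theorem exists_iteratedFDeriv_le (ω : WeightFunction) (d : ℕ) {μ : ℝ} (hμ : 0 < μ) :
    ∃ κ : ℝ, 0 ≤ κ ∧ ∀ l : ℝ, 0 ≤ l → ∃ l' : ℝ, 0 ≤ l' ∧ ∃ C : ℝ, 0 ≤ C ∧
      ∀ f : Rd d → ℂ, Tame ω f → ∀ (L : List (Fin d)) (n : ℕ) (A B : ℝ),
        (∀ t : ℝ, 1 ≤ t → t ^ n ≤ A * Real.exp (μ * ω t)) →
        (∀ t : ℝ, 1 ≤ t → t ^ L.length ≤ B * Real.exp (μ * ω t)) → ∀ y,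
        ‖iteratedFDeriv ℝ n (fun t => coordProd L t * f t) y‖ ≤
          C * A * B * (weightInt ω l' f + weightInt ω κ (fourierHat f)) *
            Real.exp (-l * ω ‖y‖) := by
  have hK := ω.subK_pos
  have hν := ω.intRate_pos d
  obtain ⟨C₁, hC₁, hfac⟩ := ω.exists_sum_factorial_le hμ
  set κ := μ * ω.subK + ω.intRate d with hκ
  refine ⟨2 * κ * ω.subK, by positivity, fun l hl => ?_⟩
  obtain ⟨C₂, hC₂, hstft⟩ := exists_stft_le (gaussian_tame ω d) (l := l + μ * ω.subK) (κ := κ)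
    (by positivity) (by positivity)
  set I := ∫ x : Rd d, Real.exp (-ω.intRate d * ω ‖x‖) with hI
  have hI0 : 0 ≤ I := integral_nonneg fun _ => Real.exp_nonneg _
  refine ⟨2 * (l + μ * ω.subK) * ω.subK, by positivity,
    C₁ * C₂ * I * Real.exp (μ * ω.subK * (ω 1 + 1)), by positivity,
    fun f hf L n A B hA hB y => ?_⟩
  obtain ⟨hA0, -⟩ := ω.one_add_pow_le hμ.le hA
  obtain ⟨hB0, hB'⟩ := ω.one_add_pow_le hμ.le hB
  set S := weightInt ω (2 * (l + μ * ω.subK) * ω.subK) f +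
    weightInt ω (2 * κ * ω.subK) (fourierHat f) with hS
  have hS0 : 0 ≤ S := add_nonneg (weightInt_nonneg _ _ _) (weightInt_nonneg _ _ _)
  set h : Rd d → ℂ := fun t => f t * gaussian d (t - y) with hh
  have hT : Tame ω h := hf.mul_translate (gaussian_tame ω d) y
  have hhat : ∀ ξ, ‖fourierHat h ξ‖ ≤
      C₂ * S * Real.exp (-(l + μ * ω.subK) * ω ‖y‖) * Real.exp (-κ * ω ‖ξ‖) := hstft f hf y
  have e : (fun t => coordProd L t * f t) = fun t => h t * (coordProd L t * invGaussian y t) := by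
    funext t
    calc _ = coordProd L t * f t * (gaussian d (t - y) * invGaussian y t) := by
          rw [gaussian_mul_invGaussian, mul_one]
      _ = _ := by rw [hh]; ring
  have hm := fun n => hT.hat_decay.integrable_pow_mul hT.hat_continuous.aestronglyMeasurable n
  set R := (1 + ‖y‖) ^ L.length with hR
  have hR0 : 0 ≤ R := by positivity
  -- the Leibniz rule at the point `y`
  have hleibniz : ‖iteratedFDeriv ℝ n (fun t => coordProd L t * f t) y‖ ≤
      R * ∫ ξ, (∑ k ∈ Finset.range (n + 1), (n.choose k : ℝ) * ‖ξ‖ ^ k * (n - k).factorial) *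
        ‖fourierHat h ξ‖ := by
    rw [e]
    refine (norm_iteratedFDeriv_mul_le hT.contDiff
      ((coordProd_contDiff L).mul (invGaussian_contDiff y)) y
      (n := n) (by exact_mod_cast le_top)).trans ?_
    have e2 : ∫ ξ, (∑ k ∈ Finset.range (n + 1), (n.choose k : ℝ) * ‖ξ‖ ^ k * (n - k).factorial) *
        ‖fourierHat h ξ‖ = ∑ k ∈ Finset.range (n + 1), (n.choose k : ℝ) * (n - k).factorial *
          ∫ ξ, ‖ξ‖ ^ k * ‖fourierHat h ξ‖ := by
      simp only [Finset.sum_mul, ← integral_const_mul]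
      rw [← integral_finsetSum _ fun k _ => (hm k).const_mul _]
      congr 1
      funext ξ
      exact Finset.sum_congr rfl fun k _ => by ring
    rw [e2, Finset.mul_sum]
    refine Finset.sum_le_sum fun k _ => ?_
    calc _ ≤ (n.choose k : ℝ) * (∫ ξ, ‖ξ‖ ^ k * ‖fourierHat h ξ‖) * ((n - k).factorial * R) := by
          gcongr
          · exact hT.norm_iteratedFDeriv_le k y
          · exact norm_iteratedFDeriv_coordProd_mul_invGaussian_le L y (n - k)
      _ = _ := by ring
  -- the sum over `k` is controlled by the moments of order `n`
  have hmoment : ∫ ξ, (∑ k ∈ Finset.range (n + 1), (n.choose k : ℝ) * ‖ξ‖ ^ k * (n - k).factorial) *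
        ‖fourierHat h ξ‖ ≤ C₁ * A * (C₂ * S * Real.exp (-(l + μ * ω.subK) * ω ‖y‖)) * I := by
    rw [hI, ← integral_const_mul]
    refine integral_mono_of_nonneg (Eventually.of_forall fun ξ => by positivity)
      ((ω.integrable_exp d).const_mul _) (Eventually.of_forall fun ξ => ?_)
    have e3 : Real.exp (-ω.intRate d * ω ‖ξ‖) =
        Real.exp (μ * ω.subK * ω ‖ξ‖) * Real.exp (-κ * ω ‖ξ‖) := by
      rw [← Real.exp_add, hκ]
      congr 1
      ring
    refine (mul_le_mul (hfac n A ‖ξ‖ (norm_nonneg _) hA) (hhat ξ) (norm_nonneg _)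
      (by positivity)).trans (le_of_eq ?_)
    beta_reduce
    rw [e3]
    ring
  refine hleibniz.trans ((mul_le_mul (hB' _ (norm_nonneg y)) hmoment
    (integral_nonneg fun ξ => by positivity) (by positivity)).trans (le_of_eq ?_))
  have e4 : Real.exp (-l * ω ‖y‖) =
      Real.exp (μ * ω.subK * ω ‖y‖) * Real.exp (-(l + μ * ω.subK) * ω ‖y‖) := by
    rw [← Real.exp_add]
    congr 1
    ring
  rw [e4]
  ring

end Derivatives

/-! ### The space `S_ω` as a barrelled space of tame functions -/

section Membership

variable {d : ℕ} {ω : WeightFunction} {f g : Rd d → ℂ}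

theorem multiList_length (α : Fin d → ℕ) : (multiList α).length = ∑ i, α i := by
  rw [multiList, List.length_flatMap]
  simp only [List.length_replicate]
  rw [← List.ofFn_eq_map, List.sum_ofFn]

/-- The weighted estimate for a fixed derivative. -/
theorem exists_listDeriv_le (ω : WeightFunction) (L : List (Fin d)) {l : ℝ} (hl : 0 ≤ l) :
    ∃ l' κ C : ℝ, 0 ≤ C ∧ ∀ f : Rd d → ℂ, Tame ω f → ∀ x, ‖listDeriv L f x‖ ≤
      C * (weightInt ω l' f + weightInt ω κ (fourierHat f)) * Real.exp (-l * ω ‖x‖) := by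
  obtain ⟨μ, hμ, A, hA, hA'⟩ := ω.exists_pow_le L.length
  obtain ⟨κ, -, h⟩ := exists_iteratedFDeriv_le ω d hμ
  obtain ⟨l', -, C, hC, h⟩ := h l hl
  refine ⟨l', κ, C * A, by positivity, fun f hf x => ?_⟩
  refine (norm_listDeriv_le L hf.contDiff x).trans ?_
  have h1 := h f hf [] L.length A 1 hA' (fun t ht => by
    simpa using mul_nonneg hμ.le (ω.nonneg t (by linarith))) x
  simpa [coordProd_nil] using h1

theorem Tame.hasDecay (h : Tame ω f) : HasDecay ω f := by
  rw [hasDecay_iff]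
  refine ⟨h.contDiff, fun l hl L => ?_⟩
  obtain ⟨l', κ, C, hC, h1⟩ := exists_listDeriv_le ω L hl.le
  refine ⟨C * (weightInt ω l' f + weightInt ω κ (fourierHat f)), fun x => ?_⟩
  have h2 := mul_le_mul_of_nonneg_right (h1 f h x) (Real.exp_nonneg (l * ω ‖x‖))
  rwa [mul_assoc _ (Real.exp _), ← Real.exp_add, neg_mul, neg_add_cancel, Real.exp_zero,
    mul_one] at h2

theorem HasDecay.rapidDecay (h : HasDecay ω f) : RapidDecay ω f := by
  refine RapidDecay.of_nonneg fun l hl => ?_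
  obtain ⟨C, hC⟩ := (hasDecay_iff.1 h).2 l hl []
  refine ⟨C, fun x => ?_⟩
  rw [neg_mul, Real.exp_neg, ← div_eq_mul_inv, le_div_iff₀ (Real.exp_pos _)]
  exact hC x

/-- The functions of `S_ω` are the tame functions: no derivatives are needed in the definition. -/
theorem mem_ultraSubmodule_iff : f ∈ ultraSubmodule ω d ↔ Tame ω f :=
  ⟨fun h => ⟨h.2.1.1.continuous, h.2.1.rapidDecay, h.2.2.rapidDecay⟩,
    fun h => ⟨h.integrable, h.hasDecay, h.hat.hasDecay⟩⟩

end Membership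

namespace UltraSchwartz

variable {d : ℕ} {ω : WeightFunction}

theorem tame (f : UltraSchwartz ω d) : Tame ω f.fn := mem_ultraSubmodule_iff.1 f.2

/-- The element of `S_ω` given by a tame function. -/
def ofTame {f : Rd d → ℂ} (h : Tame ω f) : UltraSchwartz ω d := ⟨f, mem_ultraSubmodule_iff.2 h⟩

@[simp] theorem fn_ofTame {f : Rd d → ℂ} (h : Tame ω f) : (ofTame h).fn = f := rfl

theorem ext_fn {f g : UltraSchwartz ω d} (h : f.fn = g.fn) : f = g := Subtype.ext h

@[simp] theorem fn_add (f g : UltraSchwartz ω d) : (f + g).fn = f.fn + g.fn := rfl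
@[simp] theorem fn_sub (f g : UltraSchwartz ω d) : (f - g).fn = f.fn - g.fn := rfl
@[simp] theorem fn_smul (c : ℂ) (f : UltraSchwartz ω d) : (c • f).fn = c • f.fn := rfl

@[simp] theorem fn_zero : (0 : UltraSchwartz ω d).fn = 0 := rfl

theorem hat_sub (f g : UltraSchwartz ω d) :
    fourierHat (f - g).fn = fourierHat f.fn - fourierHat g.fn := (hatLinear ω d).map_sub f g

/-- The seminorm `sup |f| e^{(n+1)ω} + sup |f̂| e^{(n+1)ω}`. -/
def level (ω : WeightFunction) (d : ℕ) (n : ℕ) : Seminorm ℂ (UltraSchwartz ω d) :=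
  seminorms ω d (false, ⟨n + 1, Set.mem_Ioi.2 (by positivity)⟩, 0) +
    seminorms ω d (true, ⟨n + 1, Set.mem_Ioi.2 (by positivity)⟩, 0)

theorem seminorms_false (l : Set.Ioi (0 : ℝ)) (α : Fin d → ℕ) (f : UltraSchwartz ω d) :
    seminorms ω d (false, l, α) f = ⨆ x, ‖multiDeriv α f.fn x‖ * Real.exp (l * ω ‖x‖) := rfl

theorem seminorms_true (l : Set.Ioi (0 : ℝ)) (α : Fin d → ℕ) (f : UltraSchwartz ω d) :
    seminorms ω d (true, l, α) f =
      ⨆ x, ‖multiDeriv α (fourierHat f.fn) x‖ * Real.exp (l * ω ‖x‖) := rfl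

theorem multiDeriv_zero (f : Rd d → ℂ) : multiDeriv 0 f = f := by
  unfold multiDeriv
  induction List.finRange d with
  | nil => rfl
  | cons i l ih => simp

theorem norm_fn_le_level (n : ℕ) (f : UltraSchwartz ω d) (x : Rd d) :
    ‖f.fn x‖ ≤ level ω d n f * Real.exp (-(n + 1) * ω ‖x‖) := by
  have h : ‖f.fn x‖ * Real.exp ((n + 1) * ω ‖x‖) ≤ level ω d n f := by
    have h1 := le_ciSup (f.2.2.1.2 (n + 1) (by positivity) 0) x
    have h2 := apply_nonneg (seminorms ω d (true, ⟨n + 1, Set.mem_Ioi.2 (by positivity)⟩, 0)) f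
    simp only [multiDeriv_zero] at h1
    refine h1.trans (le_trans (le_of_eq ?_) (le_add_of_nonneg_right h2))
    rw [seminorms_false]
    simp only [multiDeriv_zero]
    rfl
  rw [neg_mul, Real.exp_neg, ← div_eq_mul_inv, le_div_iff₀ (Real.exp_pos _)]
  exact h

theorem norm_hat_le_level (n : ℕ) (f : UltraSchwartz ω d) (x : Rd d) :
    ‖fourierHat f.fn x‖ ≤ level ω d n f * Real.exp (-(n + 1) * ω ‖x‖) := by
  have h : ‖fourierHat f.fn x‖ * Real.exp ((n + 1) * ω ‖x‖) ≤ level ω d n f := by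
    have h1 := le_ciSup (f.2.2.2.2 (n + 1) (by positivity) 0) x
    have h2 := apply_nonneg (seminorms ω d (false, ⟨n + 1, Set.mem_Ioi.2 (by positivity)⟩, 0)) f
    simp only [multiDeriv_zero] at h1
    refine h1.trans (le_trans (le_of_eq ?_) (le_add_of_nonneg_left h2))
    rw [seminorms_true]
    simp only [multiDeriv_zero]
    rfl
  rw [neg_mul, Real.exp_neg, ← div_eq_mul_inv, le_div_iff₀ (Real.exp_pos _)]
  exact h

theorem level_le {n : ℕ} {f : UltraSchwartz ω d} {C D : ℝ}
    (hC : ∀ x, ‖f.fn x‖ ≤ C * Real.exp (-(n + 1) * ω ‖x‖))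
    (hD : ∀ x, ‖fourierHat f.fn x‖ ≤ D * Real.exp (-(n + 1) * ω ‖x‖)) :
    level ω d n f ≤ C + D := by
  have key : ∀ {C : ℝ} {u : Rd d → ℂ}, (∀ x, ‖u x‖ ≤ C * Real.exp (-(n + 1) * ω ‖x‖)) →
      ⨆ x, ‖u x‖ * Real.exp ((n + 1) * ω ‖x‖) ≤ C := by
    intro C u h
    refine ciSup_le fun x => ?_
    have h1 := h x
    rwa [neg_mul, Real.exp_neg, ← div_eq_mul_inv, le_div_iff₀ (Real.exp_pos _)] at h1
  refine add_le_add ?_ ?_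
  · rw [seminorms_false]
    simp only [multiDeriv_zero]
    exact key hC
  · rw [seminorms_true]
    simp only [multiDeriv_zero]
    exact key hD

theorem level_le_two_mul {n : ℕ} {f : UltraSchwartz ω d} {C : ℝ}
    (hC : ∀ x, ‖f.fn x‖ ≤ C * Real.exp (-(n + 1) * ω ‖x‖))
    (hD : ∀ x, ‖fourierHat f.fn x‖ ≤ C * Real.exp (-(n + 1) * ω ‖x‖)) :
    level ω d n f ≤ 2 * C := (level_le hC hD).trans (two_mul C).ge

theorem exp_rate_le {a b r : ℝ} (hab : a ≤ b) (hr : 0 ≤ r) :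
    Real.exp (-b * r) ≤ Real.exp (-a * r) := by
  gcongr

theorem exists_weightInt_le_level (ω : WeightFunction) (d : ℕ) (l : ℝ) :
    ∃ N : ℕ, ∃ C : ℝ, 0 ≤ C ∧ ∀ n ≥ N, ∀ f : UltraSchwartz ω d,
      weightInt ω l f.fn ≤ C * level ω d n f ∧
      weightInt ω l (fourierHat f.fn) ≤ C * level ω d n f := by
  obtain ⟨N, hN⟩ := exists_nat_ge (l + ω.intRate d)
  refine ⟨N, ∫ x : Rd d, Real.exp (-ω.intRate d * ω ‖x‖), integral_nonneg fun _ => by positivity,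
    fun n hn f => ?_⟩
  have hn' : l + ω.intRate d ≤ n + 1 := by
    have : (N : ℝ) ≤ n := by exact_mod_cast hn
    linarith
  have h0 : 0 ≤ level ω d n f := apply_nonneg _ _
  constructor
  · rw [mul_comm]
    refine (integrable_of_bound f.tame.continuous.aestronglyMeasurable fun x => ?_).2
    exact (norm_fn_le_level n f x).trans
      (mul_le_mul_of_nonneg_left (exp_rate_le hn' (ω.norm_nonneg' x)) h0)
  · rw [mul_comm]
    refine (integrable_of_bound f.tame.hat_continuous.aestronglyMeasurable fun x => ?_).2
    exact (norm_hat_le_level n f x).trans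
      (mul_le_mul_of_nonneg_left (exp_rate_le hn' (ω.norm_nonneg' x)) h0)

theorem weightInt_hat_hat {f : Rd d → ℂ} (h : Tame ω f) (l : ℝ) :
    weightInt ω l (fourierHat (fourierHat f)) = (2 * Real.pi) ^ d * weightInt ω l f := by
  rw [weightInt, weightInt, ← integral_const_mul, ← integral_neg_eq_self]
  simp only [h.norm_hat_hat, neg_neg, norm_neg, mul_assoc]

/-- The seminorms with derivatives are dominated by those without derivatives. -/
theorem exists_seminorms_le (ω : WeightFunction) (d : ℕ)
    (i : Bool × Set.Ioi (0 : ℝ) × (Fin d → ℕ)) :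
    ∃ N : ℕ, ∃ C : ℝ, 0 ≤ C ∧ ∀ f : UltraSchwartz ω d, seminorms ω d i f ≤ C * level ω d N f := by
  obtain ⟨b, l, α⟩ := i
  have hl : (0 : ℝ) < l := l.2
  obtain ⟨l', κ, C, hC, h⟩ := exists_listDeriv_le ω (multiList α) hl.le
  obtain ⟨N₁, C₁, hC₁, h₁⟩ := exists_weightInt_le_level ω d l'
  obtain ⟨N₂, C₂, hC₂, h₂⟩ := exists_weightInt_le_level ω d κ
  have hpi : 1 ≤ (2 * Real.pi) ^ d := one_le_pow₀ (by nlinarith [Real.pi_gt_three])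
  refine ⟨max N₁ N₂, C * (C₁ + (2 * Real.pi) ^ d * C₂), by positivity, fun f => ?_⟩
  have h1 := h₁ _ (le_max_left N₁ N₂) f
  have h2 := h₂ _ (le_max_right N₁ N₂) f
  have h0 : 0 ≤ level ω d (max N₁ N₂) f := apply_nonneg _ _
  have key : ∀ {u : Rd d → ℂ}, Tame ω u → weightInt ω l' u ≤ C₁ * level ω d (max N₁ N₂) f →
      weightInt ω κ (fourierHat u) ≤ (2 * Real.pi) ^ d * (C₂ * level ω d (max N₁ N₂) f) →
      ⨆ x, ‖multiDeriv α u x‖ * Real.exp (l * ω ‖x‖) ≤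
        C * (C₁ + (2 * Real.pi) ^ d * C₂) * level ω d (max N₁ N₂) f := by
    intro u hu hu1 hu2
    refine ciSup_le fun x => ?_
    have h3 := h u hu x
    rw [neg_mul, Real.exp_neg, ← div_eq_mul_inv, le_div_iff₀ (Real.exp_pos _),
      ← multiDeriv_eq_listDeriv] at h3
    refine h3.trans ?_
    calc _ ≤ C * (C₁ * level ω d (max N₁ N₂) f +
          (2 * Real.pi) ^ d * (C₂ * level ω d (max N₁ N₂) f)) := by gcongr
      _ = _ := by ring
  cases b
  · rw [seminorms_false]
    refine key f.tame h1.1 (h2.2.trans (le_mul_of_one_le_left ?_ hpi))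
    positivity
  · rw [seminorms_true]
    refine key f.tame.hat h1.2 ?_
    rw [weightInt_hat_hat f.tame]
    gcongr
    exact h2.1

theorem level_mono {m n : ℕ} (h : m ≤ n) : level ω d m ≤ level ω d n := by
  intro f
  have h0 : 0 ≤ level ω d n f := apply_nonneg _ _
  have hmn : (m + 1 : ℝ) ≤ n + 1 := by exact_mod_cast Nat.succ_le_succ h
  have key : ∀ {u : Rd d → ℂ}, (∀ l : ℝ, 0 < l →
      BddAbove (Set.range fun x => ‖u x‖ * Real.exp (l * ω ‖x‖))) →
      ⨆ x, ‖u x‖ * Real.exp ((m + 1) * ω ‖x‖) ≤ ⨆ x, ‖u x‖ * Real.exp ((n + 1) * ω ‖x‖) := by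
    intro u hu
    refine ciSup_mono (hu _ (by positivity)) fun x => ?_
    gcongr
    exact ω.norm_nonneg' x
  refine add_le_add ?_ ?_
  · rw [seminorms_false, seminorms_false]
    simp only [multiDeriv_zero]
    refine key fun l hl => ?_
    have h := f.2.2.1.2 l hl 0
    simp only [multiDeriv_zero] at h
    exact h
  · rw [seminorms_true, seminorms_true]
    simp only [multiDeriv_zero]
    refine key fun l hl => ?_
    have h := f.2.2.2.2 l hl 0
    simp only [multiDeriv_zero] at h
    exact h

theorem withSeminorms_level (ω : WeightFunction) (d : ℕ) : WithSeminorms (level ω d) := by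
  have hp : WithSeminorms (seminorms ω d) := ⟨rfl⟩
  refine hp.congr (fun n => ?_) fun i => ?_
  · set a : Bool × Set.Ioi (0 : ℝ) × (Fin d → ℕ) :=
      (false, ⟨n + 1, Set.mem_Ioi.2 (by positivity)⟩, 0)
    set b : Bool × Set.Ioi (0 : ℝ) × (Fin d → ℕ) :=
      (true, ⟨n + 1, Set.mem_Ioi.2 (by positivity)⟩, 0)
    refine ⟨{a, b}, 2, fun f => ?_⟩
    have h1 : seminorms ω d a ≤ ({a, b} : Finset _).sup (seminorms ω d) :=
      Finset.le_sup (by simp)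
    have h2 : seminorms ω d b ≤ ({a, b} : Finset _).sup (seminorms ω d) :=
      Finset.le_sup (by simp)
    have h3 := add_le_add (h1 f) (h2 f)
    rw [← two_mul] at h3
    exact h3
  · obtain ⟨N, C, hC, h⟩ := exists_seminorms_le ω d i
    refine ⟨{N}, ⟨C, hC⟩, fun f => ?_⟩
    rw [Finset.sup_singleton]
    exact h f

theorem exists_le_level {p : Seminorm ℂ (UltraSchwartz ω d)} (hp : Continuous p) :
    ∃ n : ℕ, ∃ C : ℝ, 0 ≤ C ∧ ∀ f, p f ≤ C * level ω d n f := by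
  obtain ⟨s, C, -, h⟩ := Seminorm.bound_of_continuous (withSeminorms_level ω d) p hp
  have hs : s.sup (level ω d) ≤ level ω d (s.sup id) :=
    Finset.sup_le fun i hi => level_mono (Finset.le_sup (f := id) hi)
  exact ⟨s.sup id, C, C.2, fun f => (h f).trans (mul_le_mul_of_nonneg_left (hs f) C.2)⟩

theorem continuous_of_le_level {p : Seminorm ℂ (UltraSchwartz ω d)} {n : ℕ} {C : ℝ}
    (h : ∀ f, p f ≤ C * level ω d n f) : Continuous p := by
  have hp := withSeminorms_level ω d
  have := hp.topologicalAddGroup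
  have := hp.continuousSMul
  refine Seminorm.continuous_of_le (q := C.toNNReal • level ω d n) ?_ fun f => ?_
  · exact (hp.continuous_seminorm n).const_smul C.toNNReal
  · refine (h f).trans ?_
    exact mul_le_mul_of_nonneg_right (Real.le_coe_toNNReal C) (apply_nonneg _ _)

/-- A Cauchy sequence of `S_ω` converges: the weighted uniform limits of the functions and of their
Fourier transforms again form a Fourier pair. -/
theorem exists_level_tendsto (u : ℕ → UltraSchwartz ω d)
    (hu : ∀ (n : ℕ) (ε : ℝ), 0 < ε → ∃ N, ∀ k ≥ N, ∀ m ≥ N, level ω d n (u k - u m) < ε) :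
    ∃ f, ∀ (n : ℕ) (ε : ℝ), 0 < ε → ∃ N, ∀ k ≥ N, level ω d n (u k - f) < ε := by
  have hexp : ∀ (n : ℕ) (x : Rd d), Real.exp (-(n + 1) * ω ‖x‖) ≤ 1 := fun n x => by
    rw [Real.exp_le_one_iff]
    nlinarith [mul_nonneg (show (0 : ℝ) ≤ n + 1 by positivity) (ω.norm_nonneg' x)]
  -- a general limit procedure, for the functions as well as for their transforms
  have lim : ∀ v : ℕ → Rd d → ℂ, (∀ k, Continuous (v k)) → (∀ k, RapidDecay ω (v k)) →
      (∀ (n k m : ℕ) (x : Rd d), ‖v k x - v m x‖ ≤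
        level ω d n (u k - u m) * Real.exp (-(n + 1) * ω ‖x‖)) →
      ∃ g : Rd d → ℂ, Continuous g ∧ RapidDecay ω g ∧
        ∀ (n : ℕ) (ε : ℝ), 0 < ε → ∃ N, ∀ k ≥ N, ∀ x,
          ‖v k x - g x‖ ≤ ε * Real.exp (-(n + 1) * ω ‖x‖) := by
    intro v hvc hvd hv
    have hcau : ∀ x, CauchySeq fun k => v k x := by
      intro x
      refine Metric.cauchySeq_iff.2 fun ε hε => ?_
      obtain ⟨N, hN⟩ := hu 0 ε hε
      refine ⟨N, fun k hk m hm => ?_⟩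
      rw [dist_eq_norm]
      refine lt_of_le_of_lt ((hv 0 k m x).trans ?_) (hN k hk m hm)
      exact mul_le_of_le_one_right (apply_nonneg _ _) (hexp 0 x)
    choose g hg using fun x => cauchySeq_tendsto_of_complete (hcau x)
    have hlim : ∀ (n : ℕ) (ε : ℝ), 0 < ε → ∃ N, ∀ k ≥ N, ∀ x,
        ‖v k x - g x‖ ≤ ε * Real.exp (-(n + 1) * ω ‖x‖) := by
      intro n ε hε
      obtain ⟨N, hN⟩ := hu n ε hε
      refine ⟨N, fun k hk x => ?_⟩
      refine le_of_tendsto (((hg x).const_sub (v k x)).norm) ?_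
      filter_upwards [eventually_ge_atTop N] with m hm
      refine (hv n k m x).trans ?_
      gcongr
      exact (hN k hk m hm).le
    refine ⟨g, ?_, ?_, hlim⟩
    · have hunif : TendstoUniformly v g atTop := by
        refine Metric.tendstoUniformly_iff.2 fun ε hε => ?_
        obtain ⟨N, hN⟩ := hlim 0 (ε / 2) (by positivity)
        filter_upwards [eventually_ge_atTop N] with k hk x
        rw [dist_comm, dist_eq_norm]
        refine lt_of_le_of_lt ((hN k hk x).trans ?_) (half_lt_self hε)
        exact mul_le_of_le_one_right (by positivity) (hexp 0 x)
      exact hunif.continuous (Frequently.of_forall hvc)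
    · intro l
      obtain ⟨n, hn⟩ := exists_nat_ge l
      obtain ⟨N, hN⟩ := hlim n 1 one_pos
      obtain ⟨C, hC, h⟩ := hvd N l
      refine ⟨C + 1, by positivity, fun x => ?_⟩
      have h1 := hN N le_rfl x
      have h2 := norm_le_norm_add_norm_sub' (g x) (v N x)
      rw [norm_sub_rev] at h2
      have h3 := exp_rate_le (show l ≤ n + 1 by linarith) (ω.norm_nonneg' x)
      have h4 := h x
      linarith
  obtain ⟨g, hgc, hgd, hg⟩ := lim (fun k => (u k).fn) (fun k => (u k).tame.continuous)
    (fun k => (u k).tame.decay) fun n k m x => by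
      simpa using norm_fn_le_level n (u k - u m) x
  obtain ⟨h, hhc, hhd, hh⟩ := lim (fun k => fourierHat (u k).fn)
    (fun k => (u k).tame.hat_continuous)
    (fun k => (u k).tame.hat_decay) fun n k m x => by
      have h := norm_hat_le_level n (u k - u m) x
      rwa [hat_sub] at h
  have hgi := hgd.integrable hgc.aestronglyMeasurable
  have hgh : fourierHat g = h := by
    funext ξ
    refine tendsto_nhds_unique (f := fun k => fourierHat (u k).fn ξ) (l := atTop) ?_ ?_
    · rw [Metric.tendsto_atTop]
      intro ε hε
      obtain ⟨n, hn⟩ := exists_nat_ge (ω.intRate d)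
      set I := ∫ x : Rd d, Real.exp (-ω.intRate d * ω ‖x‖) with hI
      have hI0 : 0 ≤ I := integral_nonneg fun _ => by positivity
      obtain ⟨N, hN⟩ := hg n (ε / (I + 1)) (by positivity)
      refine ⟨N, fun k hk => ?_⟩
      have e : fourierHat (u k).fn ξ - fourierHat g ξ = fourierHat ((u k).fn - g) ξ := by
        have h1 := congrFun (fourierHat_add ((u k).tame.integrable.sub hgi) hgi) ξ
        rw [sub_add_cancel] at h1
        rw [h1, Pi.add_apply, add_sub_cancel_right]
      rw [dist_eq_norm, e]
      refine lt_of_le_of_lt (norm_fourierHat_le _ _) ?_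
      have h2 : ∫ t, ‖((u k).fn - g) t‖ ≤ ε / (I + 1) * I := by
        rw [hI, ← integral_const_mul]
        refine integral_mono_of_nonneg (Eventually.of_forall fun _ => norm_nonneg _)
          ((ω.integrable_exp d).const_mul _) (Eventually.of_forall fun x => ?_)
        exact (hN k hk x).trans (mul_le_mul_of_nonneg_left
          (exp_rate_le (by linarith) (ω.norm_nonneg' x)) (by positivity))
      refine lt_of_le_of_lt h2 ?_
      rw [div_mul_eq_mul_div, div_lt_iff₀ (by positivity)]
      nlinarith
    · rw [Metric.tendsto_atTop]
      intro ε hε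
      obtain ⟨N, hN⟩ := hh 0 (ε / 2) (by positivity)
      refine ⟨N, fun k hk => ?_⟩
      rw [dist_eq_norm]
      refine lt_of_le_of_lt ((hN k hk ξ).trans ?_) (half_lt_self hε)
      exact mul_le_of_le_one_right (by positivity) (hexp 0 ξ)
  have hT : Tame ω g := ⟨hgc, hgd, hgh ▸ hhd⟩
  refine ⟨ofTame hT, fun n ε hε => ?_⟩
  obtain ⟨N₁, hN₁⟩ := hg n (ε / 3) (by positivity)
  obtain ⟨N₂, hN₂⟩ := hh n (ε / 3) (by positivity)
  refine ⟨max N₁ N₂, fun k hk => ?_⟩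
  refine lt_of_le_of_lt (level_le (C := ε / 3) (D := ε / 3) (fun x => ?_) fun x => ?_)
    (by linarith)
  · exact hN₁ k ((le_max_left _ _).trans hk) x
  · rw [hat_sub, fn_ofTame, hgh]
    exact hN₂ k ((le_max_right _ _).trans hk) x

/-- `S_ω` is a Fréchet space, hence barrelled. -/
instance barrelledSpace : BarrelledSpace ℂ (UltraSchwartz ω d) := by
  have hp := withSeminorms_level ω d
  have := hp.topologicalAddGroup
  have := hp.continuousSMul
  have := hp.firstCountableTopology
  let _ : UniformSpace (UltraSchwartz ω d) := IsTopologicalAddGroup.rightUniformSpace _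
  have : IsUniformAddGroup (UltraSchwartz ω d) := isUniformAddGroup_of_addCommGroup
  have : (uniformity (UltraSchwartz ω d)).IsCountablyGenerated :=
    IsUniformAddGroup.uniformity_countably_generated
  have : CompleteSpace (UltraSchwartz ω d) := by
    refine UniformSpace.complete_of_cauchySeq_tendsto fun u hu => ?_
    obtain ⟨f, hf⟩ := exists_level_tendsto u fun n ε hε => by
      have hV : {q : UltraSchwartz ω d × UltraSchwartz ω d | level ω d n (q.2 - q.1) < ε} ∈
          uniformity (UltraSchwartz ω d) := by
        rw [uniformity_eq_comap_nhds_zero]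
        refine ⟨(level ω d n).ball 0 ε, ?_, fun q hq => ?_⟩
        · exact (hp.mem_nhds_iff 0 _).2 ⟨{n}, ε, hε, by simp⟩
        · simpa [Seminorm.mem_ball] using hq
      obtain ⟨N, hN⟩ := cauchySeq_iff.1 hu _ hV
      exact ⟨N, fun k hk m hm => hN m hm k hk⟩
    exact ⟨f, (hp.tendsto_nhds_atTop u f).2 hf⟩
  have : BaireSpace (UltraSchwartz ω d) := inferInstance
  exact BaireSpace.instBarrelledSpace

end UltraSchwartz

theorem UltraDistribution.exists_norm_le_level {ω : WeightFunction} {d : ℕ}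
    (a : UltraDistribution ω d) :
    ∃ n : ℕ, ∃ C : ℝ, 0 ≤ C ∧ ∀ f, ‖a f‖ ≤ C * UltraSchwartz.level ω d n f :=
  UltraSchwartz.exists_le_level (p := (normSeminorm ℂ ℂ).comp a.toLinearMap)
    (continuous_norm.comp a.continuous)

/-! ### The structure of ultradistributions -/

/-- A functional that is bounded with respect to an embedding into a product of two Hilbert spaces
is given by inner products. -/
theorem exists_inner_add_inner {X H₁ H₂ : Type*} [AddCommGroup X] [Module ℂ X]
    [NormedAddCommGroup H₁] [InnerProductSpace ℂ H₁] [CompleteSpace H₁]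
    [NormedAddCommGroup H₂] [InnerProductSpace ℂ H₂] [CompleteSpace H₂]
    (J : X →ₗ[ℂ] H₁ × H₂) (hJ : Function.Injective J) (b : X →ₗ[ℂ] ℂ) (C : ℝ)
    (hb : ∀ f, ‖b f‖ ≤ C * ‖J f‖) :
    ∃ u v, ∀ f, b f = inner ℂ u (J f).1 + inner ℂ v (J f).2 := by
  let e := LinearEquiv.ofInjective J hJ
  let φ : LinearMap.range J →L[ℂ] ℂ := (b.comp e.symm.toLinearMap).mkContinuous C fun v => by
    obtain ⟨f, rfl⟩ := e.surjective v
    simpa [e] using hb f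
  obtain ⟨g, hg, -⟩ := exists_extension_norm_eq (LinearMap.range J) φ
  have hgJ : ∀ f, g (J f) = b f := by
    intro f
    have h1 := hg (e f)
    have h2 : φ (e f) = b f := by simp [φ]
    exact h1.trans h2
  refine ⟨(InnerProductSpace.toDual ℂ H₁).symm (g.comp (ContinuousLinearMap.inl ℂ H₁ H₂)),
    (InnerProductSpace.toDual ℂ H₂).symm (g.comp (ContinuousLinearMap.inr ℂ H₁ H₂)), fun f => ?_⟩
  rw [InnerProductSpace.toDual_symm_apply, InnerProductSpace.toDual_symm_apply, ← hgJ]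
  simp only [ContinuousLinearMap.comp_apply, ContinuousLinearMap.inl_apply,
    ContinuousLinearMap.inr_apply, ← map_add, Prod.mk_add_mk, add_zero, zero_add]

namespace UltraSchwartz

variable {d : ℕ} {ω : WeightFunction}

theorem weightInt_mono {f : Rd d → ℂ} (hf : RapidDecay ω f) (hc : Continuous f) {l l' : ℝ}
    (h : l ≤ l') : weightInt ω l f ≤ weightInt ω l' f := by
  refine integral_mono (hf.integrable_weight hc.aestronglyMeasurable l)
    (hf.integrable_weight hc.aestronglyMeasurable l') fun x => ?_
  have := ω.norm_nonneg' x
  dsimp only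
  gcongr

theorem exists_level_le_weightInt (ω : WeightFunction) (d n : ℕ) : ∃ l C : ℝ, 0 ≤ C ∧
    ∀ f : UltraSchwartz ω d,
      level ω d n f ≤ C * (weightInt ω l f.fn + weightInt ω l (fourierHat f.fn)) := by
  obtain ⟨l', κ, C, hC, h⟩ := exists_listDeriv_le (d := d) ω [] (l := n + 1) (by positivity)
  have hpi : 1 ≤ (2 * Real.pi) ^ d := one_le_pow₀ (by nlinarith [Real.pi_gt_three])
  refine ⟨max l' κ, C * (1 + (2 * Real.pi) ^ d), by positivity, fun f => ?_⟩
  set P := weightInt ω (max l' κ) f.fn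
  set Q := weightInt ω (max l' κ) (fourierHat f.fn)
  have hP : 0 ≤ P := weightInt_nonneg _ _ _
  have hQ : 0 ≤ Q := weightInt_nonneg _ _ _
  have h1 : ∀ x, ‖f.fn x‖ ≤ C * (P + Q) * Real.exp (-(n + 1) * ω ‖x‖) := by
    intro x
    refine (h f.fn f.tame x).trans ?_
    gcongr
    · exact weightInt_mono f.tame.decay f.tame.continuous (le_max_left _ _)
    · exact weightInt_mono f.tame.hat_decay f.tame.hat_continuous (le_max_right _ _)
  have h2 : ∀ x, ‖fourierHat f.fn x‖ ≤
      C * (Q + (2 * Real.pi) ^ d * P) * Real.exp (-(n + 1) * ω ‖x‖) := by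
    intro x
    refine (h _ f.tame.hat x).trans ?_
    rw [weightInt_hat_hat f.tame]
    gcongr
    · exact weightInt_mono f.tame.hat_decay f.tame.hat_continuous (le_max_left _ _)
    · exact weightInt_mono f.tame.decay f.tame.continuous (le_max_right _ _)
  refine (level_le h1 h2).trans ?_
  have : 0 ≤ C * ((2 * Real.pi) ^ d * Q) + C * 0 := by positivity
  nlinarith [mul_nonneg hC (mul_nonneg (sub_nonneg.2 hpi) hQ)]

/-- Multiplication by the weight `e^{sω}`. -/
def weighted (ω : WeightFunction) (s : ℝ) (f : Rd d → ℂ) : Rd d → ℂ :=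
  fun x => f x * (Real.exp (s * ω ‖x‖) : ℝ)

theorem norm_weighted (s : ℝ) (f : Rd d → ℂ) (x : Rd d) :
    ‖weighted ω s f x‖ = ‖f x‖ * Real.exp (s * ω ‖x‖) := by
  rw [weighted, norm_mul, Complex.norm_real, Real.norm_of_nonneg (Real.exp_nonneg _)]

theorem memLp_expWeight (ω : WeightFunction) (d : ℕ) :
    MemLp (fun x : Rd d => Real.exp (-ω.intRate d * ω ‖x‖)) 2 := by
  have hc := continuous_exp_weight ω d (-ω.intRate d)
  refine (memLp_two_iff_integrable_sq_norm hc.aestronglyMeasurable).2 ?_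
  refine (ω.integrable_exp d).mono' (hc.norm.pow 2).aestronglyMeasurable
    (Eventually.of_forall fun x => ?_)
  have h1 : Real.exp (-ω.intRate d * ω ‖x‖) ≤ 1 := by
    rw [Real.exp_le_one_iff]
    nlinarith [mul_nonneg (ω.intRate_pos d).le (ω.norm_nonneg' x)]
  rw [Real.norm_of_nonneg (by positivity), Real.norm_of_nonneg (Real.exp_nonneg _), sq]
  exact mul_le_of_le_one_left (Real.exp_nonneg _) h1

theorem memLp_weighted {f : Rd d → ℂ} (hf : RapidDecay ω f) (hc : Continuous f) (s : ℝ) :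
    MemLp (weighted ω s f) 2 := by
  obtain ⟨C, hC, h⟩ := hf (s + ω.intRate d)
  refine ((memLp_expWeight ω d).const_mul C).of_le ?_ (Eventually.of_forall fun x => ?_)
  · exact (hc.mul (Complex.continuous_ofReal.comp
      (continuous_exp_weight ω d s))).aestronglyMeasurable
  · rw [norm_weighted, Real.norm_of_nonneg (by positivity)]
    refine (mul_le_mul_of_nonneg_right (h x) (Real.exp_nonneg _)).trans (le_of_eq ?_)
    rw [mul_assoc, ← Real.exp_add]
    congr 2
    ring

/-- By the Cauchy–Schwarz inequality, weighted `L¹` norms are controlled by weighted `L²` norms. -/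
theorem exists_weightInt_le_norm (ω : WeightFunction) (d : ℕ) (l : ℝ) : ∃ C : ℝ, 0 ≤ C ∧
    ∀ (f : Rd d → ℂ) (hf : MemLp (weighted ω (l + ω.intRate d) f) 2),
      weightInt ω l f ≤ C * ‖hf.toLp‖ := by
  refine ⟨(∫ x : Rd d, ‖Real.exp (-ω.intRate d * ω ‖x‖)‖ ^ (2 : ℝ)) ^ (1 / (2 : ℝ)), by positivity,
    fun f hf => ?_⟩
  have h2 : ENNReal.ofReal 2 = 2 := by norm_num
  have h := integral_mul_norm_le_Lp_mul_Lq (μ := (volume : Measure (Rd d)))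
    (f := fun x => ‖weighted ω (l + ω.intRate d) f x‖)
    (g := fun x => Real.exp (-ω.intRate d * ω ‖x‖)) Real.HolderConjugate.two_two
    (by rw [h2]; exact hf.norm) (by rw [h2]; exact memLp_expWeight ω d)
  rw [Lp.norm_toLp, hf.eLpNorm_eq_integral_rpow_norm (by norm_num) (by norm_num),
    ENNReal.toReal_ofReal (by positivity), mul_comm]
  simp only [norm_norm, ENNReal.toReal_ofNat] at h ⊢
  rw [← one_div]
  refine le_trans (le_of_eq ?_) h
  rw [weightInt]
  congr 1
  funext x
  rw [norm_weighted, Real.norm_of_nonneg (Real.exp_nonneg _), mul_assoc, ← Real.exp_add]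
  congr 2
  ring

/-- The embedding `f ↦ (f e^{sω}, f̂ e^{sω})` of `S_ω` into `L² × L²`. -/
def toL2 (ω : WeightFunction) (d : ℕ) (s : ℝ) : UltraSchwartz ω d →ₗ[ℂ]
    (Lp ℂ 2 (volume : Measure (Rd d)) × Lp ℂ 2 (volume : Measure (Rd d))) where
  toFun f := ((memLp_weighted f.tame.decay f.tame.continuous s).toLp,
    (memLp_weighted f.tame.hat_decay f.tame.hat_continuous s).toLp)
  map_add' f g := by
    refine Prod.ext ?_ ?_
    · rw [Prod.fst_add, ← MemLp.toLp_add]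
      refine (MemLp.toLp_eq_toLp_iff
        (memLp_weighted (f + g).tame.decay (f + g).tame.continuous s) _).2
        (Eventually.of_forall fun x => ?_)
      simp [weighted, add_mul]
    · rw [Prod.snd_add, ← MemLp.toLp_add]
      refine (MemLp.toLp_eq_toLp_iff
        (memLp_weighted (f + g).tame.hat_decay (f + g).tame.hat_continuous s) _).2
        (Eventually.of_forall fun x => ?_)
      have : fourierHat (f + g).fn = fourierHat f.fn + fourierHat g.fn :=
        (hatLinear ω d).map_add f g
      rw [this]
      simp [weighted, add_mul]
  map_smul' c f := by
    refine Prod.ext ?_ ?_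
    · rw [Prod.smul_fst, RingHom.id_apply, ← MemLp.toLp_const_smul]
      refine (MemLp.toLp_eq_toLp_iff
        (memLp_weighted (c • f).tame.decay (c • f).tame.continuous s) _).2
        (Eventually.of_forall fun x => ?_)
      simp [weighted, mul_assoc]
    · rw [Prod.smul_snd, RingHom.id_apply, ← MemLp.toLp_const_smul]
      refine (MemLp.toLp_eq_toLp_iff
        (memLp_weighted (c • f).tame.hat_decay (c • f).tame.hat_continuous s) _).2
        (Eventually.of_forall fun x => ?_)
      have : fourierHat (c • f).fn = c • fourierHat f.fn := (hatLinear ω d).map_smul c f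
      rw [this]
      simp [weighted, mul_assoc]

theorem exists_level_le_toL2 (ω : WeightFunction) (d n : ℕ) : ∃ s C : ℝ, 0 ≤ C ∧
    ∀ f : UltraSchwartz ω d, level ω d n f ≤ C * ‖toL2 ω d s f‖ := by
  obtain ⟨l, C, hC, h⟩ := exists_level_le_weightInt ω d n
  obtain ⟨D, hD, h'⟩ := exists_weightInt_le_norm ω d l
  refine ⟨l + ω.intRate d, C * (D + D), by positivity, fun f => (h f).trans ?_⟩
  have h1 : weightInt ω l f.fn ≤ D * ‖toL2 ω d (l + ω.intRate d) f‖ :=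
    (h' _ (memLp_weighted f.tame.decay f.tame.continuous _)).trans
      (mul_le_mul_of_nonneg_left (norm_fst_le (toL2 ω d (l + ω.intRate d) f)) hD)
  have h2 : weightInt ω l (fourierHat f.fn) ≤ D * ‖toL2 ω d (l + ω.intRate d) f‖ :=
    (h' _ (memLp_weighted f.tame.hat_decay f.tame.hat_continuous _)).trans
      (mul_le_mul_of_nonneg_left (norm_snd_le (toL2 ω d (l + ω.intRate d) f)) hD)
  rw [mul_assoc, add_mul]
  gcongr

end UltraSchwartz

namespace UltraDistribution

open UltraSchwartz

variable {d : ℕ} {ω : WeightFunction}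

/-- The functional `a` is the sum of a function `U` and of the Fourier transform of a function `W`,
both of growth at most `e^{lω}` in the mean. -/
structure Represents (a : UltraDistribution ω d) (l : ℝ) (U W : Rd d → ℂ) : Prop where
  aesm_left : AEStronglyMeasurable U
  aesm_right : AEStronglyMeasurable W
  integrable_left : Integrable fun x => ‖U x‖ * Real.exp (-l * ω ‖x‖)
  integrable_right : Integrable fun x => ‖W x‖ * Real.exp (-l * ω ‖x‖)
  conj_apply : ∀ f : UltraSchwartz ω d, starRingEnd ℂ (a f) =
    (∫ x, U x * f.fn x) + ∫ ξ, W ξ * fourierHat f.fn ξ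

/-- Structure theorem for `S'_ω`: the Hahn–Banach theorem extends the functional from the image of
`S_ω` in `L² × L²`, where it is given by inner products. -/
theorem exists_represents (a : UltraDistribution ω d) : ∃ l U W, a.Represents l U W := by
  obtain ⟨n, C, hC, ha⟩ := a.exists_norm_le_level
  obtain ⟨s, D, hD, hs⟩ := exists_level_le_toL2 ω d n
  set J := toL2 ω d s with hJ
  have hinj : Function.Injective J := by
    refine (injective_iff_map_eq_zero J).2 fun f hf => ext_fn ?_
    funext x
    have h1 := hs f
    rw [hf, norm_zero, mul_zero] at h1
    have h2 := norm_fn_le_level n f x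
    have h3 : ‖f.fn x‖ ≤ 0 := h2.trans
      (mul_nonpos_of_nonpos_of_nonneg h1 (Real.exp_nonneg _))
    simpa using h3
  let b : UltraSchwartz ω d →ₗ[ℂ] ℂ :=
    { toFun := fun f => starRingEnd ℂ (a f)
      map_add' := fun f g => by simp
      map_smul' := fun c f => by simp }
  obtain ⟨u, v, hsplit⟩ := exists_inner_add_inner J hinj b (C * D) fun f => by
    have h2 : ‖b f‖ = ‖a f‖ := Complex.norm_conj _
    rw [h2, mul_assoc]
    exact (ha f).trans (mul_le_mul_of_nonneg_left (hs f) hC)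
  have haesm : ∀ w : Lp ℂ 2 (volume : Measure (Rd d)),
      AEStronglyMeasurable (weighted ω s fun x => starRingEnd ℂ (w x)) := by
    intro w
    exact (Complex.continuous_conj.comp_aestronglyMeasurable (Lp.aestronglyMeasurable w)).mul
      (Complex.continuous_ofReal.comp (continuous_exp_weight ω d s)).aestronglyMeasurable
  have hint : ∀ w : Lp ℂ 2 (volume : Measure (Rd d)),
      Integrable fun x => ‖weighted ω s (fun x => starRingEnd ℂ (w x)) x‖ *
        Real.exp (-(s + ω.intRate d) * ω ‖x‖) := by
    intro w
    have h1 := MemLp.integrable_mul (Lp.memLp w).norm (memLp_expWeight ω d)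
    refine h1.congr (Eventually.of_forall fun x => ?_)
    simp only [Pi.mul_apply]
    rw [norm_weighted, Complex.norm_conj, mul_assoc, ← Real.exp_add]
    congr 2
    ring
  have hinner : ∀ (w : Lp ℂ 2 (volume : Measure (Rd d))) (f : Rd d → ℂ)
      (hf : MemLp (weighted ω s f) 2), inner ℂ w hf.toLp =
        ∫ x, weighted ω s (fun x => starRingEnd ℂ (w x)) x * f x := by
    intro w f hf
    rw [L2.inner_def]
    refine integral_congr_ae ?_
    filter_upwards [hf.coeFn_toLp] with x hx
    rw [hx]
    simp only [weighted, RCLike.inner_apply]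
    ring
  refine ⟨s + ω.intRate d, weighted ω s fun x => starRingEnd ℂ (u x),
    weighted ω s fun x => starRingEnd ℂ (v x), haesm u, haesm v, hint u, hint v, fun f => ?_⟩
  refine (hsplit f).trans ?_
  rw [← hinner u _ (memLp_weighted f.tame.decay f.tame.continuous s),
    ← hinner v _ (memLp_weighted f.tame.hat_decay f.tame.hat_continuous s)]
  rfl

end UltraDistribution

/-! ### Integration and differentiation under an ultradistribution -/

section Dominated

variable {d : ℕ} {ω : WeightFunction}

/-- Pairing with a function of mean growth `e^{lω}` is compatible with superposition. -/
theorem integral_mul_integral_swap {Z : Type*} [MeasurableSpace Z] {ν : Measure Z} [SFinite ν]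
    {l : ℝ} {U : Rd d → ℂ} (hU : AEStronglyMeasurable U)
    (hUi : Integrable fun x => ‖U x‖ * Real.exp (-l * ω ‖x‖)) {F : Z → Rd d → ℂ}
    (hF : StronglyMeasurable (Function.uncurry F)) {m : Z → ℝ} (hm : Integrable m ν)
    (hle : ∀ z t, ‖F z t‖ ≤ m z * Real.exp (-l * ω ‖t‖)) :
    ∫ t, U t * ∫ z, F z t ∂ν = ∫ z, (∫ t, U t * F z t) ∂ν := by
  simp only [← integral_const_mul]
  refine integral_integral_swap ?_
  refine (hUi.mul_prod hm).mono' ?_ (Eventually.of_forall fun p => ?_)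
  · exact hU.comp_fst.mul (hF.comp_measurable measurable_swap).aestronglyMeasurable
  · rw [Function.uncurry_apply_pair, norm_mul]
    calc _ ≤ ‖U p.1‖ * (m p.2 * Real.exp (-l * ω ‖p.1‖)) := by
          gcongr
          exact hle _ _
      _ = _ := by ring

theorem integrable_character_weight (ω : WeightFunction) (ζ : Rd d) :
    Integrable fun t : Rd d => ‖character ζ t‖ * Real.exp (-ω.intRate d * ω ‖t‖) := by
  simpa only [norm_character, one_mul] using ω.integrable_exp d

/-- Pairing with a function of mean growth `e^{lω}` may be differentiated under the integral. -/
theorem hasFDerivAt_integral_mul {E : Type*} [NormedAddCommGroup E] [NormedSpace ℝ E]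
    {J : Type*} [Fintype J] {l : ℝ} {U : Rd d → ℂ} (hU : AEStronglyMeasurable U)
    (hUi : Integrable fun x => ‖U x‖ * Real.exp (-l * ω ‖x‖)) {F : E → Rd d → ℂ}
    {F' : J → E → Rd d → ℂ} {ℓ : J → E →L[ℝ] ℂ} {z₀ : E} (hF : ∀ z, Continuous (F z))
    (hF' : ∀ j z, Continuous (F' j z)) {C : ℝ} (hFle : ∀ t, ‖F z₀ t‖ ≤ C * Real.exp (-l * ω ‖t‖))
    (hF'le : ∀ᶠ z in 𝓝 z₀, ∀ j t, ‖F' j z t‖ ≤ C * Real.exp (-l * ω ‖t‖))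
    (hd : ∀ t z, HasFDerivAt (fun z => F z t) (∑ j, F' j z t • ℓ j) z) :
    HasFDerivAt (fun z => ∫ t, U t * F z t) (∑ j, (∫ t, U t * F' j z₀ t) • ℓ j) z₀ := by
  have hint : ∀ {u : Rd d → ℂ}, Continuous u → (∀ t, ‖u t‖ ≤ C * Real.exp (-l * ω ‖t‖)) →
      Integrable fun t => U t * u t := by
    intro u hu hle
    refine (hUi.const_mul C).mono' (hU.mul hu.aestronglyMeasurable)
      (Eventually.of_forall fun t => ?_)
    rw [norm_mul]
    calc _ ≤ ‖U t‖ * (C * Real.exp (-l * ω ‖t‖)) := by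
          gcongr
          exact hle _
      _ = _ := by ring
  have hF'0 := hF'le.self_of_nhds
  have e : ∑ j, (∫ t, U t * F' j z₀ t) • ℓ j = ∫ t, U t • ∑ j, F' j z₀ t • ℓ j := by
    simp only [Finset.smul_sum, smul_smul]
    rw [integral_finsetSum _ fun j _ => (hint (hF' j z₀) (hF'0 j)).smul_const (ℓ j)]
    exact Finset.sum_congr rfl fun j _ =>
      (integral_smul_const (𝕜 := ℂ) (fun t => U t * F' j z₀ t) (ℓ j)).symm
  rw [e]
  refine hasFDerivAt_integral_of_dominated_of_fderiv_le (s := {z | ∀ j t, ‖F' j z t‖ ≤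
      C * Real.exp (-l * ω ‖t‖)}) (F' := fun z t => U t • ∑ j, F' j z t • ℓ j)
    (bound := fun t => ‖U t‖ * Real.exp (-l * ω ‖t‖) * (C * ∑ j, ‖ℓ j‖))
    hF'le (Eventually.of_forall fun z => hU.mul (hF z).aestronglyMeasurable)
    (hint (hF z₀) hFle) ?_ (Eventually.of_forall fun t z hz => ?_) (hUi.mul_const _)
    (Eventually.of_forall fun t z _ => ?_)
  · refine hU.smul (Continuous.aestronglyMeasurable ?_)
    exact continuous_finsetSum _ fun j _ => (hF' j z₀).smul continuous_const
  · rw [norm_smul, mul_assoc]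
    refine mul_le_mul_of_nonneg_left ?_ (norm_nonneg _)
    refine (norm_sum_le _ _).trans ?_
    rw [← mul_assoc, Finset.mul_sum]
    refine Finset.sum_le_sum fun j _ => ?_
    rw [norm_smul, mul_comm (Real.exp _)]
    exact mul_le_mul_of_nonneg_right (hz j t) (norm_nonneg _)
  · exact (hd t z).const_mul (U t)

end Dominated

namespace UltraDistribution

open UltraSchwartz

variable {d : ℕ} {ω : WeightFunction}

/-- An ultradistribution commutes with absolutely convergent superpositions of elements of `S_ω`. -/
theorem apply_integral (a : UltraDistribution ω d) {Z : Type*} [MeasurableSpace Z] {ν : Measure Z}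
    [SFinite ν] {Φ : Z → UltraSchwartz ω d} {F : UltraSchwartz ω d}
    (hmeas : StronglyMeasurable (Function.uncurry fun z t => (Φ z).fn t))
    (hdom : ∀ l : ℝ, ∃ m : Z → ℝ, Integrable m ν ∧ ∀ z t,
      ‖(Φ z).fn t‖ ≤ m z * Real.exp (-l * ω ‖t‖) ∧
      ‖fourierHat (Φ z).fn t‖ ≤ m z * Real.exp (-l * ω ‖t‖))
    (hF : ∀ t, F.fn t = ∫ z, (Φ z).fn t ∂ν) : a F = ∫ z, a (Φ z) ∂ν := by
  obtain ⟨l, U, W, h⟩ := a.exists_represents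
  obtain ⟨m, hm, hle⟩ := hdom l
  obtain ⟨m', hm', hle'⟩ := hdom (ω.intRate d)
  have hhat : ∀ ζ, fourierHat F.fn ζ = ∫ z, fourierHat (Φ z).fn ζ ∂ν := by
    intro ζ
    simp only [fourierHat_eq, hF]
    exact integral_mul_integral_swap (character_contDiff _).continuous.aestronglyMeasurable
      (integrable_character_weight ω (-ζ)) hmeas hm' fun z t => (hle' z t).1
  have hmeas' : StronglyMeasurable (Function.uncurry fun z ζ => fourierHat (Φ z).fn ζ) := by
    have h1 : StronglyMeasurable fun p : (Z × Rd d) × Rd d =>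
        character (-p.1.2) p.2 * (Φ p.1.1).fn p.2 := by
      refine StronglyMeasurable.mul ?_
        (hmeas.comp_measurable (g := fun p : (Z × Rd d) × Rd d => (p.1.1, p.2)) (by fun_prop))
      have hc : Continuous fun q : Rd d × Rd d => character (-q.1) q.2 := by
        unfold character
        fun_prop
      exact hc.stronglyMeasurable.comp_measurable
        (g := fun p : (Z × Rd d) × Rd d => (p.1.2, p.2)) (by fun_prop)
    have h2 := h1.integral_prod_right' (ν := volume)
    have e : (Function.uncurry fun z ζ => fourierHat (Φ z).fn ζ) =
        fun p : Z × Rd d => ∫ t, character (-p.2) t * (Φ p.1).fn t := by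
      funext p
      exact fourierHat_eq _ _
    rw [e]
    exact h2
  have key : starRingEnd ℂ (a F) = ∫ z, starRingEnd ℂ (a (Φ z)) ∂ν := by
    have hi : ∀ {V : Rd d → ℂ} {G : Z → Rd d → ℂ}, AEStronglyMeasurable V →
        (Integrable fun x => ‖V x‖ * Real.exp (-l * ω ‖x‖)) →
        StronglyMeasurable (Function.uncurry G) →
        (∀ z t, ‖G z t‖ ≤ m z * Real.exp (-l * ω ‖t‖)) →
        Integrable (fun z => ∫ t, V t * G z t) ν := by
      intro V G hV hVi hG hGle
      refine Integrable.integral_prod_left (f := fun p : Z × Rd d => V p.2 * G p.1 p.2) ?_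
      refine (hm.mul_prod hVi).mono' (hV.comp_snd.mul hG.aestronglyMeasurable)
        (Eventually.of_forall fun p => ?_)
      rw [norm_mul]
      calc _ ≤ ‖V p.2‖ * (m p.1 * Real.exp (-l * ω ‖p.2‖)) := by
            gcongr
            exact hGle _ _
        _ = _ := by ring
    simp only [h.conj_apply, hF, hhat]
    rw [integral_mul_integral_swap h.aesm_left h.integrable_left hmeas hm fun z t => (hle z t).1,
      integral_mul_integral_swap h.aesm_right h.integrable_right hmeas' hm fun z t => (hle z t).2,
      integral_add]
    · exact hi h.aesm_left h.integrable_left hmeas fun z t => (hle z t).1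
    · exact hi h.aesm_right h.integrable_right hmeas' fun z t => (hle z t).2
  rw [integral_conj] at key
  exact (starRingEnd ℂ).injective key

/-- Differentiation of `z ↦ ⟨a, Θ(z)⟩` for a family `Θ` in `S_ω` that is pointwise differentiable,
with derivatives in `S_ω` that are locally bounded for the seminorms without derivatives. -/
theorem hasFDerivAt_apply (a : UltraDistribution ω d) {E : Type*} [NormedAddCommGroup E]
    [NormedSpace ℝ E] {J : Type*} [Fintype J] {Θ : E → UltraSchwartz ω d}
    {Θ' : J → E → UltraSchwartz ω d} {ℓ : J → E →L[ℝ] ℂ}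
    (hd : ∀ t z, HasFDerivAt (fun z => (Θ z).fn t) (∑ j, (Θ' j z).fn t • ℓ j) z)
    (hle : ∀ (z₀ : E) (l : ℝ), ∃ C, ∀ᶠ z in 𝓝 z₀, ∀ j t,
      ‖(Θ' j z).fn t‖ ≤ C * Real.exp (-l * ω ‖t‖) ∧
      ‖fourierHat (Θ' j z).fn t‖ ≤ C * Real.exp (-l * ω ‖t‖)) (z₀ : E) :
    HasFDerivAt (fun z => starRingEnd ℂ (a (Θ z)))
      (∑ j, starRingEnd ℂ (a (Θ' j z₀)) • ℓ j) z₀ := by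
  obtain ⟨l, U, W, h⟩ := a.exists_represents
  -- a common constant for the function and the derivatives
  have hC : ∀ (z₀ : E) (l : ℝ), ∃ C, (∀ t, ‖(Θ z₀).fn t‖ ≤ C * Real.exp (-l * ω ‖t‖) ∧
      ‖fourierHat (Θ z₀).fn t‖ ≤ C * Real.exp (-l * ω ‖t‖)) ∧ ∀ᶠ z in 𝓝 z₀, ∀ j t,
      ‖(Θ' j z).fn t‖ ≤ C * Real.exp (-l * ω ‖t‖) ∧
      ‖fourierHat (Θ' j z).fn t‖ ≤ C * Real.exp (-l * ω ‖t‖) := by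
    intro z₀ l
    obtain ⟨C₁, h₁⟩ := hle z₀ l
    obtain ⟨C₂, -, h₂⟩ := (Θ z₀).tame.decay l
    obtain ⟨C₃, -, h₃⟩ := (Θ z₀).tame.hat_decay l
    refine ⟨max C₁ (max C₂ C₃), fun t => ⟨(h₂ t).trans ?_, (h₃ t).trans ?_⟩, ?_⟩
    · gcongr
      exact (le_max_left _ _).trans (le_max_right _ _)
    · gcongr
      exact (le_max_right _ _).trans (le_max_right _ _)
    · filter_upwards [h₁] with z hz j t
      refine ⟨(hz j t).1.trans ?_, (hz j t).2.trans ?_⟩ <;>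
      · gcongr
        exact le_max_left _ _
  have hdhat : ∀ ζ z, HasFDerivAt (fun z => fourierHat (Θ z).fn ζ)
      (∑ j, fourierHat (Θ' j z).fn ζ • ℓ j) z := by
    intro ζ z
    obtain ⟨C, h₁, h₂⟩ := hC z (ω.intRate d)
    simp only [fourierHat_eq]
    exact hasFDerivAt_integral_mul (ω := ω) (F := fun z t => (Θ z).fn t)
      (F' := fun j z t => (Θ' j z).fn t) (ℓ := ℓ)
      (character_contDiff _).continuous.aestronglyMeasurable
      (integrable_character_weight ω (-ζ)) (fun z => (Θ z).tame.continuous)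
      (fun j z => (Θ' j z).tame.continuous) (fun t => (h₁ t).1)
      (h₂.mono fun z hz j t => (hz j t).1) hd
  obtain ⟨C, h₁, h₂⟩ := hC z₀ l
  have hA := hasFDerivAt_integral_mul (F := fun z t => (Θ z).fn t)
    (F' := fun j z t => (Θ' j z).fn t) (ℓ := ℓ) h.aesm_left h.integrable_left
    (fun z => (Θ z).tame.continuous) (fun j z => (Θ' j z).tame.continuous)
    (fun t => (h₁ t).1) (h₂.mono fun z hz j t => (hz j t).1) hd
  have hB := hasFDerivAt_integral_mul (F := fun z t => fourierHat (Θ z).fn t)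
    (F' := fun j z t => fourierHat (Θ' j z).fn t) (ℓ := ℓ) h.aesm_right h.integrable_right
    (fun z => (Θ z).tame.hat_continuous) (fun j z => (Θ' j z).tame.hat_continuous)
    (fun t => (h₁ t).2) (h₂.mono fun z hz j t => (hz j t).2) hdhat
  have hAB := hA.fun_add hB
  rw [← Finset.sum_add_distrib] at hAB
  simp only [h.conj_apply]
  refine hAB.congr_fderiv (Finset.sum_congr rfl fun j _ => ?_)
  rw [← add_smul]

end UltraDistribution

/-! ### Derivatives of phase shifts -/

section Operators

variable {d : ℕ} {ω : WeightFunction} {f g : Rd d → ℂ}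

theorem fderiv_eq_sum_pderiv (f : Rd d → ℂ) (x : Rd d) :
    fderiv ℝ f x = ∑ j, pderiv j f x • coordCLM j := by
  ext v
  have hv : v = ∑ j, v j • EuclideanSpace.single j (1 : ℝ) := by
    ext i
    simp [Finset.sum_apply, Pi.single_apply]
  conv_lhs => rw [hv]
  rw [map_sum, sum_apply]
  refine Finset.sum_congr rfl fun j _ => ?_
  rw [map_smul]
  simp [pderiv, coordCLM_apply, mul_comm]

theorem RapidDecay.translate (h : RapidDecay ω f) (y : Rd d) :
    RapidDecay ω fun t => f (t - y) := by
  refine RapidDecay.of_nonneg fun l hl => ?_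
  obtain ⟨C, hC, h1⟩ := h (l * ω.subK)
  refine ⟨C * (Real.exp (l * ω.subK) * Real.exp (l * ω.subK * ω ‖y‖)), fun t => ?_⟩
  rw [mul_assoc]
  exact (h1 (t - y)).trans (mul_le_mul_of_nonneg_left (ω.exp_neg_shift hl.le t y) hC)

theorem weightInt_translate_le (h : RapidDecay ω f) (hc : Continuous f) {κ : ℝ} (hκ : 0 ≤ κ)
    (y : Rd d) : weightInt ω κ (fun t => f (t - y)) ≤
      Real.exp (κ * ω.subK * (ω ‖y‖ + 1)) * weightInt ω (κ * ω.subK) f := by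
  rw [weightInt, ← integral_add_right_eq_self _ y, weightInt, ← integral_const_mul]
  simp only [add_sub_cancel_right]
  refine integral_mono_of_nonneg (Eventually.of_forall fun _ => by positivity)
    ((h.integrable_weight hc.aestronglyMeasurable _).const_mul _) (Eventually.of_forall fun t => ?_)
  have h1 : Real.exp (κ * ω ‖t + y‖) ≤
      Real.exp (κ * ω.subK * (ω ‖y‖ + 1)) * Real.exp (κ * ω.subK * ω ‖t‖) := by
    rw [← Real.exp_add]
    refine Real.exp_le_exp.2 ?_
    nlinarith [mul_le_mul_of_nonneg_left (ω.norm_add_le_subK t y) hκ]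
  calc _ ≤ ‖f t‖ * (Real.exp (κ * ω.subK * (ω ‖y‖ + 1)) * Real.exp (κ * ω.subK * ω ‖t‖)) := by
        dsimp only
        gcongr
    _ = _ := by ring

namespace Tame

theorem character_mul (h : Tame ω f) (η : Rd d) : Tame ω (character η * f) := by
  refine ⟨(character_contDiff η).continuous.mul h.continuous,
    h.decay.of_norm_le zero_le_one fun t => by simp [norm_character], ?_⟩
  rw [fourierHat_modulate]
  exact h.hat_decay.translate η

theorem mul_coord (h : Tame ω f) (j : Fin d) : Tame ω fun t => (t j : ℂ) * f t := by
  have hc : Continuous fun t : Rd d => (t j : ℂ) := by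
    have e : (fun t : Rd d => (t j : ℂ)) = coordCLM j := funext fun t => (coordCLM_apply j t).symm
    rw [e]
    exact (coordCLM j).continuous
  refine ⟨hc.mul h.continuous, fun l => ?_, ?_⟩
  · obtain ⟨C, hC, h1⟩ := h.decay.pow_mul 1 l
    refine ⟨C, hC, fun x => le_trans ?_ (h1 x)⟩
    rw [norm_mul, pow_one]
    gcongr
    simpa using PiLp.norm_apply_le x j
  · have hi : Integrable fun t => ‖t‖ * ‖f t‖ := by
      simpa using h.decay.integrable_pow_mul h.continuous.aestronglyMeasurable 1
    have e := pderiv_fourierHat h.integrable hi j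
    have hR : RapidDecay ω (_root_.pderiv j (fourierHat f)) := (h.hat.hasDecay.pderiv j).rapidDecay
    have hn : ∀ ξ, ‖fourierHat (fun t => (t j : ℂ) * f t) ξ‖ ≤
        1 * ‖_root_.pderiv j (fourierHat f) ξ‖ := by
      intro ξ
      rw [e]
      simp only [norm_mul, norm_neg, Complex.norm_I, one_mul, le_refl]
    exact hR.of_norm_le zero_le_one hn

theorem integrable_fderiv (h : Tame ω f) : Integrable (fderiv ℝ f) := by
  have hR : ∀ j, Integrable fun x => ‖_root_.pderiv j f x‖ := by
    intro j
    have hc : Continuous (_root_.pderiv j f) := (pderiv_contDiff j h.contDiff).continuous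
    have hD : HasDecay ω (_root_.pderiv j f) := h.hasDecay.pderiv j
    exact (hD.rapidDecay.integrable hc.aestronglyMeasurable).norm
  have hs : Integrable fun x => ∑ j, ‖_root_.pderiv j f x‖ :=
    integrable_finsetSum _ fun j _ => hR j
  refine hs.mono' (h.contDiff.continuous_fderiv (by simp)).aestronglyMeasurable
    (Eventually.of_forall fun x => ?_)
  rw [fderiv_eq_sum_pderiv]
  refine (norm_sum_le _ _).trans (Finset.sum_le_sum fun j _ => ?_)
  rw [norm_smul]
  exact mul_le_of_le_one_right (norm_nonneg _) (norm_coordCLM_le j)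

theorem hat_pderiv (h : Tame ω f) (j : Fin d) :
    fourierHat (_root_.pderiv j f) = fun ξ => Complex.I * (ξ j : ℂ) * fourierHat f ξ :=
  fourierHat_pderiv h.integrable (smooth_differentiable h.contDiff) h.integrable_fderiv j

theorem pderiv (h : Tame ω f) (j : Fin d) : Tame ω (pderiv j f) := by
  refine ⟨(pderiv_contDiff j h.contDiff).continuous, (h.hasDecay.pderiv j).rapidDecay, ?_⟩
  rw [h.hat_pderiv]
  refine (h.hat.mul_coord j).decay.of_norm_le zero_le_one fun ξ => ?_
  simp

end Tame

theorem listDeriv_translate (L : List (Fin d)) (x : Rd d) (f : Rd d → ℂ) :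
    listDeriv L (fun t => f (t - x)) = fun t => listDeriv L f (t - x) := by
  induction L with
  | nil => rfl
  | cons i L ih =>
    change pderiv i (listDeriv L _) = _
    rw [ih, pderiv_translate]
    rfl

end Operators

namespace UltraSchwartz

variable {d : ℕ} {ω : WeightFunction}

/-- Multiplication by the coordinate `t_j`. -/
def mulCoord (j : Fin d) (f : UltraSchwartz ω d) : UltraSchwartz ω d := ofTame (f.tame.mul_coord j)

/-- The partial derivative `∂_j` on `S_ω`. -/
def partialD (j : Fin d) (f : UltraSchwartz ω d) : UltraSchwartz ω d := ofTame (f.tame.pderiv j)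

theorem fn_foldr_partialD (L : List (Fin d)) (f : UltraSchwartz ω d) :
    (L.foldr partialD f).fn = listDeriv L f.fn := by
  induction L with
  | nil => rfl
  | cons j L ih => exact congrArg (pderiv j) ih

theorem fn_foldr_mulCoord (L : List (Fin d)) (f : UltraSchwartz ω d) (t : Rd d) :
    (L.foldr mulCoord f).fn t = coordProd L t * f.fn t := by
  induction L with
  | nil => simp [coordProd_nil]
  | cons j L ih =>
    rw [coordProd_cons, mul_assoc, ← ih]
    rfl

theorem hat_foldr_partialD (L : List (Fin d)) (f : UltraSchwartz ω d) (ξ : Rd d) :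
    fourierHat (L.foldr partialD f).fn ξ =
      Complex.I ^ L.length * (coordProd L ξ * fourierHat f.fn ξ) := by
  induction L with
  | nil => simp [coordProd_nil]
  | cons j L ih =>
    have h := congrFun ((L.foldr partialD f).tame.hat_pderiv j) ξ
    refine h.trans ?_
    rw [ih, coordProd_cons, List.length_cons, pow_succ]
    ring

theorem hat_foldr_mulCoord (M : List (Fin d)) (f : UltraSchwartz ω d) :
    fourierHat (M.foldr mulCoord f).fn = Complex.I ^ M.length • listDeriv M (fourierHat f.fn) := by
  induction M with
  | nil => simp [listDeriv]
  | cons j M ih =>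
    set u := M.foldr mulCoord f with hu
    have h := pderiv_fourierHat u.tame.integrable
      (by simpa using u.tame.decay.integrable_pow_mul u.tame.continuous.aestronglyMeasurable 1) j
    have h2 : fourierHat ((j :: M).foldr mulCoord f).fn =
        Complex.I • pderiv j (fourierHat u.fn) := by
      rw [h]
      funext ξ
      simp only [Pi.smul_apply, smul_eq_mul, ← mul_assoc]
      simp
      rfl
    rw [h2, ih, pderiv_smul j _ (listDeriv_contDiff M f.tame.hat.contDiff), smul_smul,
      List.length_cons, pow_succ']
    rfl

/-- The function `t ↦ t_M e^{it·ξ} (∂_L ψ)(t - x)`, where `z = (x, ξ)`. Up to signs and powers of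
`i` these are the derivatives of `(x, ξ) ↦ Π(x, ξ) ψ`. -/
def atom (ψ : UltraSchwartz ω d) (M L : List (Fin d)) (z : Rd d × Rd d) : UltraSchwartz ω d :=
  M.foldr mulCoord ((L.foldr partialD ψ).phaseShift z.1 z.2)

theorem fn_phaseShift (x ξ : Rd d) (ψ : UltraSchwartz ω d) (t : Rd d) :
    (ψ.phaseShift x ξ).fn t = character ξ t * ψ.fn (t - x) := rfl

theorem hat_phaseShift (x ξ : Rd d) (ψ : UltraSchwartz ω d) :
    fourierHat (ψ.phaseShift x ξ).fn =
      fun ζ => (character (-x) * fourierHat ψ.fn) (ζ - ξ) := by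
  have : (ψ.phaseShift x ξ).fn = character ξ * fun t => ψ.fn (t - x) := rfl
  rw [this, fourierHat_modulate, fourierHat_translate]

theorem fn_atom (ψ : UltraSchwartz ω d) (M L : List (Fin d)) (z : Rd d × Rd d) (t : Rd d) :
    (ψ.atom M L z).fn t = coordProd M t * (character z.2 t * listDeriv L ψ.fn (t - z.1)) := by
  rw [atom, fn_foldr_mulCoord, fn_phaseShift, fn_foldr_partialD]

/-- On the Fourier side, the derivatives `∂_L ψ` become monomials, the factor `t_M` becomes a
derivative, and the translation by `x` becomes a modulation. -/
theorem norm_hat_atom_le (ψ : UltraSchwartz ω d) (M L : List (Fin d)) (x ξ ζ : Rd d) :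
    ‖fourierHat (ψ.atom M L (x, ξ)).fn ζ‖ ≤ ‖iteratedFDeriv ℝ M.length
      (fun t => coordProd L t * (character (-x) * fourierHat ψ.fn) t) (ζ - ξ)‖ := by
  set g : Rd d → ℂ := fun t => coordProd L t * (character (-x) * fourierHat ψ.fn) t with hg
  have hgs : ContDiff ℝ (⊤ : ℕ∞) g :=
    (coordProd_contDiff L).mul ((character_contDiff _).mul ψ.tame.hat.contDiff)
  have h1 : fourierHat ((L.foldr partialD ψ).phaseShift x ξ).fn =
      fun ζ => (Complex.I ^ L.length • g) (ζ - ξ) := by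
    rw [hat_phaseShift]
    funext ζ
    simp only [Pi.mul_apply, Pi.smul_apply, smul_eq_mul, hat_foldr_partialD, hg]
    ring
  rw [atom, hat_foldr_mulCoord, h1, listDeriv_translate, listDeriv_smul M _ hgs]
  simp only [Pi.smul_apply, norm_smul, norm_pow, Complex.norm_I, one_pow, one_mul]
  exact norm_listDeriv_le M hgs _

/-- The crucial estimate for the functions `t_M e^{it·ξ} (∂_L ψ)(t - x)`. The loss `e^{cω(x)}` in
`x` depends on `μ` only, and not on the decay `l` in the other variable. -/
theorem exists_atom_le (ψ : UltraSchwartz ω d) {μ : ℝ} (hμ : 0 < μ) : ∃ c : ℝ, 0 ≤ c ∧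
    ∀ l : ℝ, 0 ≤ l → ∃ lam : ℝ, 0 ≤ lam ∧ ∃ C : ℝ, 0 ≤ C ∧
      ∀ (M L : List (Fin d)) (A B : ℝ),
        (∀ t : ℝ, 1 ≤ t → t ^ L.length ≤ A * Real.exp (μ * ω t)) →
        (∀ t : ℝ, 1 ≤ t → t ^ M.length ≤ B * Real.exp (μ * ω t)) → ∀ x ξ t,
        ‖(ψ.atom M L (x, ξ)).fn t‖ ≤
          C * A * B * Real.exp (c * ω ‖x‖) * Real.exp (lam * ω ‖ξ‖) *
            Real.exp (-l * ω ‖x - t‖) ∧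
        ‖fourierHat (ψ.atom M L (x, ξ)).fn t‖ ≤
          C * A * B * Real.exp (c * ω ‖x‖) * Real.exp (lam * ω ‖ξ‖) * Real.exp (-l * ω ‖t‖) := by
  obtain ⟨κ, hκ, hW⟩ := exists_iteratedFDeriv_le ω d hμ
  have hK := ω.subK_pos
  set K := ω.subK with hKdef
  refine ⟨μ * K * K + κ * K, by positivity, fun l hl => ?_⟩
  obtain ⟨l₁, -, C₁, hC₁, hW₁⟩ := hW (l + μ * K * K) (by positivity)
  obtain ⟨l₂, -, C₂, hC₂, hW₂⟩ := hW (l * K) (by positivity)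
  set D₁ := C₁ * (weightInt ω l₁ ψ.fn + weightInt ω κ (fourierHat ψ.fn)) *
    (Real.exp (μ * K * (ω 1 + 1)) * Real.exp (μ * K * K)) with hD₁
  set Q := weightInt ω (κ * K) (fourierHat (fourierHat ψ.fn)) with hQ
  have hQ0 : 0 ≤ Q := weightInt_nonneg _ _ _
  set P := weightInt ω l₂ (fourierHat ψ.fn) with hP
  have hP0 : 0 ≤ P := weightInt_nonneg _ _ _
  have hR0 : 0 ≤ weightInt ω l₁ ψ.fn + weightInt ω κ (fourierHat ψ.fn) :=
    add_nonneg (weightInt_nonneg _ _ _) (weightInt_nonneg _ _ _)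
  set D₂ := C₂ * (P + Real.exp (κ * K) * Q) * Real.exp (l * K) with hD₂
  have hD₁0 : 0 ≤ D₁ := by positivity
  have hD₂0 : 0 ≤ D₂ := by positivity
  refine ⟨l * K, by positivity, D₁ + D₂, by positivity, fun M L A B hA hB x ξ t => ?_⟩
  obtain ⟨hA0, -⟩ := ω.one_add_pow_le hμ.le hA
  obtain ⟨hB0, hB'⟩ := ω.one_add_pow_le hμ.le hB
  have hx0 := ω.norm_nonneg' x
  have hξ0 := ω.norm_nonneg' ξ
  have hone : ∀ r : ℝ, 0 ≤ r → 1 ≤ Real.exp r := fun r hr => Real.one_le_exp hr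
  constructor
  · have h1 : ‖coordProd M t‖ ≤ B * Real.exp (μ * K * (ω 1 + 1)) * (Real.exp (μ * K * K) *
        Real.exp (μ * K * K * ω ‖x‖) * Real.exp (μ * K * K * ω ‖x - t‖)) := by
      have h2 : ‖t‖ ≤ 1 + (‖x‖ + ‖x - t‖) := by
        have h := norm_sub_le x (x - t)
        rw [sub_sub_cancel] at h
        linarith
      have h3 := hB' (‖x‖ + ‖x - t‖) (by positivity)
      refine (norm_coordProd_le M t).trans ((pow_le_pow_left₀ (norm_nonneg _) h2 _).trans
        (h3.trans ?_))
      gcongr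
      rw [← Real.exp_add, ← Real.exp_add]
      refine Real.exp_le_exp.2 ?_
      have h4 := ω.add_le_subK (norm_nonneg x) (norm_nonneg (x - t))
      have h5 : 0 ≤ μ * K := by positivity
      nlinarith [mul_le_mul_of_nonneg_left h4 h5]
    have h2 : ‖listDeriv L ψ.fn (t - x)‖ ≤ C₁ * A *
        (weightInt ω l₁ ψ.fn + weightInt ω κ (fourierHat ψ.fn)) *
        Real.exp (-(l + μ * K * K) * ω ‖x - t‖) := by
      refine (norm_listDeriv_le L ψ.tame.contDiff _).trans ?_
      have h3 := hW₁ ψ.fn ψ.tame [] L.length A 1 hA (fun t ht => by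
        simpa using mul_nonneg hμ.le (ω.nonneg t (by linarith))) (t - x)
      simpa [coordProd_nil, norm_sub_rev t x] using h3
    rw [fn_atom, norm_mul, norm_mul, norm_character, one_mul]
    refine (mul_le_mul h1 h2 (norm_nonneg _) (by positivity)).trans ?_
    have e : Real.exp (-l * ω ‖x - t‖) = Real.exp (μ * K * K * ω ‖x - t‖) *
        Real.exp (-(l + μ * K * K) * ω ‖x - t‖) := by
      rw [← Real.exp_add]
      congr 1
      ring
    calc _ = D₁ * A * B * Real.exp (μ * K * K * ω ‖x‖) * 1 * Real.exp (-l * ω ‖x - t‖) := by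
          rw [e, hD₁]
          ring
      _ ≤ _ := by
          gcongr
          · linarith
          · exact le_add_of_nonneg_right (by positivity)
          · exact hone _ (by positivity)
  · set g := character (-x) * fourierHat ψ.fn with hg
    have hgT : Tame ω g := ψ.tame.hat.character_mul (-x)
    have hgP : weightInt ω l₂ g = P := by
      simp only [weightInt, hg, hP, Pi.mul_apply, norm_mul, norm_character, one_mul]
    have hgQ : weightInt ω κ (fourierHat g) ≤ Real.exp (κ * K * (ω ‖x‖ + 1)) * Q := by
      rw [hg, fourierHat_modulate]
      have h := weightInt_translate_le ψ.tame.hat.hat_decay ψ.tame.hat.hat_continuous hκ (-x)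
      rwa [norm_neg] at h
    have hgPQ : weightInt ω l₂ g + weightInt ω κ (fourierHat g) ≤
        (P + Real.exp (κ * K) * Q) * Real.exp (κ * K * ω ‖x‖) := by
      rw [hgP, add_mul]
      refine add_le_add (le_mul_of_one_le_right hP0 (hone _ (by positivity))) (hgQ.trans_eq ?_)
      rw [mul_add, Real.exp_add, mul_one]
      ring
    have h1 := hW₂ g hgT L M.length B A hB hA (t - ξ)
    refine (norm_hat_atom_le ψ M L x ξ t).trans (h1.trans ?_)
    calc _ ≤ C₂ * B * A * ((P + Real.exp (κ * K) * Q) * Real.exp (κ * K * ω ‖x‖)) *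
          (Real.exp (l * K) * Real.exp (l * K * ω ‖ξ‖) * Real.exp (-l * ω ‖t‖)) := by
          gcongr
          exact ω.exp_neg_shift hl t ξ
      _ = D₂ * A * B * Real.exp (κ * K * ω ‖x‖) * Real.exp (l * K * ω ‖ξ‖) *
          Real.exp (-l * ω ‖t‖) := by
          rw [hD₂]
          ring
      _ ≤ _ := by
          gcongr
          · linarith
          · exact le_add_of_nonneg_left (by positivity)

/-- The functionals through which the differential of `z ↦ Π(z) ψ` acts on the increment. -/
def atomForm : Fin d ⊕ Fin d → (Rd d × Rd d →L[ℝ] ℂ)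
  | Sum.inl j => -((coordCLM j).comp (ContinuousLinearMap.fst ℝ (Rd d) (Rd d)))
  | Sum.inr j => Complex.I • ((coordCLM j).comp (ContinuousLinearMap.snd ℝ (Rd d) (Rd d)))

/-- The partial derivatives of `z ↦ atom ψ M L z`, up to the constants in `atomForm`. -/
def atomDeriv (ψ : UltraSchwartz ω d) (M L : List (Fin d)) :
    Fin d ⊕ Fin d → Rd d × Rd d → UltraSchwartz ω d
  | Sum.inl j => ψ.atom M (j :: L)
  | Sum.inr j => ψ.atom (j :: M) L

theorem hasFDerivAt_atom (ψ : UltraSchwartz ω d) (M L : List (Fin d)) (t : Rd d)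
    (z : Rd d × Rd d) : HasFDerivAt (fun z => (ψ.atom M L z).fn t)
      (∑ j, (ψ.atomDeriv M L j z).fn t • atomForm j) z := by
  simp only [fn_atom]
  have h1 : HasFDerivAt (fun z : Rd d × Rd d => character z.2 t)
      (character z.2 t • (Complex.I • (Complex.ofRealCLM.comp
        ((innerSL ℝ t).comp (ContinuousLinearMap.snd ℝ (Rd d) (Rd d)))))) z := by
    have h0 : HasFDerivAt (fun z : Rd d × Rd d => Complex.I * ((inner ℝ t z.2 : ℝ) : ℂ))
        (Complex.I • (Complex.ofRealCLM.comp
          ((innerSL ℝ t).comp (ContinuousLinearMap.snd ℝ (Rd d) (Rd d))))) z :=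
      (Complex.ofRealCLM.comp
        ((innerSL ℝ t).comp (ContinuousLinearMap.snd ℝ (Rd d) (Rd d)))).hasFDerivAt.const_mul _
    exact h0.cexp
  have h2 : HasFDerivAt (fun z : Rd d × Rd d => listDeriv L ψ.fn (t - z.1))
      ((fderiv ℝ (listDeriv L ψ.fn) (t - z.1)).comp
        (-(ContinuousLinearMap.fst ℝ (Rd d) (Rd d)))) z := by
    have h3 := (smooth_differentiable (listDeriv_contDiff L ψ.tame.contDiff) (t - z.1)).hasFDerivAt
    exact HasFDerivAt.comp z h3 (hasFDerivAt_fst.const_sub t)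
  refine ((h1.mul h2).const_mul (coordProd M t)).congr_fderiv ?_
  rw [Fintype.sum_sum_type]
  simp only [atomDeriv, atomForm, fn_atom, coordProd_cons]
  rw [fderiv_eq_sum_pderiv]
  ext v
  · simp [coordCLM_apply, Finset.mul_sum]
    refine Finset.sum_congr rfl fun j _ => ?_
    change _ = coordProd M t * (character z.2 t * pderiv j (listDeriv L ψ.fn) (t - z.1)) * _
    ring
  · have hinner : ((inner ℝ t v : ℝ) : ℂ) = ∑ j, (t j : ℂ) * (v j : ℂ) := by
      rw [PiLp.inner_apply]
      push_cast
      refine Finset.sum_congr rfl fun j _ => ?_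
      simp [mul_comm]
    simp [coordCLM_apply, Finset.mul_sum, hinner]
    refine Finset.sum_congr rfl fun j _ => ?_
    ring

end UltraSchwartz

/-! ### Smoothness of the short-time Fourier transform of an ultradistribution -/

namespace UltraSchwartz

variable {d : ℕ} {ω : WeightFunction}

/-- Atoms are bounded, together with their Fourier transforms, locally uniformly in `z`. -/
theorem exists_atom_le_nhds (ψ : UltraSchwartz ω d) (M L : List (Fin d)) (z₀ : Rd d × Rd d)
    (l : ℝ) : ∃ C, ∀ᶠ z in 𝓝 z₀, ∀ t,
      ‖(ψ.atom M L z).fn t‖ ≤ C * Real.exp (-l * ω ‖t‖) ∧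
      ‖fourierHat (ψ.atom M L z).fn t‖ ≤ C * Real.exp (-l * ω ‖t‖) := by
  obtain ⟨μ₁, hμ₁, A, hA, hA'⟩ := ω.exists_pow_le L.length
  obtain ⟨μ₂, hμ₂, B, hB, hB'⟩ := ω.exists_pow_le M.length
  obtain ⟨c, hc, h⟩ := ψ.exists_atom_le (lt_max_of_lt_left hμ₁ : 0 < max μ₁ μ₂)
  have hK := ω.one_le_subK
  have hl0 : 0 ≤ max l 0 := le_max_right _ _
  obtain ⟨lam, hlam, C, hC, h1⟩ := h (max l 0 * ω.subK) (by positivity)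
  have h2 := h1 M L A B
    (fun t ht => (hA' t ht).trans (by
      have := ω.nonneg t (by linarith)
      gcongr
      exact le_max_left _ _))
    (fun t ht => (hB' t ht).trans (by
      have := ω.nonneg t (by linarith)
      gcongr
      exact le_max_right _ _))
  set G : Rd d × Rd d → ℝ := fun z =>
    C * A * B * Real.exp (c * ω ‖z.1‖) * Real.exp (lam * ω ‖z.2‖) *
      (Real.exp (max l 0 * ω.subK) * Real.exp (max l 0 * ω.subK * ω ‖z.1‖)) with hG
  have hGc : Continuous G := by
    have e1 := (ω.continuous_norm d).comp (continuous_fst (X := Rd d) (Y := Rd d))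
    have e2 := (ω.continuous_norm d).comp (continuous_snd (X := Rd d) (Y := Rd d))
    exact ((continuous_const.mul (Real.continuous_exp.comp (continuous_const.mul e1))).mul
      (Real.continuous_exp.comp (continuous_const.mul e2))).mul (continuous_const.mul
        (Real.continuous_exp.comp (continuous_const.mul e1)))
  refine ⟨G z₀ + 1, ?_⟩
  filter_upwards [hGc.continuousAt.eventually_lt_const (lt_add_one (G z₀))] with z hz t
  obtain ⟨b1, b2⟩ := h2 z.1 z.2 t
  have hD : 0 ≤ C * A * B * Real.exp (c * ω ‖z.1‖) * Real.exp (lam * ω ‖z.2‖) := by positivity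
  have hlt : Real.exp (-max l 0 * ω ‖t‖) ≤ Real.exp (-l * ω ‖t‖) :=
    exp_rate_le (le_max_left _ _) (ω.norm_nonneg' t)
  have hfin : G z * Real.exp (-max l 0 * ω ‖t‖) ≤ (G z₀ + 1) * Real.exp (-l * ω ‖t‖) :=
    mul_le_mul hz.le hlt (Real.exp_nonneg _) ((by positivity : 0 ≤ G z).trans hz.le)
  refine ⟨b1.trans (le_trans ?_ hfin), b2.trans (le_trans ?_ hfin)⟩
  · rw [hG, mul_assoc _ (_ * _)]
    refine mul_le_mul_of_nonneg_left ?_ hD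
    have := ω.exp_neg_shift hl0 t z.1
    rwa [norm_sub_rev] at this
  · rw [hG, mul_assoc _ (_ * _)]
    refine mul_le_mul_of_nonneg_left ?_ hD
    have h3 : Real.exp (-(max l 0 * ω.subK) * ω ‖t‖) ≤ Real.exp (-max l 0 * ω ‖t‖) :=
      exp_rate_le (le_mul_of_one_le_right hl0 hK) (ω.norm_nonneg' t)
    refine h3.trans (le_mul_of_one_le_left (Real.exp_nonneg _) ?_)
    have := ω.norm_nonneg' z.1
    exact one_le_mul_of_one_le_of_one_le (Real.one_le_exp (by positivity))
      (Real.one_le_exp (by positivity))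

end UltraSchwartz

namespace UltraDistribution

open UltraSchwartz

variable {d : ℕ} {ω : WeightFunction}

theorem hasFDerivAt_apply_atom (a : UltraDistribution ω d) (ψ : UltraSchwartz ω d)
    (M L : List (Fin d)) (z : Rd d × Rd d) :
    HasFDerivAt (fun z => starRingEnd ℂ (a (ψ.atom M L z)))
      (∑ j, starRingEnd ℂ (a (ψ.atomDeriv M L j z)) • atomForm j) z := by
  refine a.hasFDerivAt_apply (fun t z => ψ.hasFDerivAt_atom M L t z) (fun z₀ l => ?_) z
  have h : ∀ j, ∃ C, ∀ᶠ z in 𝓝 z₀, ∀ t,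
      ‖(ψ.atomDeriv M L j z).fn t‖ ≤ C * Real.exp (-l * ω ‖t‖) ∧
      ‖fourierHat (ψ.atomDeriv M L j z).fn t‖ ≤ C * Real.exp (-l * ω ‖t‖) := by
    rintro (j | j)
    · exact ψ.exists_atom_le_nhds M (j :: L) z₀ l
    · exact ψ.exists_atom_le_nhds (j :: M) L z₀ l
  choose C hC using h
  refine ⟨∑ j, |C j|, ?_⟩
  filter_upwards [eventually_all.2 hC] with z hz j t
  have hj : C j ≤ ∑ j, |C j| := (le_abs_self _).trans
    (Finset.single_le_sum (f := fun j => |C j|) (fun _ _ => abs_nonneg _) (Finset.mem_univ j))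
  exact ⟨(hz j t).1.trans (by gcongr), (hz j t).2.trans (by gcongr)⟩

/-- The partial derivatives of `z ↦ atom ψ M L z` are again atoms, so induction on the order
applies. -/
theorem contDiff_apply_atom (a : UltraDistribution ω d) (ψ : UltraSchwartz ω d)
    (M L : List (Fin d)) : ContDiff ℝ (⊤ : ℕ∞) fun z => a (ψ.atom M L z) := by
  have key : ∀ (n : ℕ) (M L : List (Fin d)),
      ContDiff ℝ n fun z => starRingEnd ℂ (a (ψ.atom M L z)) := by
    intro n
    induction n with
    | zero =>
      intro M L
      refine contDiff_zero.2 (Differentiable.continuous (𝕜 := ℝ) fun z => ?_)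
      exact (a.hasFDerivAt_apply_atom ψ M L z).differentiableAt
    | succ n ih =>
      intro M L
      refine contDiff_succ_iff_hasFDerivAt.2 ⟨_, ?_, fun z => a.hasFDerivAt_apply_atom ψ M L z⟩
      refine ContDiff.sum fun j _ => ?_
      have hj : ContDiff ℝ n fun z => starRingEnd ℂ (a (ψ.atomDeriv M L j z)) := by
        rcases j with j | j
        · exact ih M (j :: L)
        · exact ih (j :: M) L
      exact hj.smul contDiff_const
  have h2 : ContDiff ℝ (⊤ : ℕ∞) fun z => starRingEnd ℂ (a (ψ.atom M L z)) :=
    contDiff_infty.2 fun n => key n M L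
  have h3 := Complex.conjCLE.contDiff.comp h2
  have e : (fun z => a (ψ.atom M L z)) =
      Complex.conjCLE ∘ fun z => starRingEnd ℂ (a (ψ.atom M L z)) := by
    funext z
    simp
  rw [e]
  exact h3

theorem contDiff_stft (a : UltraDistribution ω d) (ψ : UltraSchwartz ω d) :
    ContDiff ℝ (⊤ : ℕ∞) fun z : Rd d × Rd d => a.stft ψ z.1 z.2 :=
  a.contDiff_apply_atom ψ [] []

theorem hasFDerivAt_apply_atom' (a : UltraDistribution ω d) (ψ : UltraSchwartz ω d)
    (M L : List (Fin d)) (z : Rd d × Rd d) :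
    HasFDerivAt (fun z => a (ψ.atom M L z))
      (Complex.conjCLE.toContinuousLinearMap.comp
        (∑ j, starRingEnd ℂ (a (ψ.atomDeriv M L j z)) • atomForm j)) z := by
  have h := (Complex.conjCLE.toContinuousLinearMap.hasFDerivAt).comp z
    (a.hasFDerivAt_apply_atom ψ M L z)
  refine h.congr_of_eventuallyEq (Eventually.of_forall fun w => ?_)
  simp

theorem pderiv_apply_atom_right (a : UltraDistribution ω d) (ψ : UltraSchwartz ω d)
    (M L : List (Fin d)) (x : Rd d) (j : Fin d) :
    pderiv j (fun ξ => a (ψ.atom M L (x, ξ))) =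
      -Complex.I • fun ξ => a (ψ.atom (j :: M) L (x, ξ)) := by
  funext ξ
  have h := (a.hasFDerivAt_apply_atom' ψ M L (x, ξ)).comp ξ (hasFDerivAt_prodMk_right x ξ)
  have h2 : fderiv ℝ (fun ξ => a (ψ.atom M L (x, ξ))) ξ = _ := h.fderiv
  rw [pderiv, h2, Fintype.sum_sum_type]
  have e : ∀ i : Fin d, ((if i = j then 1 else 0 : ℝ) : ℂ) = if i = j then 1 else 0 := by
    intro i
    split_ifs <;> simp
  simp [atomForm, atomDeriv, coordCLM_apply, sum_apply, mul_comm, e]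

theorem pderiv_apply_atom_left (a : UltraDistribution ω d) (ψ : UltraSchwartz ω d)
    (M L : List (Fin d)) (ξ : Rd d) (j : Fin d) :
    pderiv j (fun x => a (ψ.atom M L (x, ξ))) =
      (-1 : ℂ) • fun x => a (ψ.atom M (j :: L) (x, ξ)) := by
  funext x
  have h := HasFDerivAt.comp (f := fun x : Rd d => (x, ξ)) x
    (a.hasFDerivAt_apply_atom' ψ M L (x, ξ)) (hasFDerivAt_prodMk_left x ξ)
  have h2 : fderiv ℝ (fun x => a (ψ.atom M L (x, ξ))) x = _ := h.fderiv
  rw [pderiv, h2, Fintype.sum_sum_type]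
  have e : ∀ i : Fin d, ((if i = j then 1 else 0 : ℝ) : ℂ) = if i = j then 1 else 0 := by
    intro i
    split_ifs <;> simp
  simp [atomForm, atomDeriv, coordCLM_apply, sum_apply, mul_comm, e]

theorem listDeriv_apply_atom_right (a : UltraDistribution ω d) (ψ : UltraSchwartz ω d)
    (M L N : List (Fin d)) (x : Rd d) :
    listDeriv N (fun ξ => a (ψ.atom M L (x, ξ))) =
      (-Complex.I) ^ N.length • fun ξ => a (ψ.atom (N ++ M) L (x, ξ)) := by
  induction N with
  | nil => simp [listDeriv]
  | cons j N ih =>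
    change pderiv j (listDeriv N _) = _
    have hs : ContDiff ℝ (⊤ : ℕ∞) fun ξ => a (ψ.atom (N ++ M) L (x, ξ)) :=
      (a.contDiff_apply_atom ψ _ _).comp (contDiff_prodMk_right x)
    rw [ih, pderiv_smul j _ hs, pderiv_apply_atom_right, smul_smul, List.length_cons, pow_succ]
    rfl

theorem listDeriv_apply_atom_left (a : UltraDistribution ω d) (ψ : UltraSchwartz ω d)
    (M L N : List (Fin d)) (ξ : Rd d) :
    listDeriv N (fun x => a (ψ.atom M L (x, ξ))) =
      (-1 : ℂ) ^ N.length • fun x => a (ψ.atom M (N ++ L) (x, ξ)) := by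
  induction N with
  | nil => simp [listDeriv]
  | cons j N ih =>
    change pderiv j (listDeriv N _) = _
    have hs : ContDiff ℝ (⊤ : ℕ∞) fun x => a (ψ.atom M (N ++ L) (x, ξ)) :=
      (a.contDiff_apply_atom ψ _ _).comp (contDiff_prodMk_left ξ)
    rw [ih, pderiv_smul j _ hs, pderiv_apply_atom_left, smul_smul, List.length_cons, pow_succ]
    rfl

/-- Up to a factor of modulus one, the derivatives of `V_ψ a` are the values of `a` on atoms. -/
theorem norm_mixedDeriv_stft (a : UltraDistribution ω d) (ψ : UltraSchwartz ω d)
    (α β : Fin d → ℕ) (x ξ : Rd d) : ‖mixedDeriv α β (a.stft ψ) x ξ‖ =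
      ‖a (ψ.atom (multiList β) (multiList α) (x, ξ))‖ := by
  have h1 : ∀ x', multiDeriv β (a.stft ψ x') =
      (-Complex.I) ^ (multiList β).length • fun ξ => a (ψ.atom (multiList β) [] (x', ξ)) := by
    intro x'
    rw [multiDeriv_eq_listDeriv]
    have := a.listDeriv_apply_atom_right ψ [] [] (multiList β) x'
    rwa [List.append_nil] at this
  have hs : ContDiff ℝ (⊤ : ℕ∞) fun x' => a (ψ.atom (multiList β) [] (x', ξ)) :=
    (a.contDiff_apply_atom ψ _ _).comp (contDiff_prodMk_left ξ)
  have h2 : (fun x' => multiDeriv β (a.stft ψ x') ξ) =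
      (-Complex.I) ^ (multiList β).length • fun x' => a (ψ.atom (multiList β) [] (x', ξ)) := by
    funext x'
    rw [h1]
    rfl
  rw [mixedDeriv, h2, multiDeriv_smul _ _ hs, multiDeriv_eq_listDeriv,
    listDeriv_apply_atom_left, List.append_nil]
  simp

end UltraDistribution

/-! ### From convolutors to estimates of the derivatives -/

namespace UltraSchwartz

variable {d : ℕ} {ω : WeightFunction}

theorem fn_conjReflect (x : Rd d) (f : UltraSchwartz ω d) (t : Rd d) :
    (f.conjReflect x).fn t = starRingEnd ℂ (f.fn (x - t)) := rfl

theorem hat_conjReflect (x : Rd d) (f : UltraSchwartz ω d) (ξ : Rd d) :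
    fourierHat (f.conjReflect x).fn ξ = character (-x) ξ * starRingEnd ℂ (fourierHat f.fn ξ) := by
  have e : (f.conjReflect x).fn =
      fun t => (fun s => starRingEnd ℂ ((fun u => f.fn (-u)) s)) (t - x) := by
    funext t
    simp [fn_conjReflect]
  rw [e, fourierHat_translate x (fun s => starRingEnd ℂ ((fun u => f.fn (-u)) s)),
    fourierHat_conj, fourierHat_reflect]
  simp

theorem norm_hat_conjReflect (x : Rd d) (f : UltraSchwartz ω d) (ξ : Rd d) :
    ‖fourierHat (f.conjReflect x).fn ξ‖ = ‖fourierHat f.fn ξ‖ := by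
  rw [hat_conjReflect, norm_mul, norm_character, one_mul, Complex.norm_conj]

theorem conjReflect_conjReflect (x : Rd d) (f : UltraSchwartz ω d) :
    (f.conjReflect x).conjReflect x = f :=
  ext_fn (funext fun t => by simp [fn_conjReflect])

theorem conjReflect_add (x : Rd d) (f g : UltraSchwartz ω d) :
    (f + g).conjReflect x = f.conjReflect x + g.conjReflect x :=
  ext_fn (funext fun t => by simp [fn_conjReflect])

theorem conjReflect_smul (x : Rd d) (c : ℂ) (f : UltraSchwartz ω d) :
    (c • f).conjReflect x = starRingEnd ℂ c • f.conjReflect x :=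
  ext_fn (funext fun t => by simp [fn_conjReflect])

theorem exists_level_conjReflect_le (ω : WeightFunction) (d n : ℕ) (x : Rd d) :
    ∃ m : ℕ, ∃ C : ℝ, 0 ≤ C ∧ ∀ f : UltraSchwartz ω d,
      level ω d n (f.conjReflect x) ≤ C * level ω d m f := by
  have hK := ω.one_le_subK
  obtain ⟨m, hm⟩ := exists_nat_ge ((n + 1 : ℝ) * ω.subK)
  have hnm : (n + 1 : ℝ) ≤ m + 1 := by
    have : (n + 1 : ℝ) ≤ (n + 1) * ω.subK := le_mul_of_one_le_right (by positivity) hK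
    linarith
  set D := Real.exp ((n + 1) * ω.subK) * Real.exp ((n + 1) * ω.subK * ω ‖x‖) with hD
  refine ⟨m, D + 1, by positivity, fun f => ?_⟩
  have h0 : 0 ≤ level ω d m f := apply_nonneg _ _
  rw [add_mul]
  refine level_le (fun t => ?_) fun ξ => ?_
  · rw [fn_conjReflect, Complex.norm_conj]
    calc ‖f.fn (x - t)‖ ≤ level ω d m f * Real.exp (-(m + 1) * ω ‖x - t‖) :=
          norm_fn_le_level m f _
      _ ≤ level ω d m f * (D * Real.exp (-(n + 1) * ω ‖t‖)) := by
          refine mul_le_mul_of_nonneg_left ?_ h0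
          have h1 := ω.exp_neg_shift (l := n + 1) (by positivity) t x
          rw [norm_sub_rev] at h1
          exact (exp_rate_le (by linarith) (ω.norm_nonneg' _)).trans h1
      _ = _ := by ring
  · rw [norm_hat_conjReflect, one_mul]
    exact (norm_hat_le_level m f ξ).trans
      (mul_le_mul_of_nonneg_left (exp_rate_le hnm (ω.norm_nonneg' _)) h0)

end UltraSchwartz

namespace UltraDistribution

open UltraSchwartz

variable {d : ℕ} {ω : WeightFunction}

/-- The seminorm `f ↦ |(a ∗ f)(x)| e^{μω(x)}`. -/
def convSeminorm (a : UltraDistribution ω d) (μ : ℝ) (x : Rd d) : Seminorm ℂ (UltraSchwartz ω d) :=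
  Seminorm.of (fun f => ‖a.conv f x‖ * Real.exp (μ * ω ‖x‖))
    (fun f g => by
      rw [conv, conjReflect_add, map_add, ← add_mul]
      exact mul_le_mul_of_nonneg_right (norm_add_le _ _) (Real.exp_nonneg _))
    (fun c f => by
      rw [conv, conjReflect_smul, map_smulₛₗ, norm_smul, mul_assoc]
      simp [conv])

/-- For a convolutor, the uniform boundedness principle makes the decay of `a ∗ f` uniform in `f`.
-/
theorem IsConvolutor.exists_norm_conv_le {a : UltraDistribution ω d} (h : a.IsConvolutor) {μ : ℝ}
    (hμ : 0 < μ) : ∃ n : ℕ, ∃ C : ℝ, 0 ≤ C ∧ ∀ f x,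
      ‖a.conv f x‖ ≤ C * level ω d n f * Real.exp (-μ * ω ‖x‖) := by
  have hb : BddAbove (Set.range (a.convSeminorm μ)) := by
    rw [Seminorm.bddAbove_range_iff]
    intro f
    have h1 := (h f).2.1.2 μ hμ 0
    simp only [multiDeriv_zero] at h1
    exact h1
  have hc : ∀ x, Continuous (a.convSeminorm μ x) := by
    intro x
    obtain ⟨n, C, hC, h1⟩ := a.exists_norm_le_level
    obtain ⟨m, D, hD, h2⟩ := exists_level_conjReflect_le ω d n x
    refine continuous_of_le_level (n := m) (C := C * D * Real.exp (μ * ω ‖x‖)) fun f => ?_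
    calc ‖a (f.conjReflect x)‖ * Real.exp (μ * ω ‖x‖)
        ≤ C * (D * level ω d m f) * Real.exp (μ * ω ‖x‖) := by
          gcongr
          exact (h1 _).trans (mul_le_mul_of_nonneg_left (h2 f) hC)
      _ = _ := by ring
  have hsup : Continuous (⨆ x, a.convSeminorm μ x : Seminorm ℂ (UltraSchwartz ω d)) := by
    rw [Seminorm.coe_iSup_eq hb]
    exact Seminorm.continuous_iSup _ hc hb
  obtain ⟨n, C, hC, h3⟩ := exists_le_level hsup
  refine ⟨n, C, hC, fun f x => ?_⟩
  rw [neg_mul, Real.exp_neg, ← div_eq_mul_inv, le_div_iff₀ (Real.exp_pos _)]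
  exact (le_ciSup hb x f).trans (h3 f)

/-- The value of `a` on an atom is `(a ∗ f)(x)`, where `f` is the reflected atom. -/
theorem IsConvolutor.exists_norm_apply_atom_le {a : UltraDistribution ω d} (h : a.IsConvolutor)
    (ψ : UltraSchwartz ω d) {μ : ℝ} (hμ : 0 < μ) : ∃ C : ℝ, 0 ≤ C ∧ ∃ lam : ℝ, 0 ≤ lam ∧
      ∀ (M L : List (Fin d)) (A B : ℝ),
        (∀ t : ℝ, 1 ≤ t → t ^ L.length ≤ A * Real.exp (μ * ω t)) →
        (∀ t : ℝ, 1 ≤ t → t ^ M.length ≤ B * Real.exp (μ * ω t)) → ∀ x ξ,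
        ‖a (ψ.atom M L (x, ξ))‖ ≤
          C * A * B * Real.exp (-μ * ω ‖x‖) * Real.exp (lam * ω ‖ξ‖) := by
  obtain ⟨c, hc, h1⟩ := ψ.exists_atom_le hμ
  -- the decay of `a ∗ f` compensates the loss `e^{cω(x)}` of the atoms
  obtain ⟨n, C, hC, h2⟩ := h.exists_norm_conv_le (show 0 < μ + c by positivity)
  obtain ⟨lam, hlam, D, hD, h3⟩ := h1 (n + 1) (by positivity)
  refine ⟨2 * C * D, by positivity, lam, hlam, fun M L A B hA hB x ξ => ?_⟩
  set f := (ψ.atom M L (x, ξ)).conjReflect x with hf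
  have h4 : level ω d n f ≤ 2 * (D * A * B * Real.exp (c * ω ‖x‖) * Real.exp (lam * ω ‖ξ‖)) := by
    refine level_le_two_mul (fun t => ?_) fun t => ?_
    · rw [hf, fn_conjReflect, Complex.norm_conj]
      have := (h3 M L A B hA hB x ξ (x - t)).1
      rwa [sub_sub_cancel] at this
    · rw [hf, norm_hat_conjReflect]
      exact (h3 M L A B hA hB x ξ t).2
  have h5 := h2 f x
  rw [conv, hf, conjReflect_conjReflect, ← hf] at h5
  refine h5.trans ?_
  have e : Real.exp (-μ * ω ‖x‖) = Real.exp (c * ω ‖x‖) * Real.exp (-(μ + c) * ω ‖x‖) := by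
    rw [← Real.exp_add]
    congr 1
    ring
  calc _ ≤ C * (2 * (D * A * B * Real.exp (c * ω ‖x‖) * Real.exp (lam * ω ‖ξ‖))) *
        Real.exp (-(μ + c) * ω ‖x‖) := by gcongr
    _ = _ := by
        rw [e]
        ring

end UltraDistribution

namespace WeightFunction

/-- The moment `tⁿ e^{-μω(t)}` with `t = e^s` is at most `e^{μφ*(n/μ)}`, directly by the definition
of the supremum `φ*(n/μ)`. -/
theorem ofReal_exp_le_exp_youngConj (ω : WeightFunction) {μ s : ℝ} (hμ : 0 < μ) (hs : 0 ≤ s)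
    (n : ℕ) : ENNReal.ofReal (Real.exp (s * n - μ * ω (Real.exp s))) ≤
      EReal.exp (μ * ω.youngConj (n / μ)) := by
  rw [← EReal.exp_coe]
  refine EReal.exp_monotone ?_
  have h1 : ((s * (n / μ) - ω (Real.exp s) : ℝ) : EReal) ≤ ω.youngConj (n / μ) :=
    le_iSup₂ (f := fun (s : ℝ) (_ : 0 ≤ s) => ((s * (n / μ) - ω (Real.exp s) : ℝ) : EReal)) s hs
  have h2 := mul_le_mul_of_nonneg_left h1 (show (0 : EReal) ≤ (μ : EReal) by exact_mod_cast hμ.le)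
  refine le_trans (le_of_eq ?_) h2
  rw [← EReal.coe_mul]
  congr 1
  field_simp

theorem exp_youngConj_ne_zero (ω : WeightFunction) {μ : ℝ} (hμ : 0 < μ) (n : ℕ) :
    EReal.exp (μ * ω.youngConj (n / μ)) ≠ 0 := by
  refine (lt_of_lt_of_le ?_ (ω.ofReal_exp_le_exp_youngConj hμ le_rfl n)).ne'
  exact ENNReal.ofReal_pos.2 (Real.exp_pos _)

theorem pow_le_exp_youngConj (ω : WeightFunction) {μ : ℝ} (hμ : 0 < μ) {n : ℕ}
    (hn : EReal.exp (μ * ω.youngConj (n / μ)) ≠ ⊤) {t : ℝ} (ht : 1 ≤ t) :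
    t ^ n ≤ (EReal.exp (μ * ω.youngConj (n / μ))).toReal * Real.exp (μ * ω t) := by
  have ht0 : 0 < t := by linarith
  have h := (ENNReal.ofReal_le_iff_le_toReal hn).1
    (ω.ofReal_exp_le_exp_youngConj hμ (Real.log_nonneg ht) n)
  rw [Real.exp_log ht0, Real.exp_sub, mul_comm, Real.exp_nat_mul, Real.exp_log ht0,
    div_le_iff₀ (Real.exp_pos _)] at h
  exact h

theorem exp_youngConj_zero_le (ω : WeightFunction) {μ : ℝ} (hμ : 0 < μ) :
    EReal.exp (μ * ω.youngConj 0) ≤ 1 := by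
  rw [← EReal.exp_zero]
  refine EReal.exp_monotone ?_
  have h1 : ω.youngConj 0 ≤ 0 := by
    refine iSup₂_le fun s _ => ?_
    have := ω.nonneg _ (Real.exp_pos s).le
    exact_mod_cast (by linarith : s * 0 - ω (Real.exp s) ≤ 0)
  exact mul_nonpos_of_nonneg_of_nonpos (by exact_mod_cast hμ.le) h1

end WeightFunction

namespace UltraDistribution

open UltraSchwartz

variable {d : ℕ} {ω : WeightFunction}

theorem IsConvolutor.exists_enorm_mixedDeriv_le {a : UltraDistribution ω d} (h : a.IsConvolutor)
    (ψ : UltraSchwartz ω d) {μ : ℝ} (hμ : 0 < μ) : ∃ C : ℝ, 0 < C ∧ ∃ l : ℝ, 0 < l ∧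
      ∀ (α β : Fin d → ℕ) (x ξ : Rd d),
        ‖mixedDeriv α β (a.stft ψ) x ξ‖ₑ ≤ ENNReal.ofReal C
          * EReal.exp (μ * ω.youngConj ((∑ i, α i : ℕ) / μ))
          * EReal.exp (μ * ω.youngConj ((∑ i, β i : ℕ) / μ))
          * ENNReal.ofReal (Real.exp (-μ * ω ‖x‖))
          * ENNReal.ofReal (Real.exp (l * ω ‖ξ‖)) := by
  obtain ⟨C, hC, lam, hlam, h1⟩ := h.exists_norm_apply_atom_le ψ hμ
  refine ⟨C + 1, by positivity, lam + 1, by positivity, fun α β x ξ => ?_⟩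
  have hC' : ENNReal.ofReal (C + 1) ≠ 0 := by
    simp only [ne_eq, ENNReal.ofReal_eq_zero, not_le]
    positivity
  have hpos : ∀ r, ENNReal.ofReal (Real.exp r) ≠ 0 := fun r => by
    simp only [ne_eq, ENNReal.ofReal_eq_zero, not_le]
    positivity
  have hα0 := ω.exp_youngConj_ne_zero hμ (∑ i, α i)
  have hβ0 := ω.exp_youngConj_ne_zero hμ (∑ i, β i)
  -- where `φ*` is infinite, so is the right-hand side, the other factors being positive
  rcases eq_or_ne (EReal.exp (μ * ω.youngConj ((∑ i, α i : ℕ) / μ))) ⊤ with hα | hα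
  · rw [hα, ENNReal.mul_top hC', ENNReal.top_mul hβ0, ENNReal.top_mul (hpos _),
      ENNReal.top_mul (hpos _)]
    exact le_top
  rcases eq_or_ne (EReal.exp (μ * ω.youngConj ((∑ i, β i : ℕ) / μ))) ⊤ with hβ | hβ
  · rw [hβ, ENNReal.mul_top (mul_ne_zero hC' hα0), ENNReal.top_mul (hpos _),
      ENNReal.top_mul (hpos _)]
    exact le_top
  have h2 := h1 (multiList β) (multiList α) _ _
    (fun t ht => by
      rw [multiList_length]
      exact ω.pow_le_exp_youngConj hμ hα ht)
    (fun t ht => by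
      rw [multiList_length]
      exact ω.pow_le_exp_youngConj hμ hβ ht) x ξ
  rw [← ofReal_norm, norm_mixedDeriv_stft]
  have hξ := ω.norm_nonneg' ξ
  rw [← ENNReal.ofReal_toReal hα, ← ENNReal.ofReal_toReal hβ]
  rw [← ENNReal.ofReal_mul (by positivity), ← ENNReal.ofReal_mul (by positivity),
    ← ENNReal.ofReal_mul (by positivity), ← ENNReal.ofReal_mul (by positivity)]
  refine ENNReal.ofReal_le_ofReal (h2.trans ?_)
  gcongr <;> linarith

/-- The estimate of the derivatives of order zero is the estimate of the function itself, since
`e^{μφ*(0)} ≤ 1`. -/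
theorem exists_norm_stft_le {a : UltraDistribution ω d} {ψ : UltraSchwartz ω d}
    (h : ∀ μ : ℝ, 0 < μ → ∃ C : ℝ, 0 < C ∧ ∃ l : ℝ, 0 < l ∧
      ∀ (α β : Fin d → ℕ) (x ξ : Rd d),
        ‖mixedDeriv α β (a.stft ψ) x ξ‖ₑ ≤ ENNReal.ofReal C
          * EReal.exp (μ * ω.youngConj ((∑ i, α i : ℕ) / μ))
          * EReal.exp (μ * ω.youngConj ((∑ i, β i : ℕ) / μ))
          * ENNReal.ofReal (Real.exp (-μ * ω ‖x‖))
          * ENNReal.ofReal (Real.exp (l * ω ‖ξ‖))) {μ : ℝ} (hμ : 0 < μ) :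
    ∃ C : ℝ, 0 < C ∧ ∃ l : ℝ, 0 < l ∧ ∀ x ξ : Rd d,
      ‖a.stft ψ x ξ‖ ≤ C * Real.exp (-μ * ω ‖x‖) * Real.exp (l * ω ‖ξ‖) := by
  obtain ⟨C, hC, l, hl, h1⟩ := h μ hμ
  refine ⟨C, hC, l, hl, fun x ξ => ?_⟩
  have h2 := h1 0 0 x ξ
  have e : mixedDeriv 0 0 (a.stft ψ) x ξ = a.stft ψ x ξ := by
    rw [mixedDeriv, multiDeriv_zero, multiDeriv_zero]
  have e0 : ((∑ i, (0 : Fin d → ℕ) i : ℕ) : ℝ) / μ = 0 := by simp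
  rw [e, e0] at h2
  have h3 := ω.exp_youngConj_zero_le hμ
  have h4 : ‖a.stft ψ x ξ‖ₑ ≤ ENNReal.ofReal C * 1 * 1 *
      ENNReal.ofReal (Real.exp (-μ * ω ‖x‖)) * ENNReal.ofReal (Real.exp (l * ω ‖ξ‖)) :=
    h2.trans (by gcongr)
  rw [mul_one, mul_one, ← ENNReal.ofReal_mul hC.le, ← ENNReal.ofReal_mul (by positivity),
    ← ofReal_norm, ENNReal.ofReal_le_ofReal_iff (by positivity)] at h4
  exact h4

end UltraDistribution

/-! ### Inversion of the short-time Fourier transform and decay of `a ∗ f` -/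

namespace UltraSchwartz

variable {d : ℕ} {ω : WeightFunction}

/-- The short-time Fourier transform of a function `g` of `S_ω` with window `ψ`. -/
def coeff (ψ g : UltraSchwartz ω d) (z : Rd d × Rd d) : ℂ :=
  fourierHat (fun t => g.fn t * starRingEnd ℂ (ψ.fn (t - z.1))) z.2

theorem continuous_character_uncurry : Continuous fun q : Rd d × Rd d => character q.1 q.2 := by
  unfold character
  fun_prop

theorem stronglyMeasurable_coeff (ψ g : UltraSchwartz ω d) : StronglyMeasurable (coeff ψ g) := by
  have h1 : Continuous fun p : (Rd d × Rd d) × Rd d =>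
      character (-p.1.2) p.2 * (g.fn p.2 * starRingEnd ℂ (ψ.fn (p.2 - p.1.1))) := by
    refine Continuous.mul ?_ (Continuous.mul ?_ ?_)
    · exact continuous_character_uncurry.comp (by fun_prop :
        Continuous fun p : (Rd d × Rd d) × Rd d => (-p.1.2, p.2))
    · exact g.tame.continuous.comp continuous_snd
    · exact Complex.continuous_conj.comp (ψ.tame.continuous.comp (by fun_prop))
  have h2 := h1.stronglyMeasurable.integral_prod_right' (ν := volume)
  have e : coeff ψ g = fun z : Rd d × Rd d =>
      ∫ t, character (-z.2) t * (g.fn t * starRingEnd ℂ (ψ.fn (t - z.1))) := by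
    funext z
    exact fourierHat_eq _ _
  rw [e]
  exact h2

/-- Up to a unimodular factor, `V_ψ g(y, η)` for `g = conj (f (x - ·))` is the short-time Fourier
transform of `conj f` at `(x - y, -η)` with the reflected window. -/
theorem exists_coeff_conjReflect_le (ψ f : UltraSchwartz ω d) {l κ : ℝ} (hl : 0 ≤ l)
    (hκ : 0 ≤ κ) : ∃ C, 0 ≤ C ∧ ∀ x y η, ‖coeff ψ (f.conjReflect x) (y, η)‖ ≤
      C * Real.exp (-l * ω ‖x - y‖) * Real.exp (-κ * ω ‖η‖) := by
  obtain ⟨C, hC, h⟩ := exists_stft_le ψ.tame.reflect.conj hl hκ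
  have h1 := h _ f.tame.conj
  refine ⟨C * (weightInt ω (2 * l * ω.subK) (fun t => starRingEnd ℂ (f.fn t)) +
    weightInt ω (2 * κ * ω.subK) (fourierHat fun t => starRingEnd ℂ (f.fn t))),
    mul_nonneg hC (add_nonneg (weightInt_nonneg _ _ _) (weightInt_nonneg _ _ _)), fun x y η => ?_⟩
  have h2 := h1 (x - y) (-η)
  rw [norm_neg] at h2
  refine le_trans (le_of_eq ?_) h2
  -- the substitution `t ↦ x - t`
  set k : Rd d → ℂ := fun t => starRingEnd ℂ (f.fn t) *
    starRingEnd ℂ (ψ.fn (-(t - (x - y)))) with hk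
  have e : (fun t => (f.conjReflect x).fn t * starRingEnd ℂ (ψ.fn (t - y))) =
      fun t => (fun s => k (-s)) (t - x) := by
    funext t
    simp only [hk, fn_conjReflect]
    congr 3 <;> abel
  rw [coeff]
  dsimp only
  rw [e, fourierHat_translate x (fun s => k (-s)), Pi.mul_apply, norm_mul, norm_character, one_mul,
    fourierHat_reflect]

theorem exists_phaseShift_le (ψ : UltraSchwartz ω d) {l : ℝ} (hl : 0 ≤ l) :
    ∃ C, 0 ≤ C ∧ ∀ x ξ t,
      ‖(ψ.phaseShift x ξ).fn t‖ ≤ C * Real.exp (l * ω.subK * ω ‖x‖) *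
        Real.exp (l * ω.subK * ω ‖ξ‖) * Real.exp (-l * ω ‖t‖) ∧
      ‖fourierHat (ψ.phaseShift x ξ).fn t‖ ≤ C * Real.exp (l * ω.subK * ω ‖x‖) *
        Real.exp (l * ω.subK * ω ‖ξ‖) * Real.exp (-l * ω ‖t‖) := by
  have hK := ω.subK_pos
  obtain ⟨A, hA, h1⟩ := ψ.tame.decay (l * ω.subK)
  obtain ⟨B, hB, h2⟩ := ψ.tame.hat_decay (l * ω.subK)
  have hone : ∀ x : Rd d, 1 ≤ Real.exp (l * ω.subK * ω ‖x‖) := fun x => by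
    have := ω.norm_nonneg' x
    exact Real.one_le_exp (by positivity)
  refine ⟨(A + B) * Real.exp (l * ω.subK), by positivity, fun x ξ t => ⟨?_, ?_⟩⟩
  · rw [fn_phaseShift, norm_mul, norm_character, one_mul]
    calc _ ≤ A * (Real.exp (l * ω.subK) * Real.exp (l * ω.subK * ω ‖x‖) * Real.exp (-l * ω ‖t‖)) :=
          (h1 _).trans (mul_le_mul_of_nonneg_left (ω.exp_neg_shift hl t x) hA)
      _ = A * Real.exp (l * ω.subK) * Real.exp (l * ω.subK * ω ‖x‖) * 1 *
          Real.exp (-l * ω ‖t‖) := by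
          ring
      _ ≤ _ := by
          gcongr
          · linarith
          · exact hone ξ
  · rw [hat_phaseShift]
    dsimp only
    rw [Pi.mul_apply, norm_mul, norm_character, one_mul]
    calc _ ≤ B * (Real.exp (l * ω.subK) * Real.exp (l * ω.subK * ω ‖ξ‖) * Real.exp (-l * ω ‖t‖)) :=
          (h2 _).trans (mul_le_mul_of_nonneg_left (ω.exp_neg_shift hl t ξ) hB)
      _ = B * Real.exp (l * ω.subK) * 1 * Real.exp (l * ω.subK * ω ‖ξ‖) *
          Real.exp (-l * ω ‖t‖) := by
          ring
      _ ≤ _ := by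
          gcongr
          · linarith
          · exact hone x

theorem exists_coeff_le (ψ g : UltraSchwartz ω d) {l κ : ℝ} (hl : 0 ≤ l) (hκ : 0 ≤ κ) :
    ∃ C, 0 ≤ C ∧ ∀ z, ‖coeff ψ g z‖ ≤
      C * Real.exp (-l * ω ‖z.1‖) * Real.exp (-κ * ω ‖z.2‖) := by
  obtain ⟨C, hC, h⟩ := exists_coeff_conjReflect_le ψ (g.conjReflect 0) hl hκ
  refine ⟨C, hC, fun z => ?_⟩
  have := h 0 z.1 z.2
  rwa [conjReflect_conjReflect, zero_sub, norm_neg] at this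

theorem integrable_exp_prod (ω : WeightFunction) (d : ℕ) : Integrable fun z : Rd d × Rd d =>
    Real.exp (-ω.intRate d * ω ‖z.1‖) * Real.exp (-ω.intRate d * ω ‖z.2‖) :=
  (ω.integrable_exp d).mul_prod (ω.integrable_exp d)

/-- The decay of `V_ψ g` outweighs the growth of the seminorms of `Π(y, η) ψ`, so the superposition
in the inversion formula converges absolutely for every weight `e^{lω}`. -/
theorem exists_coeff_smul_phaseShift_le (ψ g : UltraSchwartz ω d) (l : ℝ) :
    ∃ m : Rd d × Rd d → ℝ, Integrable m ∧ ∀ z t,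
      ‖(coeff ψ g z • ψ.phaseShift z.1 z.2).fn t‖ ≤ m z * Real.exp (-l * ω ‖t‖) ∧
      ‖fourierHat (coeff ψ g z • ψ.phaseShift z.1 z.2).fn t‖ ≤ m z * Real.exp (-l * ω ‖t‖) := by
  have hK := ω.subK_pos
  have hν := ω.intRate_pos d
  have hl0 : 0 ≤ max l 0 := le_max_right _ _
  obtain ⟨A, hA, h1⟩ := ψ.exists_phaseShift_le hl0
  obtain ⟨B, hB, h2⟩ := exists_coeff_le ψ g
    (show 0 ≤ max l 0 * ω.subK + ω.intRate d by positivity)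
    (show 0 ≤ max l 0 * ω.subK + ω.intRate d by positivity)
  refine ⟨fun z => A * B * (Real.exp (-ω.intRate d * ω ‖z.1‖) * Real.exp (-ω.intRate d * ω ‖z.2‖)),
    (integrable_exp_prod ω d).const_mul _, fun z t => ?_⟩
  have key : ∀ {r : ℝ}, r ≤ A * Real.exp (max l 0 * ω.subK * ω ‖z.1‖) *
      Real.exp (max l 0 * ω.subK * ω ‖z.2‖) * Real.exp (-max l 0 * ω ‖t‖) →
      ‖coeff ψ g z‖ * r ≤ A * B * (Real.exp (-ω.intRate d * ω ‖z.1‖) *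
        Real.exp (-ω.intRate d * ω ‖z.2‖)) * Real.exp (-l * ω ‖t‖) := by
    intro r hr
    have e : ∀ x : Rd d, Real.exp (-ω.intRate d * ω ‖x‖) =
        Real.exp (-(max l 0 * ω.subK + ω.intRate d) * ω ‖x‖) *
          Real.exp (max l 0 * ω.subK * ω ‖x‖) := by
      intro x
      rw [← Real.exp_add]
      congr 1
      ring
    calc ‖coeff ψ g z‖ * r ≤ ‖coeff ψ g z‖ * (A * Real.exp (max l 0 * ω.subK * ω ‖z.1‖) *
          Real.exp (max l 0 * ω.subK * ω ‖z.2‖) * Real.exp (-max l 0 * ω ‖t‖)) := by gcongr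
      _ ≤ (B * Real.exp (-(max l 0 * ω.subK + ω.intRate d) * ω ‖z.1‖) *
          Real.exp (-(max l 0 * ω.subK + ω.intRate d) * ω ‖z.2‖)) *
          (A * Real.exp (max l 0 * ω.subK * ω ‖z.1‖) *
          Real.exp (max l 0 * ω.subK * ω ‖z.2‖) * Real.exp (-l * ω ‖t‖)) := by
          gcongr ?_ * (_ * ?_)
          · exact h2 z
          · exact exp_rate_le (le_max_left _ _) (ω.norm_nonneg' t)
      _ = _ := by
          rw [e z.1, e z.2]
          ring
  obtain ⟨b1, b2⟩ := h1 z.1 z.2 t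
  constructor
  · rw [fn_smul, Pi.smul_apply, norm_smul]
    exact key b1
  · rw [fn_smul, fourierHat_smul, Pi.smul_apply, norm_smul]
    exact key b2

theorem stronglyMeasurable_coeff_smul_phaseShift (ψ g : UltraSchwartz ω d) :
    StronglyMeasurable (Function.uncurry fun z t => (coeff ψ g z • ψ.phaseShift z.1 z.2).fn t) := by
  have h2 : Continuous fun p : (Rd d × Rd d) × Rd d =>
      character p.1.2 p.2 * ψ.fn (p.2 - p.1.1) := by
    refine Continuous.mul ?_ (ψ.tame.continuous.comp (by fun_prop))
    exact continuous_character_uncurry.comp (by fun_prop :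
      Continuous fun p : (Rd d × Rd d) × Rd d => (p.1.2, p.2))
  exact ((stronglyMeasurable_coeff ψ g).comp_measurable measurable_fst).mul h2.stronglyMeasurable

/-- The inversion formula for the short-time Fourier transform on `S_ω`. -/
theorem integral_coeff_smul_phaseShift (ψ g : UltraSchwartz ω d) (t : Rd d) :
    ∫ z, (coeff ψ g z • ψ.phaseShift z.1 z.2).fn t =
      (((2 * Real.pi) ^ d * ∫ y, ‖ψ.fn y‖ ^ 2 : ℝ) : ℂ) * g.fn t := by
  have hi : Integrable fun z => (coeff ψ g z • ψ.phaseShift z.1 z.2).fn t := by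
    obtain ⟨m, hm, h⟩ := exists_coeff_smul_phaseShift_le ψ g 0
    refine hm.mono' ?_ (Eventually.of_forall fun z => ?_)
    · exact ((stronglyMeasurable_coeff_smul_phaseShift ψ g).comp_measurable
        (g := fun z => (z, t)) (by fun_prop)).aestronglyMeasurable
    · simpa using (h z t).1
  rw [Measure.volume_eq_prod] at hi ⊢
  rw [integral_prod _ hi]
  have hin : ∀ y, ∫ η, (coeff ψ g (y, η) • ψ.phaseShift y η).fn t =
      (2 * Real.pi : ℂ) ^ d * g.fn t * ((‖ψ.fn (t - y)‖ ^ 2 : ℝ) : ℂ) := by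
    intro y
    have hT : Tame ω fun t => g.fn t * starRingEnd ℂ (ψ.fn (t - y)) :=
      g.tame.mul_translate ψ.tame.conj y
    have h1 := hT.hat_hat (-t)
    rw [neg_neg, fourierHat_eq, neg_neg] at h1
    calc _ = ∫ η, (character t η * fourierHat (fun t => g.fn t * starRingEnd ℂ (ψ.fn (t - y))) η) *
          ψ.fn (t - y) := by
          congr 1
          funext η
          rw [fn_smul, Pi.smul_apply, smul_eq_mul, fn_phaseShift, coeff, character, character,
            real_inner_comm]
          ring
      _ = _ := by
          rw [integral_mul_const, h1, mul_assoc, mul_assoc, mul_comm (starRingEnd ℂ _),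
            Complex.mul_conj, Complex.normSq_eq_norm_sq, mul_assoc]
  simp only [hin]
  rw [integral_const_mul, integral_complex_ofReal, integral_sub_left_eq_self
    (fun y => ‖ψ.fn y‖ ^ 2) volume t]
  push_cast
  ring

theorem integral_norm_sq_pos {ψ : UltraSchwartz ω d} (hψ : ψ ≠ 0) : 0 < ∫ y, ‖ψ.fn y‖ ^ 2 := by
  have hc : Continuous fun y => ‖ψ.fn y‖ ^ 2 := ψ.tame.continuous.norm.pow 2
  obtain ⟨C, hC, h⟩ := ψ.tame.decay 0
  have hi : Integrable fun y => ‖ψ.fn y‖ ^ 2 := by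
    refine (ψ.tame.integrable.norm.const_mul C).mono' hc.aestronglyMeasurable
      (Eventually.of_forall fun y => ?_)
    rw [Real.norm_of_nonneg (by positivity), sq]
    have := h y
    rw [neg_zero, zero_mul, Real.exp_zero, mul_one] at this
    gcongr
  rw [integral_pos_iff_support_of_nonneg (fun y => by positivity) hi]
  refine hc.isOpen_support.measure_pos _ ?_
  by_contra hne
  rw [Set.not_nonempty_iff_eq_empty, Function.support_eq_empty_iff] at hne
  refine hψ (ext_fn (funext fun y => ?_))
  have := congrFun hne y
  simpa using this

end UltraSchwartz

namespace UltraDistribution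

open UltraSchwartz

variable {d : ℕ} {ω : WeightFunction}

/-- The inversion formula under the functional `a`. -/
theorem integral_conj_coeff_mul_stft (a : UltraDistribution ω d) (ψ g : UltraSchwartz ω d) :
    (((2 * Real.pi) ^ d * ∫ y, ‖ψ.fn y‖ ^ 2 : ℝ) : ℂ) * a g =
      ∫ z, starRingEnd ℂ (coeff ψ g z) * a.stft ψ z.1 z.2 := by
  have h := a.apply_integral (Φ := fun z => coeff ψ g z • ψ.phaseShift z.1 z.2)
    (F := (((2 * Real.pi) ^ d * ∫ y, ‖ψ.fn y‖ ^ 2 : ℝ) : ℂ) • g) (ν := volume)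
    (stronglyMeasurable_coeff_smul_phaseShift ψ g) (exists_coeff_smul_phaseShift_le ψ g)
    (fun t => (integral_coeff_smul_phaseShift ψ g t).symm)
  rw [map_smulₛₗ, Complex.conj_ofReal, smul_eq_mul] at h
  rw [h]
  congr 1
  funext z
  rw [map_smulₛₗ, smul_eq_mul]
  rfl

/-- Decay of the short-time Fourier transform of `a` gives decay of `a ∗ f`. -/
theorem rapidDecay_conv {a : UltraDistribution ω d} {ψ : UltraSchwartz ω d} (hψ : ψ ≠ 0)
    (h : ∀ μ : ℝ, 0 < μ → ∃ C : ℝ, 0 < C ∧ ∃ l : ℝ, 0 < l ∧ ∀ x ξ : Rd d,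
      ‖a.stft ψ x ξ‖ ≤ C * Real.exp (-μ * ω ‖x‖) * Real.exp (l * ω ‖ξ‖))
    (f : UltraSchwartz ω d) : RapidDecay ω (a.conv f) := by
  refine RapidDecay.of_nonneg fun l hl => ?_
  have hK := ω.subK_pos
  have hν := ω.intRate_pos d
  set ν := ω.intRate d with hνdef
  set c : ℝ := (2 * Real.pi) ^ d * ∫ y, ‖ψ.fn y‖ ^ 2 with hc
  have hc0 : 0 < c := mul_pos (by positivity) (integral_norm_sq_pos hψ)
  obtain ⟨A, hA, lam, hlam, h1⟩ := h (l * ω.subK + ν) (by positivity)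
  obtain ⟨B, hB, h2⟩ := exists_coeff_conjReflect_le ψ f (show 0 ≤ l * ω.subK by positivity)
    (show 0 ≤ lam + ν by positivity)
  set J := ∫ z : Rd d × Rd d, Real.exp (-ν * ω ‖z.1‖) * Real.exp (-ν * ω ‖z.2‖) with hJ
  refine ⟨c⁻¹ * (A * B * Real.exp (l * ω.subK) * J), fun x => ?_⟩
  have h3 := congrArg norm (a.integral_conj_coeff_mul_stft ψ (f.conjReflect x))
  rw [← hc, norm_mul, Complex.norm_real, Real.norm_of_nonneg hc0.le] at h3
  have h4 : ‖∫ z, starRingEnd ℂ (coeff ψ (f.conjReflect x) z) * a.stft ψ z.1 z.2‖ ≤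
      A * B * Real.exp (l * ω.subK) * Real.exp (-l * ω ‖x‖) * J := by
    rw [hJ, ← integral_const_mul]
    refine norm_integral_le_of_norm_le ((integrable_exp_prod ω d).const_mul _)
      (Eventually.of_forall fun z => ?_)
    rw [norm_mul, Complex.norm_conj]
    have e1 : Real.exp (-ν * ω ‖z.1‖) =
        Real.exp (l * ω.subK * ω ‖z.1‖) * Real.exp (-(l * ω.subK + ν) * ω ‖z.1‖) := by
      rw [← Real.exp_add]
      congr 1
      ring
    have e2 : Real.exp (-ν * ω ‖z.2‖) =
        Real.exp (-(lam + ν) * ω ‖z.2‖) * Real.exp (lam * ω ‖z.2‖) := by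
      rw [← Real.exp_add]
      congr 1
      ring
    calc _ ≤ (B * (Real.exp (l * ω.subK) * Real.exp (l * ω.subK * ω ‖z.1‖) *
          Real.exp (-l * ω ‖x‖)) * Real.exp (-(lam + ν) * ω ‖z.2‖)) *
          (A * Real.exp (-(l * ω.subK + ν) * ω ‖z.1‖) * Real.exp (lam * ω ‖z.2‖)) := by
          refine mul_le_mul ((h2 x z.1 z.2).trans ?_) (h1 z.1 z.2) (norm_nonneg _) (by positivity)
          gcongr
          exact ω.exp_neg_shift hl.le x z.1
      _ = _ := by
          rw [e1, e2]
          ring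
  rw [← h3] at h4
  rw [mul_assoc, ← div_eq_inv_mul, le_div_iff₀' hc0]
  refine h4.trans (le_of_eq ?_)
  ring

end UltraDistribution

/-! ### Decay of the Fourier transform of `a ∗ f` -/

theorem fourierHat_convolution {d : ℕ} {f g : Rd d → ℂ} (hf : Integrable f) (hg : Integrable g)
    (ξ : Rd d) :
    fourierHat (fun x => ∫ s, f s * g (x - s)) ξ = fourierHat f ξ * fourierHat g ξ := by
  simp only [fourierHat_eq_fourier]
  exact Real.fourier_mul_convolution_eq hf hg _

theorem two_pi_pow_ne_zero (d : ℕ) : (2 * Real.pi : ℂ) ^ d ≠ 0 :=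
  pow_ne_zero d (mul_ne_zero two_ne_zero (by exact_mod_cast Real.pi_ne_zero))

namespace UltraSchwartz

variable {d : ℕ} {ω : WeightFunction}

theorem hat_mul_hat_tame (f g : UltraSchwartz ω d) :
    Tame ω fun t => fourierHat f.fn t * fourierHat g.fn t := by
  simpa using f.tame.hat.mul_translate g.tame.hat 0

/-- The convolution of two elements of `S_ω`, multiplied by `(2π)^d`, as the Fourier transform of
the product of their Fourier transforms. -/
def scaledConv (f g : UltraSchwartz ω d) : UltraSchwartz ω d :=
  ofTame (f.hat_mul_hat_tame g).hat.reflect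

theorem scaledConv_comm (f g : UltraSchwartz ω d) : f.scaledConv g = g.scaledConv f :=
  ext_fn (by
    funext x
    simp only [scaledConv, fn_ofTame]
    congr 1
    funext t
    exact mul_comm _ _)

theorem fn_scaledConv (f g : UltraSchwartz ω d) (x : Rd d) :
    (f.scaledConv g).fn x = (2 * Real.pi : ℂ) ^ d * ∫ s, f.fn s * g.fn (x - s) := by
  have hpi := two_pi_pow_ne_zero d
  have h := fourierHat_mul f.tame.hat.continuous f.tame.hat.integrable f.tame.hat.hat_integrable
    g.tame.hat.integrable (-x)
  have e : ∀ η, fourierHat (fourierHat f.fn) η * fourierHat (fourierHat g.fn) (-x - η) =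
      (2 * Real.pi : ℂ) ^ d * ((2 * Real.pi : ℂ) ^ d * (f.fn (-η) * g.fn (x - -η))) := by
    intro η
    rw [f.tame.hat_hat, g.tame.hat_hat, show -(-x - η) = x - -η by abel]
    ring
  simp only [e] at h
  rw [integral_const_mul, mul_right_inj' hpi, integral_const_mul,
    integral_neg_eq_self (fun η => f.fn η * g.fn (x - η))] at h
  exact h

theorem conjReflect_eq_phaseShift (x : Rd d) (f : UltraSchwartz ω d) :
    f.conjReflect x = (f.conjReflect 0).phaseShift x 0 :=
  ext_fn (funext fun t => by simp [fn_conjReflect, fn_phaseShift, character])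

end UltraSchwartz

namespace UltraDistribution

open UltraSchwartz

variable {d : ℕ} {ω : WeightFunction}

theorem continuous_conv (a : UltraDistribution ω d) (f : UltraSchwartz ω d) :
    Continuous (a.conv f) := by
  have e : a.conv f = fun x => a.stft (f.conjReflect 0) x 0 :=
    funext fun x => congrArg a (conjReflect_eq_phaseShift x f)
  rw [e]
  exact (a.contDiff_stft _).continuous.comp (f := fun x : Rd d => (x, (0 : Rd d))) (by fun_prop)

/-- A superposition of the functions `conj (f (s - ·))` is mapped to the superposition of the values
`(a ∗ f)(s)`. -/
theorem apply_integral_conjReflect (a : UltraDistribution ω d) {h f F : UltraSchwartz ω d}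
    (hF : ∀ t, F.fn t = ∫ s, h.fn s * starRingEnd ℂ (f.fn (s - t))) :
    a F = ∫ s, starRingEnd ℂ (h.fn s) * a.conv f s := by
  have key := a.apply_integral (Φ := fun s => h.fn s • f.conjReflect s) (F := F) (ν := volume)
    ?_ ?_ hF
  · rw [key]
    congr 1
    funext s
    rw [map_smulₛₗ, smul_eq_mul]
    rfl
  · have hc : Continuous fun p : Rd d × Rd d => h.fn p.1 * starRingEnd ℂ (f.fn (p.1 - p.2)) :=
      (h.tame.continuous.comp continuous_fst).mul
        (Complex.continuous_conj.comp (f.tame.continuous.comp (by fun_prop)))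
    exact hc.stronglyMeasurable
  · intro l
    have hl0 : 0 ≤ max l 0 := le_max_right _ _
    obtain ⟨A, hA, h1⟩ := f.tame.decay (max l 0 * ω.subK)
    obtain ⟨B, hB, h2⟩ := f.tame.hat_decay (max l 0)
    have hlt : ∀ t : Rd d, Real.exp (-max l 0 * ω ‖t‖) ≤ Real.exp (-l * ω ‖t‖) := fun t =>
      exp_rate_le (le_max_left _ _) (ω.norm_nonneg' t)
    refine ⟨fun s => A * Real.exp (max l 0 * ω.subK) *
      (‖h.fn s‖ * Real.exp (max l 0 * ω.subK * ω ‖s‖)) + B * ‖h.fn s‖, ?_, fun s t => ⟨?_, ?_⟩⟩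
    · exact ((h.tame.decay.integrable_weight h.tame.continuous.aestronglyMeasurable _).const_mul
        _).add (h.tame.integrable.norm.const_mul _)
    · rw [fn_smul, Pi.smul_apply, norm_smul, fn_conjReflect, Complex.norm_conj, add_mul]
      refine le_add_of_le_of_nonneg ?_ (by positivity)
      have h3 := ω.exp_neg_shift hl0 t s
      rw [norm_sub_rev] at h3
      calc _ ≤ ‖h.fn s‖ * (A * (Real.exp (max l 0 * ω.subK) *
            Real.exp (max l 0 * ω.subK * ω ‖s‖) * Real.exp (-l * ω ‖t‖))) := by
            gcongr
            refine (h1 _).trans (mul_le_mul_of_nonneg_left (h3.trans ?_) hA)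
            gcongr ?_ * ?_
            exact hlt t
        _ = _ := by ring
    · rw [fn_smul, fourierHat_smul, Pi.smul_apply, norm_smul, norm_hat_conjReflect, add_mul]
      refine le_add_of_nonneg_of_le (by positivity) ?_
      calc _ ≤ ‖h.fn s‖ * (B * Real.exp (-l * ω ‖t‖)) := by
            gcongr
            exact (h2 t).trans (mul_le_mul_of_nonneg_left (hlt t) hB)
        _ = _ := by ring

/-- The associativity `(a ∗ f) ∗ g = a ∗ (f ∗ g)`. -/
theorem integral_conv_mul (a : UltraDistribution ω d) (f g : UltraSchwartz ω d) (x : Rd d) :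
    (2 * Real.pi : ℂ) ^ d * ∫ s, a.conv f s * g.fn (x - s) = a.conv (f.scaledConv g) x := by
  have hpi : starRingEnd ℂ ((2 * Real.pi : ℂ) ^ d) = (2 * Real.pi : ℂ) ^ d := by
    rw [map_pow, map_mul, Complex.conj_ofReal, Complex.conj_ofNat]
  rw [conv, a.apply_integral_conjReflect (h := (2 * Real.pi : ℂ) ^ d • g.conjReflect x) (f := f),
    ← integral_const_mul]
  · congr 1
    funext s
    rw [fn_smul, Pi.smul_apply, smul_eq_mul, map_mul, hpi, fn_conjReflect, Complex.conj_conj]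
    ring
  · intro t
    rw [fn_conjReflect, fn_scaledConv, map_mul, hpi, ← integral_conj, ← integral_const_mul,
      ← integral_sub_right_eq_self _ t]
    congr 1
    funext s
    rw [fn_smul, Pi.smul_apply, smul_eq_mul, fn_conjReflect, map_mul,
      show x - t - (s - t) = x - s by abel]
    ring

/-- The Fourier transforms of `a ∗ f` and `a ∗ g` are proportional to those of `f` and `g`. -/
theorem hat_conv_mul_hat (a : UltraDistribution ω d) {f g : UltraSchwartz ω d}
    (hf : Integrable (a.conv f)) (hg : Integrable (a.conv g)) (ξ : Rd d) :
    fourierHat (a.conv f) ξ * fourierHat g.fn ξ = fourierHat (a.conv g) ξ * fourierHat f.fn ξ := by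
  have hpi := two_pi_pow_ne_zero d
  rw [← fourierHat_convolution hf g.tame.integrable, ← fourierHat_convolution hg f.tame.integrable]
  congr 1
  funext x
  refine mul_left_cancel₀ hpi ?_
  rw [integral_conv_mul, integral_conv_mul, scaledConv_comm]

/-- Convolution with the modulated and reflected window is the short-time Fourier transform. -/
theorem norm_conv_conjReflect_phaseShift (a : UltraDistribution ω d) (ψ : UltraSchwartz ω d)
    (x η : Rd d) : ‖a.conv ((ψ.phaseShift 0 η).conjReflect 0) x‖ = ‖a.stft ψ x η‖ := by
  have e : ((ψ.phaseShift 0 η).conjReflect 0).conjReflect x =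
      character (-η) x • ψ.phaseShift x η := by
    refine ext_fn (funext fun t => ?_)
    rw [fn_smul, Pi.smul_apply, smul_eq_mul, fn_conjReflect, fn_conjReflect, Complex.conj_conj,
      fn_phaseShift, fn_phaseShift, ← mul_assoc, sub_zero,
      show (0 : Rd d) - (x - t) = t - x by abel]
    congr 1
    simp only [character, ← Complex.exp_add]
    congr 1
    rw [inner_sub_left, inner_neg_right]
    push_cast
    ring
  rw [conv, e, map_smulₛₗ, norm_smul, Complex.norm_conj, norm_character, one_mul]
  rfl

theorem norm_hat_conjReflect_phaseShift (ψ : UltraSchwartz ω d) (η ξ : Rd d) :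
    ‖fourierHat ((ψ.phaseShift 0 η).conjReflect 0).fn ξ‖ = ‖fourierHat ψ.fn (ξ - η)‖ := by
  rw [norm_hat_conjReflect, hat_phaseShift]
  simp [norm_character]

theorem exists_hat_ne_zero {ψ : UltraSchwartz ω d} (hψ : ψ ≠ 0) : ∃ ζ, fourierHat ψ.fn ζ ≠ 0 := by
  by_contra! h
  refine hψ (ext_fn (funext fun t => ?_))
  have h1 := ψ.tame.norm_hat_hat (-t)
  rw [show fourierHat ψ.fn = 0 from funext h, neg_neg] at h1
  have h2 : fourierHat (0 : Rd d → ℂ) (-t) = 0 := by simp [fourierHat]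
  rw [h2, norm_zero] at h1
  have h3 : (2 * Real.pi) ^ d ≠ 0 := by positivity
  simpa [h3] using h1.symm

/-- The decay of `a ∗ f` comes from the inversion formula. That of its Fourier transform comes from
`hat_conv_mul_hat`, applied with the window modulated by a frequency that moves with `ξ`. -/
theorem isConvolutor_of_stft_le {a : UltraDistribution ω d} {ψ : UltraSchwartz ω d} (hψ : ψ ≠ 0)
    (h : ∀ μ : ℝ, 0 < μ → ∃ C : ℝ, 0 < C ∧ ∃ l : ℝ, 0 < l ∧ ∀ x ξ : Rd d,
      ‖a.stft ψ x ξ‖ ≤ C * Real.exp (-μ * ω ‖x‖) * Real.exp (l * ω ‖ξ‖)) : a.IsConvolutor := by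
  intro f
  have hint : ∀ g, Integrable (a.conv g) := fun g =>
    (rapidDecay_conv hψ h g).integrable (a.continuous_conv g).aestronglyMeasurable
  refine mem_ultraSubmodule_iff.2 ⟨a.continuous_conv f, rapidDecay_conv hψ h f, ?_⟩
  refine RapidDecay.of_nonneg fun l hl => ?_
  obtain ⟨ζ, hζ⟩ := exists_hat_ne_zero hψ
  have hζ0 : 0 < ‖fourierHat ψ.fn ζ‖ := norm_pos_iff.2 hζ
  obtain ⟨C, hC, lam, hlam, h1⟩ := h (ω.intRate d) (ω.intRate_pos d)
  have hK := ω.subK_pos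
  obtain ⟨A, hA, h2⟩ := f.tame.hat_decay (l + lam * ω.subK)
  set J := ∫ x : Rd d, Real.exp (-ω.intRate d * ω ‖x‖) with hJ
  have hJ0 : 0 ≤ J := integral_nonneg fun x => by positivity
  refine ⟨‖fourierHat ψ.fn ζ‖⁻¹ * (C * J * Real.exp (lam * ω.subK * (ω ‖ζ‖ + 1)) * A), fun ξ => ?_⟩
  -- the modulation is chosen so that the factor on the left does not depend on `ξ`
  have h3 := congrArg norm (a.hat_conv_mul_hat (hint f)
    (hint ((ψ.phaseShift 0 (ξ - ζ)).conjReflect 0)) ξ)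
  rw [norm_mul, norm_mul, norm_hat_conjReflect_phaseShift, sub_sub_cancel] at h3
  have h4 : ‖fourierHat (a.conv ((ψ.phaseShift 0 (ξ - ζ)).conjReflect 0)) ξ‖ ≤
      C * J * Real.exp (lam * ω ‖ξ - ζ‖) := by
    refine (norm_fourierHat_le _ _).trans ?_
    simp only [norm_conv_conjReflect_phaseShift]
    have e : C * J * Real.exp (lam * ω ‖ξ - ζ‖) =
        ∫ x : Rd d, C * Real.exp (lam * ω ‖ξ - ζ‖) * Real.exp (-ω.intRate d * ω ‖x‖) := by
      rw [integral_const_mul, ← hJ]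
      ring
    rw [e]
    refine integral_mono_of_nonneg (Eventually.of_forall fun _ => norm_nonneg _)
      ((ω.integrable_exp d).const_mul _) (Eventually.of_forall fun x => ?_)
    exact (h1 x (ξ - ζ)).trans (le_of_eq (by ring))
  have h5 : Real.exp (lam * ω ‖ξ - ζ‖) ≤
      Real.exp (lam * ω.subK * (ω ‖ζ‖ + 1)) * Real.exp (lam * ω.subK * ω ‖ξ‖) := by
    rw [← Real.exp_add]
    refine Real.exp_le_exp.2 ?_
    nlinarith [mul_le_mul_of_nonneg_left (ω.norm_sub_le_subK ξ ζ) hlam.le]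
  have e : Real.exp (-l * ω ‖ξ‖) =
      Real.exp (lam * ω.subK * ω ‖ξ‖) * Real.exp (-(l + lam * ω.subK) * ω ‖ξ‖) := by
    rw [← Real.exp_add]
    congr 1
    ring
  have h6 : ‖fourierHat (a.conv f) ξ‖ * ‖fourierHat ψ.fn ζ‖ ≤
      C * J * (Real.exp (lam * ω.subK * (ω ‖ζ‖ + 1)) * Real.exp (lam * ω.subK * ω ‖ξ‖)) *
        (A * Real.exp (-(l + lam * ω.subK) * ω ‖ξ‖)) := by
    rw [h3]
    refine mul_le_mul (h4.trans ?_) (h2 ξ) (norm_nonneg _) (by positivity)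
    gcongr
  rw [← le_div_iff₀ hζ0] at h6
  refine h6.trans (le_of_eq ?_)
  rw [e, div_eq_inv_mul]
  ring

end UltraDistribution

end

theorem mainTheorem5 (ω : WeightFunction) (d : ℕ) (a : UltraDistribution ω d)
    (ψ : UltraSchwartz ω d) (hψ : ψ ≠ 0) :
    List.TFAE [
      a.IsConvolutor,
      ContDiff ℝ (⊤ : ℕ∞) (fun z : Rd d × Rd d => a.stft ψ z.1 z.2) ∧
        ∀ μ : ℝ, 0 < μ → ∃ C : ℝ, 0 < C ∧ ∃ l : ℝ, 0 < l ∧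
          ∀ (α β : Fin d → ℕ) (x ξ : Rd d),
            ‖UltraDistribution.mixedDeriv α β (a.stft ψ) x ξ‖ₑ ≤
              ENNReal.ofReal C
                * EReal.exp (μ * ω.youngConj ((∑ i, α i : ℕ) / μ))
                * EReal.exp (μ * ω.youngConj ((∑ i, β i : ℕ) / μ))
                * ENNReal.ofReal (Real.exp (-μ * ω ‖x‖))
                * ENNReal.ofReal (Real.exp (l * ω ‖ξ‖)),
      ∀ μ : ℝ, 0 < μ → ∃ C : ℝ, 0 < C ∧ ∃ l : ℝ, 0 < l ∧
        ∀ x ξ : Rd d,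
          ‖a.stft ψ x ξ‖ ≤ C * Real.exp (-μ * ω ‖x‖) * Real.exp (l * ω ‖ξ‖)] := by
  tfae_have 1 → 2 := fun h => ⟨a.contDiff_stft ψ, fun _ hμ => h.exists_enorm_mixedDeriv_le ψ hμ⟩
  tfae_have 2 → 3 := fun h _ hμ => UltraDistribution.exists_norm_stft_le h.2 hμ
  tfae_have 3 → 1 := UltraDistribution.isConvolutor_of_stft_le hψ
  tfae_finish
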